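/- For $n\ge 6$ let $$k=k(n)=\begin{cases}4m & \text{if } 2^{2m-1}<n\le 2^{2m},\\ 4m+2 & \text{if } 2^{2m}<n\le 2^{2m}+2^m,\\ 4m+3 & \text{if } 2^{2m}+2^m<n\le 2^{2m+1},\end{cases}\qquad (m\ge 1).$$ A $t$-cubature formula for a probability measure $\mu$ on $\mathbb{R}^n$ is a finite set $F\subset\mathbb{R}^n$ with weights $w_p\in\mathbb{R}$ ($p\in F$) such that $\int P\,d\mu=\sum_{p\in F}w_pP(p)$ for every real polynomial $P$ of degree at most $t$. It is positive if all $w_p>0$, and interior if every $p\in F$ lies in the interior of the support $X$ of $\mu$, where the interior is taken in the sense of geometric topology: the points of $X$ that have a neighbourhood in $X$ homeomorphic to an open subset of some $\mathbb{R}^d$ (so it is the whole sphere for a sphere, and the open ball for a closed ball). A family of cubature formulas indexed by $n$ is quasilinear if a single program for a real random access machine (exact real arithmetic $+,-,\times,/,\sqrt{\ }$ and comparisons, addition, subtraction and comparison of natural numbers, and indirect addressing, each at unit cost), given $n$, lists the coordinates and the weight of every point of the $n$-th formula, each point exactly once, in time at most $f(L)$, where $L$ is the length of the output (the number of reals listed)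 and $f(L)=O((\log L)^\alpha L)$ for some $\alpha$. Then each of the following families, $n\ge 6$, admits a quasilinear family of positive, interior $5$-cubature formulas with exactly $2^{k(n)}+2n$ points: the unit sphere $S^{n-1}\subset\mathbb{R}^n$ with its uniform probability measure; $\mathbb{R}^n$ with the standard Gaussian measure; and the unit ball $B_n\subset\mathbb{R}^n$ with its uniform probability measure. -/

import Mathlib

open MeasureTheory

noncomputable section

namespace Cubature

/-! ### Cubature formulas -/

/-- A finite set of points of `ℝⁿ` together with a real weight for each point. (The values of
`weight` outside `points` play no role.) -/
structure Formula (n : ℕ) where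
  points : Finset (EuclideanSpace ℝ (Fin n))
  weight : EuclideanSpace ℝ (Fin n) → ℝ

/-- The value at `x ∈ ℝⁿ` of a polynomial in `n` variables. -/
def polyValue {n : ℕ} (P : MvPolynomial (Fin n) ℝ) (x : EuclideanSpace ℝ (Fin n)) : ℝ :=
  MvPolynomial.eval (fun i => x i) P

/-- `F` is a `t`-cubature formula for `μ`: it integrates every polynomial of degree at most `t`
exactly (and these polynomials are integrable). -/
def Formula.IsCubature {n : ℕ} (F : Formula n) (t : ℕ)
    (μ : Measure (EuclideanSpace ℝ (Fin n))) : Prop :=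
  ∀ P : MvPolynomial (Fin n) ℝ, P.totalDegree ≤ t →
    Integrable (polyValue P) μ ∧
      ∫ x, polyValue P x ∂μ = ∑ p ∈ F.points, F.weight p * polyValue P p

/-- All weights are positive. -/
def Formula.IsPositive {n : ℕ} (F : Formula n) : Prop :=
  ∀ p ∈ F.points, 0 < F.weight p

/-- The interior of `X ⊆ ℝⁿ` in the sense of geometric topology: the points of `X` that have a
neighbourhood in `X` homeomorphic to an open subset of some `ℝᵈ`. For a manifold with boundary
these are the points that do not lie on the boundary; thus every point of the sphere `Sⁿ⁻¹` is
interior, and the interior of the closed ball is the open ball. -/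
def geomInterior {n : ℕ} (X : Set (EuclideanSpace ℝ (Fin n))) :
    Set (EuclideanSpace ℝ (Fin n)) :=
  {x | ∃ hx : x ∈ X, ∃ (d : ℕ) (e : OpenPartialHomeomorph X (EuclideanSpace ℝ (Fin d))),
    (⟨x, hx⟩ : X) ∈ e.source}

/-- Every point lies in the interior of the support of `μ`. -/
def Formula.IsInterior {n : ℕ} (F : Formula n) (μ : Measure (EuclideanSpace ℝ (Fin n))) : Prop :=
  ∀ p ∈ F.points, p ∈ geomInterior μ.support

/-! ### The three measures -/

/-- The uniform probability measure on the unit sphere `Sⁿ⁻¹ ⊆ ℝⁿ`. -/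
def sphereMeasure (n : ℕ) : Measure (EuclideanSpace ℝ (Fin n)) :=
  ((volume : Measure (EuclideanSpace ℝ (Fin n))).toSphere Set.univ)⁻¹ •
    (volume : Measure (EuclideanSpace ℝ (Fin n))).toSphere.map Subtype.val

/-- The standard Gaussian probability measure on `ℝⁿ`. -/
def gaussianMeasure (n : ℕ) : Measure (EuclideanSpace ℝ (Fin n)) :=
  ProbabilityTheory.stdGaussian (EuclideanSpace ℝ (Fin n))

/-- The uniform probability measure on the closed unit ball `Bₙ ⊆ ℝⁿ`. -/
def ballMeasure (n : ℕ) : Measure (EuclideanSpace ℝ (Fin n)) :=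
  ProbabilityTheory.cond volume (Metric.closedBall 0 1)

/-! ### The real random access machine

The machine has two memories, one whose cells hold natural numbers and one whose cells hold real
numbers, both addressed by natural numbers, and a write-only output tape of real numbers. Each
elementary operation and each test takes one unit of time. The operations on natural numbers are
constants, addition, truncated subtraction, comparison and indirect addressing; those on real
numbers are the exact field operations, square roots, comparison and indirect addressing (there
is no rounding of real numbers to natural numbers). Programs are structured by sequencing,
conditionals and loops. -/

/-- A configuration of the machine: the two memories and the output written so far. -/
structure MachineState where
  nat : ℕ → ℕ
  real : ℕ → ℝ
  out : List ℝ

/-- Programs. Below, `N` is the natural number memory and `R` the real number memory. -/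
inductive Program : Type
  /-- Do nothing. -/
  | skip : Program
  /-- `N[i] := c` -/
  | setNat (i c : ℕ) : Program
  /-- `N[i] := N[j] + N[k]` -/
  | addNat (i j k : ℕ) : Program
  /-- `N[i] := N[j] - N[k]`, or `0` if this is negative. -/
  | subNat (i j k : ℕ) : Program
  /-- `N[i] := N[N[j]]` -/
  | loadNat (i j : ℕ) : Program
  /-- `N[N[i]] := N[j]` -/
  | storeNat (i j : ℕ) : Program
  /-- `R[i] := N[j]` -/
  | castReal (i j : ℕ) : Program
  /-- `R[i] := R[j] + R[k]` -/
  | addReal (i j k : ℕ) : Program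
  /-- `R[i] := R[j] - R[k]` -/
  | subReal (i j k : ℕ) : Program
  /-- `R[i] := R[j] * R[k]` -/
  | mulReal (i j k : ℕ) : Program
  /-- `R[i] := R[j] / R[k]`; the machine is stuck if `R[k] = 0`. -/
  | divReal (i j k : ℕ) : Program
  /-- `R[i] := √R[j]`; the machine is stuck if `R[j] < 0`. -/
  | sqrtReal (i j : ℕ) : Program
  /-- `R[i] := R[N[j]]` -/
  | loadReal (i j : ℕ) : Program
  /-- `R[N[i]] := R[j]` -/
  | storeReal (i j : ℕ) : Program
  /-- Append `R[i]` to the output. -/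
  | output (i : ℕ) : Program
  /-- First `p`, then `q`. -/
  | seq (p q : Program) : Program
  /-- If `N[i] < N[j]` then `p` else `q`. -/
  | ifNat (i j : ℕ) (p q : Program) : Program
  /-- If `R[i] < R[j]` then `p` else `q`. -/
  | ifReal (i j : ℕ) (p q : Program) : Program
  /-- While `N[i] < N[j]` do `p`. -/
  | whileNat (i j : ℕ) (p : Program) : Program

/-- `Exec p s T s'`: the program `p`, started in the configuration `s`, halts after exactly `T`
units of time in the configuration `s'`. -/
inductive Exec : Program → MachineState → ℕ → MachineState → Prop
  | skip (s : MachineState) : Exec .skip s 1 s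
  | setNat (i c : ℕ) (s : MachineState) :
      Exec (.setNat i c) s 1 { s with nat := Function.update s.nat i c }
  | addNat (i j k : ℕ) (s : MachineState) :
      Exec (.addNat i j k) s 1 { s with nat := Function.update s.nat i (s.nat j + s.nat k) }
  | subNat (i j k : ℕ) (s : MachineState) :
      Exec (.subNat i j k) s 1 { s with nat := Function.update s.nat i (s.nat j - s.nat k) }
  | loadNat (i j : ℕ) (s : MachineState) :
      Exec (.loadNat i j) s 1 { s with nat := Function.update s.nat i (s.nat (s.nat j)) }
  | storeNat (i j : ℕ) (s : MachineState) :
      Exec (.storeNat i j) s 1 { s with nat := Function.update s.nat (s.nat i) (s.nat j) }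
  | castReal (i j : ℕ) (s : MachineState) :
      Exec (.castReal i j) s 1 { s with real := Function.update s.real i (s.nat j : ℝ) }
  | addReal (i j k : ℕ) (s : MachineState) :
      Exec (.addReal i j k) s 1 { s with real := Function.update s.real i (s.real j + s.real k) }
  | subReal (i j k : ℕ) (s : MachineState) :
      Exec (.subReal i j k) s 1 { s with real := Function.update s.real i (s.real j - s.real k) }
  | mulReal (i j k : ℕ) (s : MachineState) :
      Exec (.mulReal i j k) s 1 { s with real := Function.update s.real i (s.real j * s.real k) }
  | divReal (i j k : ℕ) (s : MachineState) (h : s.real k ≠ 0) :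
      Exec (.divReal i j k) s 1 { s with real := Function.update s.real i (s.real j / s.real k) }
  | sqrtReal (i j : ℕ) (s : MachineState) (h : 0 ≤ s.real j) :
      Exec (.sqrtReal i j) s 1 { s with real := Function.update s.real i (Real.sqrt (s.real j)) }
  | loadReal (i j : ℕ) (s : MachineState) :
      Exec (.loadReal i j) s 1 { s with real := Function.update s.real i (s.real (s.nat j)) }
  | storeReal (i j : ℕ) (s : MachineState) :
      Exec (.storeReal i j) s 1 { s with real := Function.update s.real (s.nat i) (s.real j) }
  | output (i : ℕ) (s : MachineState) :
      Exec (.output i) s 1 { s with out := s.out ++ [s.real i] }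
  | seq (p q : Program) (s s₁ s₂ : MachineState) (T₁ T₂ : ℕ)
      (hp : Exec p s T₁ s₁) (hq : Exec q s₁ T₂ s₂) : Exec (.seq p q) s (T₁ + T₂) s₂
  | ifNatTrue (i j : ℕ) (p q : Program) (s s₁ : MachineState) (T : ℕ)
      (h : s.nat i < s.nat j) (hp : Exec p s T s₁) : Exec (.ifNat i j p q) s (T + 1) s₁
  | ifNatFalse (i j : ℕ) (p q : Program) (s s₁ : MachineState) (T : ℕ)
      (h : ¬ s.nat i < s.nat j) (hq : Exec q s T s₁) : Exec (.ifNat i j p q) s (T + 1) s₁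
  | ifRealTrue (i j : ℕ) (p q : Program) (s s₁ : MachineState) (T : ℕ)
      (h : s.real i < s.real j) (hp : Exec p s T s₁) : Exec (.ifReal i j p q) s (T + 1) s₁
  | ifRealFalse (i j : ℕ) (p q : Program) (s s₁ : MachineState) (T : ℕ)
      (h : ¬ s.real i < s.real j) (hq : Exec q s T s₁) : Exec (.ifReal i j p q) s (T + 1) s₁
  | whileNatTrue (i j : ℕ) (p : Program) (s s₁ s₂ : MachineState) (T₁ T₂ : ℕ)
      (h : s.nat i < s.nat j) (hp : Exec p s T₁ s₁) (hw : Exec (.whileNat i j p) s₁ T₂ s₂) :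
      Exec (.whileNat i j p) s (T₁ + T₂ + 1) s₂
  | whileNatFalse (i j : ℕ) (p : Program) (s : MachineState)
      (h : ¬ s.nat i < s.nat j) : Exec (.whileNat i j p) s 1 s

/-- The start configuration on input `n`: the number `n` in cell `0` of the natural number
memory, zeros everywhere else, and nothing on the output tape. -/
def startState (n : ℕ) : MachineState where
  nat := Function.update (fun _ => 0) 0 n
  real := fun _ => 0
  out := []

/-! ### Quasilinear families -/

/-- `f(L) = O((log L)^α L)` for some `α`. -/
def IsQuasilinear (f : ℕ → ℕ) : Prop :=
  ∃ α : ℕ, (fun L : ℕ => (f L : ℝ)) =O[Filter.atTop] fun L : ℕ => Real.log L ^ α * L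

/-- `out` lists every point of `F` exactly once, each as its `n` coordinates followed by its
weight. -/
def Formula.IsListing {n : ℕ} (F : Formula n) (out : List ℝ) : Prop :=
  ∃ l : List (EuclideanSpace ℝ (Fin n)), l.Nodup ∧ (∀ p, p ∈ l ↔ p ∈ F.points) ∧
    out = l.flatMap fun p => List.ofFn (fun i => p i) ++ [F.weight p]

/-- The family of the formulas `F n`, `n ≥ n₀`, is quasilinear: a single program, given `n`,
generates the points and weights of `F n` in time quasilinear in the length of the output. -/
def IsQuasilinearFamily (n₀ : ℕ) (F : ∀ n : ℕ, Formula n) : Prop :=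
  ∃ (p : Program) (f : ℕ → ℕ), IsQuasilinear f ∧ ∀ n, n₀ ≤ n →
    ∃ (T : ℕ) (s : MachineState), Exec p (startState n) T s ∧ (F n).IsListing s.out ∧
      T ≤ f s.out.length

/-- For `n ≥ n₀` the measures `μ n` on `ℝⁿ` admit quasilinear, positive, interior `t`-cubature
formulas with (exactly) `N n` points. -/
def AdmitQLPI (t n₀ : ℕ) (μ : ∀ n : ℕ, Measure (EuclideanSpace ℝ (Fin n))) (N : ℕ → ℕ) : Prop :=
  ∃ F : ∀ n : ℕ, Formula n,
    (∀ n, n₀ ≤ n → (F n).IsCubature t (μ n) ∧ (F n).IsPositive ∧ (F n).IsInterior (μ n) ∧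
      (F n).points.card = N n) ∧
    IsQuasilinearFamily n₀ F

end Cubature

end

/-!
# Quasilinear positive interior cubature formulas of degree five

**The formulas.** Let `C` be a set of sign vectors in `{±1}ⁿ` such that every product of one to
five distinct coordinates has sum zero over `C` (`IsSignDesign`). Then the points of `ρ • C`, all
with the same weight, together with the points `± β • eⱼ` on the axes, integrate every polynomial
of degree at most five for a measure whose moments are, in degree `d ≤ 5`, a constant times those
of the Gaussian measure (`HasMoments`), provided that `ρ`, `β` and the two weights satisfy four
equations (`designFormula_isCubature`): monomials with an odd exponent give zero on both sides,
and those with even exponents only involve `1`, `‖x‖²`, `xᵢ²xⱼ²` and `xⱼ⁴`. The Gaussian measure,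
the sphere and the ball have such moments, by integration in polar coordinates. Their parameters
can be computed from `n` with square roots, and for the ball the points lie in the open ball
because `n ≥ 5`.

**The sign vectors.** Let `F` be a field with `q = 2 ^ r` elements, `ψ` an additive character with
values `±1`, and `χ x = ψ (tr x)`. All arrays consist of the rows `p ↦ Φ a p * χ (b * y p) * s p`,
where `a, b` run through `F` and `s` through one or two signs (`signArray`). Summing over `s`, `b`
and `a` shows that a product of at most five columns has sum zero unless it has an even number of
columns of each kind, the elements `y` of these columns have sum zero, and the sum of the
corresponding products of `Φ a` over `a` does not vanish; so only two or four columns matter.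
* For `n ≤ 2 ^ (2m)`, `r = 2m - 1`, the form `Φ a` comes from the quadratic form
  `∑ tr (x ^ (1 + 2 ^ d))`, whose polarization is `tr x * tr y + tr (x * y)`
  (`kerdock_isSignDesign`). It is used on two copies of `F`, with an additional factor `χ (a * y)` on the second.
* For `n ≤ 2 ^ (2m) + 2 ^ m`, `r = 2m`, `Φ a` is `χ (a * x³)` on `F`, and there are additional
  columns `χ (a * u)` with `u` in the group of elements of norm one, which is a Sidon set
  (`cubicPair_isSignDesign`).
* For `n ≤ 2 ^ (2m + 1)`, `r = 2m + 1`, it is `χ (a * x³)` on a part of `F`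
  (`cubic_isSignDesign`), where the rows are distinct by the bound `√(2q)` for the character sums.

**The program.** The machine does not need arithmetic in `F`. It runs through all linear
recurrences of order `r` with coefficients in the field with two elements, written
multiplicatively with signs, until the initial window does not return before the time `q - 1`. The
characteristic polynomial is then primitive and the sequence consists of the values `ψ (α ^ t)` at
the powers of a generator `α` (`isFieldSequence_of_noEarlyReturn`); the search succeeds because a
minimal polynomial of a generator gives such a recurrence. The traces and the quadratic forms are
products of entries of this sequence at exponents modulo `q - 1`, so that tables of their values
at all exponents are available, with the exponents from `4q` on representing zero, and each
coordinate of the output takes two look-ups. The search takes time `O(q² r)`, the output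
`O(q² n)`, and the length of the output is at least a constant times `n³` with `q` of the order of `n`;
the running time is linear in the length of the output.
-/

noncomputable section

namespace Cubature

/-! ### Additive characters of finite fields of characteristic two -/

lemma addChar_map_sum {ι A : Type*} [AddCommMonoid A] (χ : AddChar A ℝ) (s : Finset ι)
    (f : ι → A) : χ (∑ i ∈ s, f i) = ∏ i ∈ s, χ (f i) := by
  induction s using Finset.cons_induction with
  | empty => simp
  | cons a s ha ih => rw [Finset.sum_cons, Finset.prod_cons, AddChar.map_add_eq_mul, ih]

section CharTwo

variable {F : Type*} [Field F] [Fintype F] [CharP F 2]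

/-- The absolute trace `x + x² + x⁴ + ⋯` of the field with `2 ^ r` elements, as an element of the
field itself. -/
def trace2 (r : ℕ) (x : F) : F := ∑ i ∈ Finset.range r, x ^ 2 ^ i

omit [Fintype F] in
lemma trace2_add (r : ℕ) (x y : F) : trace2 r (x + y) = trace2 r x + trace2 r y := by
  simp [trace2, add_pow_char_pow, Finset.sum_add_distrib]

omit [Fintype F] [CharP F 2] in
lemma trace2_zero (r : ℕ) : trace2 r (0 : F) = 0 := by
  simp [trace2]

omit [CharP F 2] in
lemma pow_two_pow {r : ℕ} (hF : Fintype.card F = 2 ^ r) (x : F) : x ^ 2 ^ r = x := by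
  rw [← hF]; exact FiniteField.pow_card x

omit [CharP F 2] in
lemma trace2_sq {r : ℕ} (hF : Fintype.card F = 2 ^ r) (x : F) :
    trace2 r (x ^ 2) = trace2 r x := by
  have h1 := Finset.sum_range_succ (fun i => x ^ 2 ^ i) r
  rw [Finset.sum_range_succ', pow_two_pow hF, pow_zero, pow_one] at h1
  have h2 := add_right_cancel h1
  simp only [trace2, ← pow_mul, ← pow_succ']
  exact h2

lemma sq_trace2 {r : ℕ} (hF : Fintype.card F = 2 ^ r) (x : F) :
    trace2 r x ^ 2 = trace2 r x := by
  conv_rhs => rw [← trace2_sq hF]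
  simp only [trace2, sum_pow_char, ← pow_mul, mul_comm]

lemma trace2_eq_zero_or_one {r : ℕ} (hF : Fintype.card F = 2 ^ r) (x : F) :
    trace2 r x = 0 ∨ trace2 r x = 1 := by
  have h := sq_trace2 hF x
  have : trace2 r x * (trace2 r x - 1) = 0 := by linear_combination h
  rcases mul_eq_zero.1 this with h | h
  · exact Or.inl h
  · exact Or.inr (sub_eq_zero.1 h)

lemma exists_trace2_eq_one {r : ℕ} (hF : Fintype.card F = 2 ^ r) : ∃ x : F, trace2 r x = 1 := by
  let _ := ZMod.algebra F 2
  obtain ⟨x, hx⟩ := Algebra.trace_surjective (ZMod 2) F 1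
  refine ⟨x, ?_⟩
  have hr : Module.finrank (ZMod 2) F = r := by
    have := Module.card_eq_pow_finrank (K := ZMod 2) (V := F)
    rw [hF, ZMod.card] at this
    exact (Nat.pow_right_injective le_rfl this).symm
  have h := FiniteField.algebraMap_trace_eq_sum_pow (ZMod 2) F x
  rw [hx, hr, map_one, Nat.card_zmod] at h
  exact h.symm

omit [Fintype F] [CharP F 2] in
lemma trace2_mul_of_zero_or_one {r : ℕ} {c : F} (hc : c = 0 ∨ c = 1) (x : F) :
    trace2 r (x * c) = trace2 r x * c := by
  rcases hc with rfl | rfl <;> simp [trace2_zero]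

/-- In a field of order `2 ^ r`, `r` odd, the element `1` has trace one; hence there is no
primitive cube root of unity. -/
lemma sq_add_add_one_ne_zero {r : ℕ} (hF : Fintype.card F = 2 ^ r) (hr : Odd r) (t : F) :
    t ^ 2 + t + 1 ≠ 0 := by
  intro h
  have h1 : trace2 r (t ^ 2 + t + 1) = 0 := by rw [h, trace2_zero]
  rw [trace2_add, trace2_add, trace2_sq hF, CharTwo.add_self_eq_zero, zero_add] at h1
  obtain ⟨k, rfl⟩ := hr
  have h2 : ((2 : ℕ) : F) = 0 := CharP.cast_eq_zero F 2
  simp only [trace2, one_pow, Finset.sum_const, Finset.card_range, nsmul_eq_mul, mul_one] at h1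
  push_cast at h1 h2
  rw [h2] at h1
  simp at h1

/-- The character `x ↦ ψ (trace x)`, where `ψ` is a character whose values on the prime field
are `1` and `-1`. -/
def traceChar (r : ℕ) (ψ : AddChar F ℝ) : AddChar F ℝ where
  toFun x := ψ (trace2 r x)
  map_zero_eq_one' := by simp [trace2_zero]
  map_add_eq_mul' x y := by rw [trace2_add, ψ.map_add_eq_mul]

omit [Fintype F] in
lemma traceChar_apply (r : ℕ) (ψ : AddChar F ℝ) (x : F) : traceChar r ψ x = ψ (trace2 r x) := rfl

omit [Fintype F] in
lemma addChar_mul_self (ψ : AddChar F ℝ) (x : F) : ψ x * ψ x = 1 := by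
  rw [← ψ.map_add_eq_mul, CharTwo.add_self_eq_zero, ψ.map_zero_eq_one]

omit [Fintype F] in
lemma addChar_eq_one_or (ψ : AddChar F ℝ) (x : F) : ψ x = 1 ∨ ψ x = -1 :=
  mul_self_eq_one_iff.1 (addChar_mul_self ψ x)

variable {r : ℕ} {ψ : AddChar F ℝ}

lemma traceChar_sq (hF : Fintype.card F = 2 ^ r) (x : F) :
    traceChar r ψ (x ^ 2) = traceChar r ψ x := by
  rw [traceChar_apply, trace2_sq hF, traceChar_apply]

lemma traceChar_pow (hF : Fintype.card F = 2 ^ r) (k : ℕ) (x : F) :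
    traceChar r ψ (x ^ 2 ^ k) = traceChar r ψ x := by
  induction k with
  | zero => simp
  | succ k ih => rw [pow_succ, pow_mul, traceChar_sq hF, ih]

lemma sum_traceChar_mul (hF : Fintype.card F = 2 ^ r) (hψ : ψ 1 = -1) {z : F} (hz : z ≠ 0) :
    ∑ a : F, traceChar r ψ (a * z) = 0 := by
  classical
  have h : traceChar r ψ ≠ 1 := by
    obtain ⟨x, hx⟩ := exists_trace2_eq_one hF
    intro h
    have : traceChar r ψ x = 1 := by rw [h]; rfl
    rw [traceChar_apply, hx, hψ] at this
    norm_num at this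
  have := AddChar.sum_mulShift z (AddChar.IsPrimitive.of_ne_one h)
  rw [this, if_neg hz]; simp

/-- A character that is constant along the multiples of `z` detects `z = 0`. -/
lemma eq_zero_of_traceChar (hF : Fintype.card F = 2 ^ r) (hψ : ψ 1 = -1) {z : F}
    (h : ∀ a, traceChar r ψ (a * z) = 1) : z = 0 := by
  by_contra hz
  have := sum_traceChar_mul hF hψ hz
  simp [h] at this

lemma psi_trace_mul_trace (hF : Fintype.card F = 2 ^ r) (hψ : ψ 1 = -1) (x y : F) :
    ψ (trace2 r x * trace2 r y) =
      (1 + traceChar r ψ x + traceChar r ψ y - traceChar r ψ (x + y)) / 2 := by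
  rw [AddChar.map_add_eq_mul]
  simp only [traceChar_apply]
  rcases trace2_eq_zero_or_one hF x with hx | hx <;>
  rcases trace2_eq_zero_or_one hF y with hy | hy <;>
  (simp [hx, hy, hψ]; try norm_num)

lemma traceChar_mul_trace (hF : Fintype.card F = 2 ^ r) (x y : F) :
    traceChar r ψ (x * trace2 r y) = ψ (trace2 r x * trace2 r y) := by
  rw [traceChar_apply, trace2_mul_of_zero_or_one (trace2_eq_zero_or_one hF y)]

/-- The sign `(-1)^Q(u)` of the quadratic form `Q(u) = ∑ tr(u ^ (1 + 2 ^ d))`, `1 ≤ d ≤ h`. -/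
def quadChar (r h : ℕ) (ψ : AddChar F ℝ) (u : F) : ℝ :=
  ∏ d ∈ Finset.range h, traceChar r ψ (u ^ (1 + 2 ^ (d + 1)))

/-- The sign `(-1)^B(u, v)` of the alternating form `B(u, v) = tr(u) tr(v) + tr(u v)`. -/
def polarChar (r : ℕ) (ψ : AddChar F ℝ) (u v : F) : ℝ :=
  ψ (trace2 r u * trace2 r v) * traceChar r ψ (u * v)

omit [Fintype F] in
lemma polarChar_add_left (u u' v : F) :
    polarChar r ψ (u + u') v = polarChar r ψ u v * polarChar r ψ u' v := by
  simp only [polarChar, trace2_add, add_mul, AddChar.map_add_eq_mul]; ring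

omit [Fintype F] in
lemma polarChar_comm (u v : F) : polarChar r ψ u v = polarChar r ψ v u := by
  simp only [polarChar, mul_comm]

omit [Fintype F] in
lemma polarChar_add_right (u v v' : F) :
    polarChar r ψ u (v + v') = polarChar r ψ u v * polarChar r ψ u v' := by
  rw [polarChar_comm, polarChar_add_left, polarChar_comm v, polarChar_comm v']

lemma polarChar_self (hF : Fintype.card F = 2 ^ r) (u : F) : polarChar r ψ u u = 1 := by
  rw [polarChar, ← sq, ← sq, sq_trace2 hF, traceChar_sq hF, traceChar_apply, addChar_mul_self]

omit [Fintype F] in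
lemma polarChar_zero_left (v : F) : polarChar r ψ 0 v = 1 := by
  simp [polarChar, trace2_zero]

omit [Fintype F] in
lemma polarChar_zero_right (v : F) : polarChar r ψ v 0 = 1 := by
  simp [polarChar, trace2_zero]

omit [Fintype F] in
lemma quadChar_zero (h : ℕ) : quadChar r h ψ (0 : F) = 1 := by
  simp [quadChar]

omit [Fintype F] in
lemma quadChar_mul_self (h : ℕ) (u : F) : quadChar r h ψ u * quadChar r h ψ u = 1 := by
  rw [quadChar, ← Finset.prod_mul_distrib]
  exact Finset.prod_eq_one fun d _ => addChar_mul_self _ _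

lemma prod_cross_terms {h : ℕ} (hF : Fintype.card F = 2 ^ (2 * h + 1)) (u v : F) :
    ∏ d ∈ Finset.range h, (traceChar (2 * h + 1) ψ (u * v ^ 2 ^ (d + 1)) *
      traceChar (2 * h + 1) ψ (v * u ^ 2 ^ (d + 1))) = polarChar (2 * h + 1) ψ u v := by
  set f : ℕ → ℝ := fun i => traceChar (2 * h + 1) ψ (u * v ^ 2 ^ i) with hf
  have h1 : ∀ d ∈ Finset.range h, traceChar (2 * h + 1) ψ (v * u ^ 2 ^ (d + 1)) =
      f (h + (h - 1 - d) + 1) := by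
    intro d hd
    have hd := Finset.mem_range.1 hd
    rw [← traceChar_pow hF (h + (h - 1 - d) + 1), hf]
    dsimp only
    rw [mul_pow, ← pow_mul, ← pow_add,
      show d + 1 + (h + (h - 1 - d) + 1) = 2 * h + 1 by omega, pow_two_pow hF,
      mul_comm u]
  rw [Finset.prod_mul_distrib, Finset.prod_congr rfl h1,
    Finset.prod_range_reflect (fun d => f (h + d + 1)) h]
  have h2 := Finset.prod_range_add (fun i => f (i + 1)) h h
  have h3 : ∏ i ∈ Finset.range (2 * h + 1), f i =
      ψ (trace2 (2 * h + 1) u * trace2 (2 * h + 1) v) := by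
    rw [← traceChar_mul_trace hF]
    conv_rhs => rw [trace2, Finset.mul_sum]
    exact (addChar_map_sum _ _ _).symm
  have h5 : f 0 = traceChar (2 * h + 1) ψ (u * v) := by simp [hf]
  rw [Finset.prod_range_succ', h5, two_mul, h2] at h3
  rw [polarChar, two_mul, ← h3, mul_assoc, ← two_mul, addChar_mul_self, mul_one]

/-- `B` is the polarization of `Q`: the cross terms `tr(u v ^ 2 ^ d) + tr(v u ^ 2 ^ d)` with
`1 ≤ d ≤ h` sum to `tr(u (tr v - v))`, because `tr(v u ^ 2 ^ d) = tr(u v ^ 2 ^ (r - d))`. -/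
lemma quadChar_add {h : ℕ} (hF : Fintype.card F = 2 ^ (2 * h + 1)) (u v : F) :
    quadChar (2 * h + 1) h ψ (u + v) =
      quadChar (2 * h + 1) h ψ u * quadChar (2 * h + 1) h ψ v * polarChar (2 * h + 1) ψ u v := by
  rw [← prod_cross_terms hF]
  simp only [quadChar, ← Finset.prod_mul_distrib]
  refine Finset.prod_congr rfl fun d _ => ?_
  simp only [← AddChar.map_add_eq_mul]
  congr 1
  rw [pow_add, add_pow_char_pow, pow_add, pow_add]
  ring

/-- The product of `(-1)^Q` over the four points of an affine plane. -/
lemma quadChar_four {h : ℕ} (hF : Fintype.card F = 2 ^ (2 * h + 1)) (x y z : F) :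
    quadChar (2 * h + 1) h ψ x * quadChar (2 * h + 1) h ψ y * quadChar (2 * h + 1) h ψ z *
      quadChar (2 * h + 1) h ψ (x + y + z) = polarChar (2 * h + 1) ψ (x + y) (x + z) := by
  rw [quadChar_add hF, quadChar_add hF]
  simp only [polarChar_add_left, polarChar_add_right]
  rw [polarChar_self hF, polarChar_comm y x]
  linear_combination
    (quadChar (2 * h + 1) h ψ y * quadChar (2 * h + 1) h ψ y *
      quadChar (2 * h + 1) h ψ z * quadChar (2 * h + 1) h ψ z *
      polarChar (2 * h + 1) ψ x y * polarChar (2 * h + 1) ψ x z *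
      polarChar (2 * h + 1) ψ y z) * quadChar_mul_self (r := 2 * h + 1) (ψ := ψ) h x +
    (quadChar (2 * h + 1) h ψ z * quadChar (2 * h + 1) h ψ z *
      polarChar (2 * h + 1) ψ x y * polarChar (2 * h + 1) ψ x z *
      polarChar (2 * h + 1) ψ y z) * quadChar_mul_self (r := 2 * h + 1) (ψ := ψ) h y +
    (polarChar (2 * h + 1) ψ x y * polarChar (2 * h + 1) ψ x z *
      polarChar (2 * h + 1) ψ y z) * quadChar_mul_self (r := 2 * h + 1) (ψ := ψ) h z

/-- The forms `(u, v) ↦ B(a u, a v)` together with their extensions to one more dimension take the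
values `0` and `1` equally often at each pair of independent vectors `(u, k)` and `(v, l)`. -/
lemma sum_polarChar {h : ℕ} (hF : Fintype.card F = 2 ^ (2 * h + 1)) (hψ : ψ 1 = -1)
    {u v k l : F} (hk : k = 0 ∨ k = 1) (hl : l = 0 ∨ l = 1) (h1 : ¬ (u = 0 ∧ k = 0))
    (h2 : ¬ (v = 0 ∧ l = 0)) (h3 : ¬ (u = v ∧ k = l)) :
    ∑ a : F, polarChar (2 * h + 1) ψ (a * u) (a * v) *
      traceChar (2 * h + 1) ψ (a * (k * v + l * u)) = 0 := by
  by_cases hu : u = 0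
  · have hk1 : k = 1 := by tauto
    have hv : v ≠ 0 := by rintro rfl; apply h3; rw [hu, hk1]; tauto
    subst hu hk1
    simp only [mul_zero, polarChar_zero_left, one_mul, add_zero]
    exact sum_traceChar_mul hF hψ hv
  by_cases hv : v = 0
  · have hk1 : l = 1 := by tauto
    subst hv hk1
    simp only [mul_zero, polarChar_zero_right, one_mul, zero_add]
    exact sum_traceChar_mul hF hψ hu
  by_cases huv : u = v
  · subst huv
    have hkl : k + l = 1 := by
      rcases hk with rfl | rfl <;> rcases hl with rfl | rfl <;> simp_all
    simp only [← add_mul, polarChar_self hF, hkl, one_mul]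
    exact sum_traceChar_mul hF hψ hu
  · obtain ⟨w, hw⟩ : ∃ w, w ^ 2 = u * v := ⟨(u * v) ^ 2 ^ (2 * h), by
      rw [← pow_mul, ← pow_succ, pow_two_pow hF]⟩
    have hh2 : (2 : F) = 0 := CharTwo.two_eq_zero
    have key : ∀ s t : F, (s = 0 ∨ s = 1) → (t = 0 ∨ t = 1) → w + s * v + t * u ≠ 0 := by
      intro s t hs ht h0
      have hw' : w = s * v + t * u := by linear_combination h0 - (s * v + t * u) * hh2
      have huv' : (u - v) ≠ 0 := sub_ne_zero.2 huv
      rcases hs with rfl | rfl <;> rcases ht with rfl | rfl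
      · exact mul_ne_zero hu hv (by rw [← hw, hw']; ring)
      · exact mul_ne_zero hu huv' (by linear_combination hw - (w + u) * hw')
      · exact mul_ne_zero hv huv' (by linear_combination -hw + (w + v) * hw')
      · refine sq_add_add_one_ne_zero hF ⟨h, rfl⟩ (u / v) ?_
        field_simp
        linear_combination (w + u + v) * (-hw') + hw - u * v * hh2 + u * v * hh2
    have hb : ∀ x : F, (x = 0 ∨ x = 1) → (x + 1 = 0 ∨ x + 1 = 1) := by
      rintro x (rfl | rfl)
      · simp
      · left; exact CharTwo.add_self_eq_zero 1
    have expand : ∀ a : F, polarChar (2 * h + 1) ψ (a * u) (a * v) *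
      traceChar (2 * h + 1) ψ (a * (k * v + l * u)) =
        (traceChar (2 * h + 1) ψ (a * (w + k * v + l * u)) +
        traceChar (2 * h + 1) ψ (a * (w + k * v + (l + 1) * u)) +
        traceChar (2 * h + 1) ψ (a * (w + (k + 1) * v + l * u)) -
        traceChar (2 * h + 1) ψ (a * (w + (k + 1) * v + (l + 1) * u))) / 2 := by
      intro a
      rw [polarChar, psi_trace_mul_trace hF hψ, show a * u * (a * v) = (a * w) ^ 2 by
        rw [mul_pow, hw]; ring, traceChar_sq hF]
      rw [show a * (w + k * v + l * u) = a * w + a * (k * v + l * u) by ring,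
        show a * (w + k * v + (l + 1) * u) = a * w + a * (k * v + l * u) + a * u by ring,
        show a * (w + (k + 1) * v + l * u) = a * w + a * (k * v + l * u) + a * v by ring,
        show a * (w + (k + 1) * v + (l + 1) * u) =
          a * w + a * (k * v + l * u) + (a * u + a * v) by ring]
      simp only [AddChar.map_add_eq_mul]
      ring
    rw [Finset.sum_congr rfl fun a _ => expand a, ← Finset.sum_div, Finset.sum_sub_distrib,
      Finset.sum_add_distrib, Finset.sum_add_distrib,
      sum_traceChar_mul hF hψ (key _ _ hk hl), sum_traceChar_mul hF hψ (key _ _ hk (hb _ hl)),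
      sum_traceChar_mul hF hψ (key _ _ (hb _ hk) hl),
      sum_traceChar_mul hF hψ (key _ _ (hb _ hk) (hb _ hl))]
    simp

end CharTwo

/-! ### Arrays of signs of strength five -/

/-- The rows `σ i` of signs form an orthogonal array of strength five (every sum of products of
between one and five distinct columns vanishes), and no row is repeated. -/
structure IsSignDesign {ι J : Type*} [Fintype ι] (σ : ι → J → ℝ) : Prop where
  sign : ∀ i p, σ i p = 1 ∨ σ i p = -1
  inj : Function.Injective σ
  balanced : ∀ O : Finset J, O.Nonempty → O.card ≤ 5 → ∑ i, ∏ p ∈ O, σ i p = 0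

lemma Finset.exists_of_card_eq_four {J : Type*} [DecidableEq J] {O : Finset J} (h : O.card = 4) :
    ∃ a b c d, a ≠ b ∧ a ≠ c ∧ a ≠ d ∧ b ≠ c ∧ b ≠ d ∧ c ≠ d ∧ O = {a, b, c, d} := by
  obtain ⟨a, t, hat, rfl, ht⟩ := Finset.card_eq_succ.1 h
  obtain ⟨b, c, d, hbc, hbd, hcd, rfl⟩ := Finset.card_eq_three.1 ht
  simp only [Finset.mem_insert, Finset.mem_singleton, not_or] at hat
  exact ⟨a, b, c, d, hat.1, hat.2.1, hat.2.2, hbc, hbd, hcd, rfl⟩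

section Designs

variable {F : Type*} [Field F] [Fintype F] [CharP F 2] {J : Type*}
variable {r : ℕ} {ψ : AddChar F ℝ}

/-- The array of signs with rows indexed by `(a, b, s)` and entries `Φ a p · (-1)^tr(b y_p) · s_p`.
The first factor varies over the forms of a family, the second one over all linear forms. -/
def signArray {S : Type*} (r : ℕ) (ψ : AddChar F ℝ) (Φ : F → J → ℝ) (y : J → F)
    (sg : S → J → ℝ) (i : F × F × S) (p : J) : ℝ :=
  Φ i.1 p * traceChar r ψ (i.2.1 * y p) * sg i.2.2 p

omit [Fintype F] in
lemma signArray_eq_one_or {S : Type*} {Φ : F → J → ℝ} {y : J → F} {sg : S → J → ℝ}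
    (hΦ : ∀ a p, Φ a p = 1 ∨ Φ a p = -1) (hsg : ∀ s p, sg s p = 1 ∨ sg s p = -1)
    (i : F × F × S) (p : J) :
    signArray r ψ Φ y sg i p = 1 ∨ signArray r ψ Φ y sg i p = -1 := by
  rw [signArray]
  rcases hΦ i.1 p with h1 | h1 <;> rcases hsg i.2.2 p with h2 | h2 <;>
  rcases addChar_eq_one_or (traceChar r ψ) (i.2.1 * y p) with h3 | h3 <;>
  simp [h1, h2, h3]

lemma sum_prod_signArray {S : Type*} [Fintype S] (hF : Fintype.card F = 2 ^ r) (hψ : ψ 1 = -1)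
    {Φ : F → J → ℝ} {y : J → F} {sg : S → J → ℝ} (O : Finset J)
    (h : ∑ s, ∏ p ∈ O, sg s p ≠ 0 → ∑ p ∈ O, y p = 0 → ∑ a, ∏ p ∈ O, Φ a p = 0) :
    ∑ i, ∏ p ∈ O, signArray r ψ Φ y sg i p = 0 := by
  have key : ∑ i, ∏ p ∈ O, signArray r ψ Φ y sg i p =
      (∑ a, ∏ p ∈ O, Φ a p) * ((∑ b, traceChar r ψ (b * ∑ p ∈ O, y p)) *
        (∑ s, ∏ p ∈ O, sg s p)) := by
    rw [Finset.sum_mul_sum, Finset.sum_mul_sum, Fintype.sum_prod_type]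
    simp only [signArray, Finset.prod_mul_distrib, Fintype.sum_prod_type, Finset.mul_sum]
    refine Finset.sum_congr rfl fun a _ => Finset.sum_congr rfl fun b _ =>
      Finset.sum_congr rfl fun s _ => ?_
    rw [← mul_assoc]
    congr 2
    rw [← addChar_map_sum]
  rw [key]
  by_cases h1 : ∑ s, ∏ p ∈ O, sg s p = 0
  · rw [h1]; ring
  by_cases h2 : ∑ p ∈ O, y p = 0
  · rw [h h1 h2]; ring
  · rw [sum_traceChar_mul hF hψ h2]; ring

/-- Independent signs on the coordinates with `e p = 0` and on the other coordinates. -/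
def signPair (e : J → F) (s : ℤˣ × ℤˣ) (p : J) : ℝ :=
  open Classical in if e p = 0 then ((s.1 : ℤ) : ℝ) else ((s.2 : ℤ) : ℝ)

/-- The same sign on all coordinates. -/
def signConst (s : ℤˣ) (_ : J) : ℝ := ((s : ℤ) : ℝ)

lemma units_cast_eq_one_or (s : ℤˣ) : ((s : ℤ) : ℝ) = 1 ∨ ((s : ℤ) : ℝ) = -1 := by
  rcases Int.units_eq_one_or s with rfl | rfl <;> simp

lemma units_cast_injective {s t : ℤˣ} (h : ((s : ℤ) : ℝ) = ((t : ℤ) : ℝ)) : s = t := by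
  exact_mod_cast h

omit [Fintype F] [CharP F 2] in
lemma signPair_eq_one_or (e : J → F) (s : ℤˣ × ℤˣ) (p : J) :
    signPair e s p = 1 ∨ signPair e s p = -1 := by
  rw [signPair]; split_ifs <;> exact units_cast_eq_one_or _

omit [Fintype F] in
/-- A product of an odd number of signs of either of the two kinds averages to zero. -/
lemma even_of_sum_signPair {e : J → F} (he : ∀ p, e p = 0 ∨ e p = 1) {O : Finset J}
    (h : ∑ s, ∏ p ∈ O, signPair e s p ≠ 0) : Even O.card ∧ ∑ p ∈ O, e p = 0 := by
  classical
  have hs : ∑ p ∈ O, e p = ((O.filter fun p => ¬ e p = 0).card : F) := by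
    rw [Finset.card_filter, Nat.cast_sum]
    refine Finset.sum_congr rfl fun p _ => ?_
    rcases he p with h | h <;> simp [h]
  have hc := Finset.card_filter_add_card_filter_not (s := O) (fun p => e p = 0)
  rw [hs, ← hc]
  revert h
  generalize hA : (O.filter fun p => e p = 0) = A
  generalize hB : (O.filter fun p => ¬ e p = 0) = B
  simp only [signPair, Finset.prod_ite, Finset.prod_const, hA, hB]
  intro h
  have h2 : (2 : F) = 0 := CharTwo.two_eq_zero
  rcases Nat.even_or_odd A.card with h3 | h3 <;> rcases Nat.even_or_odd B.card with h4 | h4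
  · refine ⟨h3.add h4, ?_⟩
    obtain ⟨k, hk⟩ := h4
    rw [hk]; push_cast; linear_combination (k : F) * h2
  all_goals
    exfalso; apply h
    rw [Fintype.sum_prod_type]
    simp [UnitsInt.univ, h3.neg_one_pow, h4.neg_one_pow]

lemma even_of_sum_signConst {O : Finset J} (h : ∑ s, ∏ p ∈ O, signConst s p ≠ 0) :
    Even O.card := by
  by_contra h3
  rw [Nat.not_even_iff_odd] at h3
  apply h
  simp [signConst, UnitsInt.univ, h3.neg_one_pow]

lemma card_two_or_four {O : Finset J} (h : Even O.card) (hne : O.Nonempty) (h5 : O.card ≤ 5) :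
    O.card = 2 ∨ O.card = 4 := by
  have := hne.card_pos
  obtain ⟨k, hk⟩ := h
  omega

omit [Fintype F] in
lemma eq_of_add_eq_zero {x y : F} (h : x + y = 0) : x = y := CharTwo.add_eq_zero.1 h

/-! ### The Kerdock array -/

/-- Coordinates of the Kerdock array are points `(y, e)` of `F × 𝔽₂`; its rows are the quadratic
forms `Q(a y) + e tr(a y) + tr(b y) + const`. -/
def kerdockForm (r h : ℕ) (ψ : AddChar F ℝ) (y e : J → F) (a : F) (p : J) : ℝ :=
  quadChar r h ψ (a * y p) * traceChar r ψ (e p * (a * y p))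

lemma kerdock_balanced {h : ℕ} (hF : Fintype.card F = 2 ^ (2 * h + 1)) (hψ : ψ 1 = -1)
    {y e : J → F} (he : ∀ p, e p = 0 ∨ e p = 1) (hinj : ∀ p p', y p = y p' → e p = e p' → p = p')
    (O : Finset J) (hO : O.Nonempty) (hO5 : O.card ≤ 5) :
    ∑ i, ∏ p ∈ O, signArray (2 * h + 1) ψ (kerdockForm (2 * h + 1) h ψ y e) y (signPair e) i p
      = 0 := by
  classical
  refine sum_prod_signArray hF hψ O fun hs hy => ?_
  obtain ⟨hev, hes⟩ := even_of_sum_signPair he hs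
  rcases card_two_or_four hev hO hO5 with hc | hc
  · obtain ⟨p, p', hne, rfl⟩ := Finset.card_eq_two.1 hc
    rw [Finset.sum_pair hne] at hy hes
    exact absurd (hinj p p' (eq_of_add_eq_zero hy) (eq_of_add_eq_zero hes)) hne
  · obtain ⟨p1, p2, p3, p4, h12, h13, h14, h23, h24, h34, rfl⟩ := Finset.exists_of_card_eq_four hc
    have hsum : ∀ f : J → F, ∑ p ∈ {p1, p2, p3, p4}, f p = f p1 + f p2 + f p3 + f p4 := by
      intro f
      rw [Finset.sum_insert (by simp [*]), Finset.sum_insert (by simp [*]), Finset.sum_pair h34]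
      ring
    rw [hsum] at hy hes
    have hy4 := (eq_of_add_eq_zero hy).symm
    have he4 := (eq_of_add_eq_zero hes).symm
    have hb : ∀ p p', e p + e p' = 0 ∨ e p + e p' = 1 := by
      intro p p'
      rcases he p with h | h <;> rcases he p' with h' | h' <;>
        simp [h, h', CharTwo.add_self_eq_zero]
    have h1 : ¬ (y p1 + y p2 = 0 ∧ e p1 + e p2 = 0) := fun ⟨h, h'⟩ =>
      h12 (hinj _ _ (eq_of_add_eq_zero h) (eq_of_add_eq_zero h'))
    have h2 : ¬ (y p1 + y p3 = 0 ∧ e p1 + e p3 = 0) := fun ⟨h, h'⟩ =>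
      h13 (hinj _ _ (eq_of_add_eq_zero h) (eq_of_add_eq_zero h'))
    have h3 : ¬ (y p1 + y p2 = y p1 + y p3 ∧ e p1 + e p2 = e p1 + e p3) := fun ⟨h, h'⟩ =>
      h23 (hinj _ _ (add_left_cancel h) (add_left_cancel h'))
    rw [← sum_polarChar hF hψ (hb p1 p2) (hb p1 p3) h1 h2 h3]
    refine Finset.sum_congr rfl fun a _ => ?_
    rw [Finset.prod_insert (by simp [*]), Finset.prod_insert (by simp [*]), Finset.prod_pair h34]
    have q4 := quadChar_four (ψ := ψ) hF (a * y p1) (a * y p2) (a * y p3)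
    rw [show a * y p1 + a * y p2 + a * y p3 = a * y p4 by rw [hy4]; ring,
      ← mul_add, ← mul_add] at q4
    have hlin : traceChar (2 * h + 1) ψ
        (a * ((e p1 + e p2) * (y p1 + y p3) + (e p1 + e p3) * (y p1 + y p2))) =
        traceChar (2 * h + 1) ψ (e p1 * (a * y p1)) * traceChar (2 * h + 1) ψ (e p2 * (a * y p2)) *
        traceChar (2 * h + 1) ψ (e p3 * (a * y p3)) *
        traceChar (2 * h + 1) ψ (e p4 * (a * y p4)) := by
      simp only [← AddChar.map_add_eq_mul]
      congr 1
      rw [hy4, he4]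
      have hh2 : (2 : F) = 0 := CharTwo.two_eq_zero
      linear_combination (- a * e p2 * y p2 - a * e p3 * y p3) * hh2
    rw [hlin, ← q4]
    simp only [kerdockForm]
    ring

lemma kerdock_injective {h : ℕ} (hh : 1 ≤ h) (hF : Fintype.card F = 2 ^ (2 * h + 1))
    (hψ : ψ 1 = -1) {y e : J → F} (hfull : ∀ x, ∃ p, e p = 0 ∧ y p = x) (hex : ∃ p, e p ≠ 0) :
    Function.Injective
      (signArray (2 * h + 1) ψ (kerdockForm (2 * h + 1) h ψ y e) y (signPair e)) := by
  classical
  rintro ⟨a, b, s0, s1⟩ ⟨a', b', s0', s1'⟩ heq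
  set χ := traceChar (2 * h + 1) ψ with hχ
  set q := quadChar (2 * h + 1) h ψ with hq
  have hmain : ∀ x, q (a * x) * χ (b * x) * ((s0 : ℤ) : ℝ) =
      q (a' * x) * χ (b' * x) * ((s0' : ℤ) : ℝ) := by
    intro x
    obtain ⟨p, hp, rfl⟩ := hfull x
    have := congrFun heq p
    simpa [signArray, kerdockForm, signPair, hp] using this
  have hs : ((s0 : ℤ) : ℝ) = ((s0' : ℤ) : ℝ) := by
    have := hmain 0
    simpa [hq, quadChar_zero] using this
  have hs0 : ((s0' : ℤ) : ℝ) ≠ 0 := by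
    rcases units_cast_eq_one_or s0' with h | h <;> rw [h] <;> norm_num
  have hmain' : ∀ x, q (a * x) * χ (b * x) = q (a' * x) * χ (b' * x) := by
    intro x
    have := hmain x
    rw [hs] at this
    exact mul_right_cancel₀ hs0 this
  have hqne : ∀ x, q x ≠ 0 := fun x hx => by
    have := quadChar_mul_self (r := 2 * h + 1) (ψ := ψ) h x
    rw [← hq, hx] at this; norm_num at this
  have hχne : ∀ x, χ x ≠ 0 := fun x hx => by
    have := addChar_mul_self χ x
    rw [hx] at this; norm_num at this
  have hpol : ∀ x z, polarChar (2 * h + 1) ψ (a * x) (a * z) =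
      polarChar (2 * h + 1) ψ (a' * x) (a' * z) := by
    intro x z
    have h1 := hmain' (x + z)
    simp only [mul_add, AddChar.map_add_eq_mul, hq, quadChar_add hF] at h1
    have h2 := hmain' x
    have h3 := hmain' z
    have h4 : (q (a * x) * χ (b * x)) * (q (a * z) * χ (b * z)) *
        polarChar (2 * h + 1) ψ (a * x) (a * z) =
          (q (a * x) * χ (b * x)) * (q (a * z) * χ (b * z)) *
        polarChar (2 * h + 1) ψ (a' * x) (a' * z) := by
      conv_rhs => rw [h2, h3]
      rw [hq]
      linear_combination h1
    exact mul_left_cancel₀ (mul_ne_zero (mul_ne_zero (hqne _) (hχne _))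
      (mul_ne_zero (hqne _) (hχne _))) h4
  set t := trace2 (F := F) (2 * h + 1) with ht
  have hlin : ∀ x, (a ^ 2 + a' ^ 2) * x = t (a * x) * a + t (a' * x) * a' := by
    intro x
    rw [← CharTwo.add_eq_zero]
    refine eq_zero_of_traceChar hF hψ fun z => ?_
    have h1 := hpol x z
    rw [polarChar, polarChar, mul_comm (trace2 _ (a * x)), mul_comm (trace2 _ (a' * x)),
      ← traceChar_mul_trace hF, ← traceChar_mul_trace hF, ← AddChar.map_add_eq_mul,
      ← AddChar.map_add_eq_mul] at h1
    have h3 := addChar_mul_self χ (a' * z * trace2 (2 * h + 1) (a' * x) + a' * x * (a' * z))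
    nth_rewrite 1 [← h1] at h3
    rw [← AddChar.map_add_eq_mul] at h3
    rw [← h3]
    congr 1
    rw [ht]
    ring
  have haa : a = a' := by
    by_contra hne
    have hd : a ^ 2 + a' ^ 2 ≠ 0 := by
      rw [← CharTwo.add_sq]
      exact pow_ne_zero 2 fun h0 => hne (eq_of_add_eq_zero h0)
    have hsub : (Finset.univ : Finset F).image (fun x => (a ^ 2 + a' ^ 2) * x) ⊆
        {0, a, a', a + a'} := by
      intro w hw
      obtain ⟨x, -, rfl⟩ := Finset.mem_image.1 hw
      rw [hlin x]
      rcases trace2_eq_zero_or_one hF (a * x) with h1 | h1 <;>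
      rcases trace2_eq_zero_or_one hF (a' * x) with h2 | h2 <;> simp [ht, h1, h2]
    have h4 := (Finset.card_le_card hsub).trans Finset.card_le_four
    rw [Finset.card_image_of_injective _ (mul_right_injective₀ hd), Finset.card_univ, hF] at h4
    have : 2 ^ 3 ≤ 2 ^ (2 * h + 1) := Nat.pow_le_pow_right (by norm_num) (by omega)
    omega
  subst haa
  have hbb : b = b' := by
    apply eq_of_add_eq_zero
    refine eq_zero_of_traceChar hF hψ fun z => ?_
    have h1 := mul_left_cancel₀ (hqne _) (hmain' z)
    rw [mul_comm z, add_mul, AddChar.map_add_eq_mul, ← hχ, h1, addChar_mul_self]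
  subst hbb
  obtain ⟨p, hp⟩ := hex
  have h1 := congrFun heq p
  simp only [signArray, signPair, if_neg hp, kerdockForm] at h1
  have h2 := mul_left_cancel₀ (mul_ne_zero (mul_ne_zero (hqne _) (hχne _)) (hχne _)) h1
  rw [units_cast_injective hs, units_cast_injective h2]

omit [Fintype F] in
lemma kerdockForm_eq_one_or {r h : ℕ} (y e : J → F) (a : F) (p : J) :
    kerdockForm r h ψ y e a p = 1 ∨ kerdockForm r h ψ y e a p = -1 := by
  rw [kerdockForm]
  rcases mul_self_eq_one_iff.1 (quadChar_mul_self (r := r) (ψ := ψ) h (a * y p)) with h1 | h1 <;>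
  rcases addChar_eq_one_or (traceChar r ψ) (e p * (a * y p)) with h2 | h2 <;> simp [h1, h2]

theorem kerdock_isSignDesign {h : ℕ} (hh : 1 ≤ h) (hF : Fintype.card F = 2 ^ (2 * h + 1))
    (hψ : ψ 1 = -1) {y e : J → F} (he : ∀ p, e p = 0 ∨ e p = 1)
    (hinj : ∀ p p', y p = y p' → e p = e p' → p = p')
    (hfull : ∀ x, ∃ p, e p = 0 ∧ y p = x) (hex : ∃ p, e p ≠ 0) :
    IsSignDesign
      (signArray (2 * h + 1) ψ (kerdockForm (2 * h + 1) h ψ y e) y (signPair e)) where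
  sign := signArray_eq_one_or (kerdockForm_eq_one_or y e) (signPair_eq_one_or e)
  inj := kerdock_injective hh hF hψ hfull hex
  balanced := kerdock_balanced hF hψ he hinj

end Designs

section Cubic

variable {F : Type*} [Field F] [Fintype F] [CharP F 2] {J : Type*}
variable {r : ℕ} {ψ : AddChar F ℝ}

/-! ### Arrays from the cubing map -/

omit [Fintype F] in
/-- The points `(x, x³)` form a Sidon set. -/
lemma cubes_sidon {x y z w : F} (hxy : x ≠ y) (hxz : x ≠ z) (hyz : y ≠ z)
    (h1 : x + y + z + w = 0) (h3 : x ^ 3 + y ^ 3 + z ^ 3 + w ^ 3 = 0) : False := by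
  have h2 : (2 : F) = 0 := CharTwo.two_eq_zero
  have hw : w = x + y + z := (eq_of_add_eq_zero h1).symm
  have : (x + y) * ((x + z) * (y + z)) = 0 := by
    rw [hw] at h3
    linear_combination h3 - (x ^ 3 + y ^ 3 + z ^ 3 + (x + y) * (x + z) * (y + z)) * h2
  rcases mul_eq_zero.1 this with h | h
  · exact hxy (eq_of_add_eq_zero h)
  rcases mul_eq_zero.1 h with h | h
  · exact hxz (eq_of_add_eq_zero h)
  · exact hyz (eq_of_add_eq_zero h)

omit [Fintype F] in
/-- The elements of norm one over a subfield of index two form a Sidon set: if two of them have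
the nonzero sum `w`, then their product is the quotient of `w` and its conjugate. -/
lemma norm_one_sidon {m : ℕ} {x y z w : F} (hx : x ^ (2 ^ m + 1) = 1) (hy : y ^ (2 ^ m + 1) = 1)
    (hz : z ^ (2 ^ m + 1) = 1) (hw : w ^ (2 ^ m + 1) = 1) (hxy : x ≠ y) (hxz : x ≠ z) (hyz : y ≠ z)
    (h : x + y + z + w = 0) : False := by
  have h2 : (2 : F) = 0 := CharTwo.two_eq_zero
  have h' : x ^ 2 ^ m + y ^ 2 ^ m + z ^ 2 ^ m + w ^ 2 ^ m = 0 := by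
    rw [← add_pow_char_pow, ← add_pow_char_pow, ← add_pow_char_pow, h]
    exact zero_pow (by positivity)
  rw [pow_succ] at hx hy hz hw
  have hs : x + y ≠ 0 := fun h0 => hxy (eq_of_add_eq_zero h0)
  have hzw : z + w = x + y := by linear_combination h - (x + y) * h2
  have key : (x + y) * (x * y + z * w) = 0 := by
    have h4 : x * y * z * w * (x ^ 2 ^ m + y ^ 2 ^ m + z ^ 2 ^ m + w ^ 2 ^ m) = 0 := by
      rw [h', mul_zero]
    have h5 : y * z * w + x * z * w + x * y * w + x * y * z = 0 := by
      linear_combination h4 - y * z * w * hx - x * z * w * hy - x * y * w * hz - x * y * z * hw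
    linear_combination h5 - x * y * hzw
  have hp : x * y + z * w = 0 := (mul_eq_zero.1 key).resolve_left hs
  have : (z + x) * (z + y) = 0 := by linear_combination hp - z * hzw + z * z * h2
  rcases mul_eq_zero.1 this with h | h
  · exact hxz (eq_of_add_eq_zero h).symm
  · exact hyz (eq_of_add_eq_zero h).symm

/-- The rows are the functions `tr(a g_p)` plus linear and constant terms. -/
def traceForm (r : ℕ) (ψ : AddChar F ℝ) (g : J → F) (a : F) (p : J) : ℝ :=
  traceChar r ψ (a * g p)

omit [Fintype F] in
lemma prod_traceForm (g : J → F) (a : F) (O : Finset J) :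
    ∏ p ∈ O, traceForm r ψ g a p = traceChar r ψ (a * ∑ p ∈ O, g p) := by
  rw [Finset.mul_sum, addChar_map_sum]; rfl

lemma mul_cube_char (hF : Fintype.card F = 2 ^ r) (A x u : F) :
    traceChar r ψ (A * (x + u) ^ 3) * traceChar r ψ (A * x ^ 3) * traceChar r ψ (A * u ^ 3) =
      traceChar r ψ (x ^ 2 * (A * u + A ^ 2 * u ^ 4)) := by
  have h2 : (2 : F) = 0 := CharTwo.two_eq_zero
  have h : traceChar r ψ (A * u ^ 2 * x) = traceChar r ψ (A ^ 2 * u ^ 4 * x ^ 2) := by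
    rw [← traceChar_sq hF]; ring_nf
  rw [mul_add (x ^ 2), AddChar.map_add_eq_mul, show x ^ 2 * (A ^ 2 * u ^ 4) =
    A ^ 2 * u ^ 4 * x ^ 2 by ring, ← h]
  simp only [← AddChar.map_add_eq_mul]
  congr 1
  linear_combination (A * x ^ 3 + A * u ^ 3 + A * x ^ 2 * u + A * x * u ^ 2) * h2

omit [CharP F 2] in
lemma exists_sq_eq (hF : Fintype.card F = 2 ^ r) (hr : r ≠ 0) (x : F) : ∃ z : F, z ^ 2 = x := by
  refine ⟨x ^ 2 ^ (r - 1), ?_⟩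
  rw [← pow_mul, ← pow_succ, Nat.sub_add_cancel (Nat.pos_of_ne_zero hr), pow_two_pow hF]

omit [Fintype F] in
lemma traceForm_eq_one_or (g : J → F) (a : F) (p : J) :
    traceForm r ψ g a p = 1 ∨ traceForm r ψ g a p = -1 :=
  addChar_eq_one_or _ _

/-- The array with the columns `(y, y³, 0)`, `y ∈ F`, and `(0, g, 1)`, where the elements `g` form
a Sidon set. -/
theorem cubicPair_isSignDesign (hF : Fintype.card F = 2 ^ r) (hr : r ≠ 0) (hψ : ψ 1 = -1)
    {y e g : J → F} (he : ∀ p, e p = 0 ∨ e p = 1)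
    (hinj : ∀ p p', e p = 0 → e p' = 0 → y p = y p' → p = p')
    (hcube : ∀ p, e p = 0 → g p = y p ^ 3) (hy0 : ∀ p, e p = 1 → y p = 0)
    (hginj : ∀ p p', e p = 1 → e p' = 1 → g p = g p' → p = p')
    (hsidon : ∀ a b c d, e a = 1 → e b = 1 → e c = 1 → e d = 1 → a ≠ b → a ≠ c → b ≠ c →
      g a + g b + g c + g d ≠ 0)
    (hfull : ∀ x, ∃ p, e p = 0 ∧ y p = x) (hex : ∃ p, e p = 1)
    (hspan : (∃ u : F, u ≠ 0 ∧ u ^ 3 ≠ 1) ∨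
      ∃ p p', e p = 1 ∧ e p' = 1 ∧ traceChar r ψ (g p) ≠ traceChar r ψ (g p')) :
    IsSignDesign (signArray r ψ (traceForm r ψ g) y (signPair e)) where
  sign := signArray_eq_one_or (traceForm_eq_one_or g) (signPair_eq_one_or e)
  balanced := by
    classical
    intro O hO hO5
    refine sum_prod_signArray hF hψ O fun hs hy => ?_
    obtain ⟨hev, hes⟩ := even_of_sum_signPair he hs
    simp only [prod_traceForm]
    refine sum_traceChar_mul hF hψ fun hg => ?_
    have h11 : (1 : F) + 1 = 0 := CharTwo.add_self_eq_zero 1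
    have hne : (1 : F) ≠ 0 := one_ne_zero
    rcases card_two_or_four hev hO hO5 with hc | hc
    · obtain ⟨p, p', hne', rfl⟩ := Finset.card_eq_two.1 hc
      rw [Finset.sum_pair hne'] at hy hes hg
      have hee := eq_of_add_eq_zero hes
      rcases he p with h | h
      · exact hne' (hinj _ _ h (hee ▸ h) (eq_of_add_eq_zero hy))
      · exact hne' (hginj _ _ h (hee ▸ h) (eq_of_add_eq_zero hg))
    · obtain ⟨p1, p2, p3, p4, h12, h13, h14, h23, h24, h34, rfl⟩ :=
        Finset.exists_of_card_eq_four hc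
      have hsum : ∀ f : J → F, ∑ p ∈ {p1, p2, p3, p4}, f p = f p1 + f p2 + f p3 + f p4 := by
        intro f
        rw [Finset.sum_insert (by simp [*]), Finset.sum_insert (by simp [*]), Finset.sum_pair h34]
        ring
      rw [hsum] at hy hes hg
      have hyne : ∀ p p', p ≠ p' → e p = 0 → e p' = 0 → y p ≠ y p' :=
        fun p p' h h1 h2 h3 => h (hinj p p' h1 h2 h3)
      rcases he p1 with e1 | e1 <;> rcases he p2 with e2 | e2 <;> rcases he p3 with e3 | e3 <;>
        rcases he p4 with e4 | e4
      case inl.inl.inl.inl =>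
        rw [hcube _ e1, hcube _ e2, hcube _ e3, hcube _ e4] at hg
        exact cubes_sidon (hyne _ _ h12 e1 e2) (hyne _ _ h13 e1 e3) (hyne _ _ h23 e2 e3) hy hg
      case inr.inr.inr.inr => exact hsidon _ _ _ _ e1 e2 e3 e4 h12 h13 h23 hg
      case inl.inl.inr.inr =>
        rw [hy0 _ e3, hy0 _ e4, add_zero, add_zero] at hy
        exact hyne _ _ h12 e1 e2 (eq_of_add_eq_zero hy)
      case inl.inr.inl.inr =>
        rw [hy0 _ e2, hy0 _ e4, add_zero, add_zero] at hy
        exact hyne _ _ h13 e1 e3 (eq_of_add_eq_zero hy)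
      case inl.inr.inr.inl =>
        rw [hy0 _ e2, hy0 _ e3, add_zero, add_zero] at hy
        exact hyne _ _ h14 e1 e4 (eq_of_add_eq_zero hy)
      case inr.inl.inl.inr =>
        rw [hy0 _ e1, hy0 _ e4, zero_add, add_zero] at hy
        exact hyne _ _ h23 e2 e3 (eq_of_add_eq_zero hy)
      case inr.inl.inr.inl =>
        rw [hy0 _ e1, hy0 _ e3, zero_add, add_zero] at hy
        exact hyne _ _ h24 e2 e4 (eq_of_add_eq_zero hy)
      case inr.inr.inl.inl =>
        rw [hy0 _ e1, hy0 _ e2, zero_add, zero_add] at hy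
        exact hyne _ _ h34 e3 e4 (eq_of_add_eq_zero hy)
      -- The remaining cases have an odd number of columns of either kind.
      all_goals
        rw [e1, e2, e3, e4] at hes
        simp [h11] at hes
  inj := by
    rintro ⟨a, b, s0, s1⟩ ⟨a', b', s0', s1'⟩ heq
    set χ := traceChar r ψ with hχ
    have hχχ := addChar_mul_self χ
    have hmain : ∀ x, χ (a * x ^ 3) * χ (b * x) * ((s0 : ℤ) : ℝ) =
        χ (a' * x ^ 3) * χ (b' * x) * ((s0' : ℤ) : ℝ) := by
      intro x
      obtain ⟨p, hp, rfl⟩ := hfull x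
      have := congrFun heq p
      simpa [signArray, traceForm, signPair, hp, hcube p hp] using this
    have hs : ((s0 : ℤ) : ℝ) = ((s0' : ℤ) : ℝ) := by simpa using hmain 0
    have hs0 : ((s0' : ℤ) : ℝ) ≠ 0 := by
      rcases units_cast_eq_one_or s0' with h | h <;> rw [h] <;> norm_num
    have hmain' : ∀ x, χ ((a + a') * x ^ 3) * χ ((b + b') * x) = 1 := by
      intro x
      have := hmain x
      rw [hs] at this
      have h1 := mul_right_cancel₀ hs0 this
      simp only [add_mul, AddChar.map_add_eq_mul]
      linear_combination χ (a' * x ^ 3) * χ (b' * x) * h1 +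
        χ (b' * x) * χ (b' * x) * hχχ (a' * x ^ 3) + hχχ (b' * x)
    have hextra : ∀ p, e p = 1 → χ ((a + a') * g p) * (((s1 : ℤ) : ℝ) * ((s1' : ℤ) : ℝ)) = 1 := by
      intro p hp
      have h1 := congrFun heq p
      have hp0 : e p ≠ 0 := by rw [hp]; exact one_ne_zero
      simp only [signArray, traceForm, signPair, if_neg hp0, hy0 p hp, mul_zero,
        AddChar.map_zero_eq_one, mul_one, ← hχ] at h1
      rw [add_mul, AddChar.map_add_eq_mul]
      have h2 : ((s1' : ℤ) : ℝ) * ((s1' : ℤ) : ℝ) = 1 := by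
        rcases units_cast_eq_one_or s1' with h | h <;> rw [h] <;> norm_num
      linear_combination χ (a' * g p) * ((s1' : ℤ) : ℝ) * h1 +
        ((s1' : ℤ) : ℝ) * ((s1' : ℤ) : ℝ) * hχχ (a' * g p) + h2
    have hzero : ∀ u : F, (a + a') * u + (a + a') ^ 2 * u ^ 4 = 0 := by
      intro u
      refine eq_zero_of_traceChar hF hψ fun z => ?_
      obtain ⟨x, rfl⟩ := exists_sq_eq hF hr z
      rw [← mul_cube_char hF, ← hχ]
      have h1 := hmain' (x + u)
      have h2 := hmain' x
      have h3 := hmain' u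
      rw [mul_add (b + b'), AddChar.map_add_eq_mul] at h1
      have h4 := hχχ ((b + b') * x)
      have h5 := hχχ ((b + b') * u)
      have h6 : (χ ((a + a') * (x + u) ^ 3) * (χ ((b + b') * x) * χ ((b + b') * u))) *
        (χ ((a + a') * x ^ 3) * χ ((b + b') * x)) *
          (χ ((a + a') * u ^ 3) * χ ((b + b') * u)) = 1 := by
        rw [h1, h2, h3]; norm_num
      rw [← h6]
      linear_combination (-(χ ((a + a') * (x + u) ^ 3) * χ ((a + a') * x ^ 3) *
        χ ((a + a') * u ^ 3) * (χ ((b + b') * u) * χ ((b + b') * u)))) * h4 -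
        (χ ((a + a') * (x + u) ^ 3) * χ ((a + a') * x ^ 3) * χ ((a + a') * u ^ 3)) * h5
    have haa : a + a' = 0 := by
      by_contra hne
      have h1 : a + a' = 1 := by
        have h0 := hzero 1
        have : (a + a') * (1 + (a + a')) = 0 := by linear_combination h0
        exact (eq_of_add_eq_zero ((mul_eq_zero.1 this).resolve_left hne)).symm
      rcases hspan with ⟨u, hu0, hu3⟩ | ⟨p, p', hp, hp', hpp⟩
      · have h0 := hzero u
        rw [h1] at h0
        have : u * (1 + u ^ 3) = 0 := by linear_combination h0
        exact hu3 (eq_of_add_eq_zero ((mul_eq_zero.1 this).resolve_left hu0)).symm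
      · have h3 := hextra p hp
        have h4 := hextra p' hp'
        rw [h1, one_mul] at h3 h4
        have h5 : ((s1 : ℤ) : ℝ) * ((s1' : ℤ) : ℝ) ≠ 0 := by
          intro h; rw [h, mul_zero] at h3; norm_num at h3
        exact hpp (mul_right_cancel₀ h5 (h3.trans h4.symm))
    have hbb : b + b' = 0 := by
      refine eq_zero_of_traceChar hF hψ fun z => ?_
      have := hmain' z
      rwa [haa, zero_mul, AddChar.map_zero_eq_one, one_mul, mul_comm] at this
    have hs1 : s1 = s1' := by
      obtain ⟨p, hp⟩ := hex
      have := hextra p hp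
      rw [haa, zero_mul, AddChar.map_zero_eq_one, one_mul] at this
      rcases Int.units_eq_one_or s1 with rfl | rfl <;>
        rcases Int.units_eq_one_or s1' with rfl | rfl <;> first | rfl | norm_num at this
    rw [eq_of_add_eq_zero haa, eq_of_add_eq_zero hbb, units_cast_injective hs, hs1]

/-- The character sums of cubic polynomials over a field of order `2 ^ r`, `r` odd, are at most
`√(2 |F|)` in absolute value. -/
lemma sq_sum_cubic_le (hF : Fintype.card F = 2 ^ r) (hr : Odd r) (hψ : ψ 1 = -1) {A : F}
    (hA : A ≠ 0) (B : F) :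
    (∑ x, traceChar r ψ (A * x ^ 3) * traceChar r ψ (B * x)) ^ 2 ≤ 2 * (2 : ℝ) ^ r := by
  classical
  set χ := traceChar r ψ with hχ
  have hr0 : r ≠ 0 := by rintro rfl; simp at hr
  have hχχ := addChar_mul_self χ
  have hsq : (fun x : F => x ^ 2).Bijective :=
    Finite.surjective_iff_bijective.1 (fun x => exists_sq_eq hF hr0 x)
  have h1 : (∑ x, χ (A * x ^ 3) * χ (B * x)) ^ 2 =
      ∑ u, χ (A * u ^ 3) * χ (B * u) * ∑ x, χ (x * (A * u + A ^ 2 * u ^ 4)) := by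
    rw [sq, Finset.sum_mul_sum]
    have : ∀ x, ∑ z, χ (A * x ^ 3) * χ (B * x) * (χ (A * z ^ 3) * χ (B * z)) =
        ∑ u, χ (A * u ^ 3) * χ (B * u) * χ (x ^ 2 * (A * u + A ^ 2 * u ^ 4)) := by
      intro x
      rw [← Equiv.sum_comp (Equiv.addLeft x)]
      refine Finset.sum_congr rfl fun u _ => ?_
      rw [← mul_cube_char hF, ← hχ]
      simp only [Equiv.coe_addLeft, mul_add B, AddChar.map_add_eq_mul]
      linear_combination (χ (A * x ^ 3) * χ (A * (x + u) ^ 3) * χ (B * u)) * hχχ (B * x) -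
        (χ (A * x ^ 3) * χ (A * (x + u) ^ 3) * χ (B * u)) * hχχ (A * u ^ 3)
    rw [Finset.sum_congr rfl fun x _ => this x, Finset.sum_comm]
    refine Finset.sum_congr rfl fun u _ => ?_
    rw [← Finset.mul_sum, ← hsq.sum_comp (fun x => χ (x * (A * u + A ^ 2 * u ^ 4)))]
  set U := Finset.univ.filter fun u : F => A * u + A ^ 2 * u ^ 4 = 0 with hU
  have hcube : ∀ u v : F, u ∈ U → v ∈ U → u ≠ 0 → v ≠ 0 → u = v := by
    intro u v hu hv hu0 hv0
    have h3 : ∀ w ∈ U, w ≠ 0 → A * w ^ 3 = 1 := by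
      intro w hw hw0
      have h0 := (Finset.mem_filter.1 hw).2
      have : (A * w) * (1 + A * w ^ 3) = 0 := by linear_combination h0
      exact (eq_of_add_eq_zero ((mul_eq_zero.1 this).resolve_left (mul_ne_zero hA hw0))).symm
    by_contra hne
    have h4 : (u - v) * (u ^ 2 + u * v + v ^ 2) = 0 := by
      refine (mul_eq_zero.1 (?_ : A * _ = 0)).resolve_left hA
      linear_combination h3 u hu hu0 - h3 v hv hv0
    have h5 := (mul_eq_zero.1 h4).resolve_left (sub_ne_zero.2 hne)
    refine sq_add_add_one_ne_zero hF hr (u / v) ?_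
    field_simp
    linear_combination h5
  have hUcard : U.card ≤ 2 := by
    have : (U.erase 0).card ≤ 1 := by
      rw [Finset.card_le_one]
      intro u hu v hv
      rw [Finset.mem_erase] at hu hv
      exact hcube u v hu.2 hv.2 hu.1 hv.1
    have := Finset.pred_card_le_card_erase (s := U) (a := 0)
    omega
  rw [h1]
  calc _ = ∑ u ∈ U, χ (A * u ^ 3) * χ (B * u) * ∑ x, χ (x * (A * u + A ^ 2 * u ^ 4)) := by
        symm
        refine Finset.sum_subset (Finset.subset_univ _) fun u _ hu => ?_
        rw [sum_traceChar_mul hF hψ, mul_zero]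
        simpa [hU] using hu
    _ ≤ ∑ u ∈ U, (2 : ℝ) ^ r := by
        refine Finset.sum_le_sum fun u hu => ?_
        rw [(Finset.mem_filter.1 hu).2]
        simp only [mul_zero, AddChar.map_zero_eq_one, Finset.sum_const, Finset.card_univ, hF]
        have : χ (A * u ^ 3) * χ (B * u) ≤ 1 := by
          rw [← AddChar.map_add_eq_mul]
          rcases addChar_eq_one_or χ (A * u ^ 3 + B * u) with h | h <;> rw [h]; norm_num
        have h2 : (0 : ℝ) < 2 ^ r := by positivity
        simp only [nsmul_eq_mul, mul_one]
        push_cast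
        nlinarith
    _ ≤ 2 * (2 : ℝ) ^ r := by
        rw [Finset.sum_const, nsmul_eq_mul]
        have : (U.card : ℝ) ≤ 2 := by exact_mod_cast hUcard
        gcongr

/-- The array with the columns `(y, y³)`. Its rows are distinct as soon as the number of columns
exceeds `(|F| + √(2 |F|)) / 2`. -/
theorem cubic_isSignDesign [Fintype J] (hF : Fintype.card F = 2 ^ r) (hr : Odd r) (hψ : ψ 1 = -1)
    {y : J → F} (hinj : Function.Injective y) (hlo : 2 ^ r < 2 * Fintype.card J)
    (hcard : (2 : ℝ) * 2 ^ r < (2 * Fintype.card J - 2 ^ r) ^ 2) :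
    IsSignDesign (signArray r ψ (traceForm r ψ fun p => y p ^ 3) y signConst) where
  sign := signArray_eq_one_or (traceForm_eq_one_or _) fun s _ => units_cast_eq_one_or s
  balanced := by
    classical
    intro O hO hO5
    refine sum_prod_signArray hF hψ O fun hs hy => ?_
    have hev := even_of_sum_signConst hs
    simp only [prod_traceForm]
    refine sum_traceChar_mul hF hψ fun hg => ?_
    rcases card_two_or_four hev hO hO5 with hc | hc
    · obtain ⟨p, p', hne', rfl⟩ := Finset.card_eq_two.1 hc
      rw [Finset.sum_pair hne'] at hy
      exact hne' (hinj (eq_of_add_eq_zero hy))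
    · obtain ⟨p1, p2, p3, p4, h12, h13, h14, h23, h24, h34, rfl⟩ :=
        Finset.exists_of_card_eq_four hc
      have hsum : ∀ f : J → F, ∑ p ∈ {p1, p2, p3, p4}, f p = f p1 + f p2 + f p3 + f p4 := by
        intro f
        rw [Finset.sum_insert (by simp [*]), Finset.sum_insert (by simp [*]), Finset.sum_pair h34]
        ring
      rw [hsum] at hy hg
      exact cubes_sidon (hinj.ne h12) (hinj.ne h13) (hinj.ne h23) hy hg
  inj := by
    classical
    rintro ⟨a, b, s⟩ ⟨a', b', s'⟩ heq
    set χ := traceChar r ψ with hχ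
    have hχχ := addChar_mul_self χ
    set f : F → ℝ := fun x => χ ((a + a') * x ^ 3) * χ ((b + b') * x) with hf
    have hf1 : ∀ x, f x = 1 ∨ f x = -1 := fun x => by
      simp only [hf, ← AddChar.map_add_eq_mul]; exact addChar_eq_one_or _ _
    obtain ⟨κ, hκ, hκs⟩ : ∃ κ : ℝ, (κ = 1 ∨ κ = -1) ∧ ((s : ℤ) : ℝ) = κ * ((s' : ℤ) : ℝ) := by
      rcases units_cast_eq_one_or s with h | h <;> rcases units_cast_eq_one_or s' with h' | h' <;>
      rw [h, h']
      · exact ⟨1, by norm_num, by norm_num⟩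
      · exact ⟨-1, by norm_num, by norm_num⟩
      · exact ⟨-1, by norm_num, by norm_num⟩
      · exact ⟨1, by norm_num, by norm_num⟩
    have hκκ : κ * κ = 1 := by rcases hκ with rfl | rfl <;> norm_num
    have hs0 : ((s' : ℤ) : ℝ) ≠ 0 := by
      rcases units_cast_eq_one_or s' with h | h <;> rw [h] <;> norm_num
    have hmain : ∀ p, κ * f (y p) = 1 := by
      intro p
      have h1 := congrFun heq p
      simp only [signArray, traceForm, signConst, hκs, ← mul_assoc, ← hχ] at h1
      have h1 := mul_right_cancel₀ hs0 h1
      simp only [hf, add_mul, AddChar.map_add_eq_mul]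
      linear_combination χ (a' * y p ^ 3) * χ (b' * y p) * h1 +
        χ (b' * y p) * χ (b' * y p) * hχχ (a' * y p ^ 3) + hχχ (b' * y p)
    have hsum : (2 * Fintype.card J - 2 ^ r : ℝ) ≤ κ * ∑ x, f x := by
      have hle : ∑ x, (2 * (if x ∈ Finset.univ.image y then (1 : ℝ) else 0) - 1) ≤
          ∑ x, κ * f x := by
        refine Finset.sum_le_sum fun x _ => ?_
        split_ifs with hx
        · obtain ⟨p, -, rfl⟩ := Finset.mem_image.1 hx
          rw [hmain p]; norm_num
        · rcases hκ with rfl | rfl <;> rcases hf1 x with h | h <;> rw [h] <;> norm_num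
      rw [← Finset.mul_sum, Finset.sum_sub_distrib, ← Finset.mul_sum, Finset.sum_boole,
        Finset.filter_mem_eq_inter, Finset.univ_inter, Finset.card_image_of_injective _ hinj] at hle
      simpa [hF] using hle
    have hpos : (0 : ℝ) < 2 * Fintype.card J - 2 ^ r := by
      have : ((2 ^ r : ℕ) : ℝ) < ((2 * Fintype.card J : ℕ) : ℝ) := by exact_mod_cast hlo
      push_cast at this; linarith
    have haa : a + a' = 0 := by
      by_contra hne
      have h1 := sq_sum_cubic_le hF hr hψ hne (b + b')
      have h2 : (2 * Fintype.card J - 2 ^ r : ℝ) ^ 2 ≤ (κ * ∑ x, f x) ^ 2 :=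
        pow_le_pow_left₀ hpos.le hsum 2
      rw [mul_pow, sq κ, hκκ, one_mul] at h2
      exact absurd (hcard.trans_le (h2.trans h1)) (lt_irrefl _)
    have hbb : b + b' = 0 := by
      by_contra hne
      have h1 := sum_traceChar_mul hF hψ hne
      have h2 : ∑ x, f x = 0 := by
        rw [← h1]
        refine Finset.sum_congr rfl fun x _ => ?_
        simp only [hf, haa, zero_mul, AddChar.map_zero_eq_one, one_mul, ← hχ]
        rw [mul_comm]
      rw [h2, mul_zero] at hsum
      linarith
    have hκ1 : κ = 1 := by
      have hJ : Nonempty J := by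
        rw [← Fintype.card_pos_iff]
        by_contra h0
        have : Fintype.card J = 0 := by omega
        rw [this] at hlo; simp at hlo
      obtain ⟨p⟩ := hJ
      have := hmain p
      simpa [hf, haa, hbb] using this
    rw [hκ1, one_mul] at hκs
    rw [eq_of_add_eq_zero haa, eq_of_add_eq_zero hbb, units_cast_injective hκs]

end Cubic

/-! ### Linear recurring sequences of maximal period -/

/-- The `i`-th most significant of the `r` binary digits of `c < 2 ^ r` is `1`. -/
def topBit (r c i : ℕ) : Prop := 2 ^ r ≤ 2 * (2 ^ i * c % 2 ^ r)

lemma exists_topBit (r : ℕ) (f : ℕ → Prop) :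
    ∃ c < 2 ^ r, ∀ i < r, topBit r c i ↔ f i := by
  classical
  induction r generalizing f with
  | zero => exact ⟨0, by simp, by simp⟩
  | succ r ih =>
    obtain ⟨c, hc, h⟩ := ih fun i => f (i + 1)
    refine ⟨(if f 0 then 2 ^ r else 0) + c, ?_, ?_⟩
    · rw [pow_succ]; split_ifs <;> omega
    · rintro (_ | i) hi
      · rw [topBit, pow_zero, one_mul, Nat.mod_eq_of_lt (by rw [pow_succ]; split_ifs <;> omega),
          pow_succ]
        split_ifs with h0
        · simp only [h0, iff_true]; omega
        · simp only [h0, iff_false]; omega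
      · rw [← h i (by omega), topBit, topBit]
        have : 2 ^ (i + 1) * ((if f 0 then 2 ^ r else 0) + c) % 2 ^ (r + 1) =
            2 * (2 ^ i * c % 2 ^ r) := by
          rw [← Nat.mul_mod_mul_left, ← pow_succ']
          split_ifs
          · rw [mul_add, show 2 ^ (i + 1) * 2 ^ r + 2 ^ (i + 1) * c =
              2 * (2 ^ i * c) + 2 ^ (r + 1) * 2 ^ i by ring, Nat.add_mul_mod_self_left]
          · rw [zero_add, pow_succ', mul_assoc]
        rw [this, pow_succ']
        omega

open Classical in
/-- `S` satisfies, for its first `N` steps, the linear recurrence of order `r` over `𝔽₂` with the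
taps given by the digits of `c`, and starts with `1, 0, …, 0`. The sequence is written
multiplicatively, with `-1` for `1` and `1` for `0`. -/
structure IsLFSR (r c N : ℕ) (S : ℕ → ℝ) : Prop where
  zero : S 0 = -1
  init : ∀ i, 0 < i → i < r → S i = 1
  step : ∀ t < N, S (t + r) = ∏ i ∈ Finset.range r, if topBit r c i then S (t + i) else 1

/-- The initial window of length `r` does not return within the first `2 ^ r - 2` shifts. -/
def NoEarlyReturn (r : ℕ) (S : ℕ → ℝ) : Prop :=
  ∀ t, 0 < t → t < 2 ^ r - 1 → ∃ i < r, S (t + i) ≠ S i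

open Classical in
lemma IsLFSR.eq_char {R : Type*} [CommRing R] {r c N : ℕ} {S : ℕ → ℝ} (hS : IsLFSR r c N S)
    {α : R} {ψ : AddChar R ℝ}
    (hα : α ^ r = ∑ i ∈ Finset.range r, if topBit r c i then α ^ i else 0) (h0 : ψ 1 = -1)
    (hi : ∀ i, 0 < i → i < r → ψ (α ^ i) = 1) (t : ℕ) (ht : t < N + r) : S t = ψ (α ^ t) := by
  induction t using Nat.strong_induction_on with
  | _ t ih =>
    rcases Nat.lt_or_ge t r with h | h
    · rcases Nat.eq_zero_or_pos t with rfl | h'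
      · rw [hS.zero, pow_zero, h0]
      · rw [hS.init t h' h, hi t h' h]
    · obtain ⟨t, rfl⟩ := Nat.exists_eq_add_of_le' h
      rw [hS.step t (by omega), pow_add, hα, Finset.mul_sum, addChar_map_sum]
      refine Finset.prod_congr rfl fun i hir => ?_
      have hir := Finset.mem_range.1 hir
      split_ifs
      · rw [ih (t + i) (by omega) (by omega), pow_add]
      · rw [mul_zero, AddChar.map_zero_eq_one]

/-- The nontrivial sign character of `𝔽₂`. -/
def signChar : AddChar (ZMod 2) ℝ := AddChar.zmodChar 2 (ζ := (-1 : ℝ)) (by norm_num)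

lemma signChar_one : signChar 1 = -1 := by
  rw [signChar, AddChar.zmodChar_apply, ZMod.val_one]; norm_num

lemma eq_zero_of_signChar {x : ZMod 2} (h : signChar x = 1) : x = 0 := by
  have : x = 0 ∨ x = 1 := by clear h; revert x; decide
  rcases this with rfl | rfl
  · rfl
  · rw [signChar_one] at h; norm_num at h

/-- The functional equal to `1` at `1` and to `0` at the other elements of a power basis. -/
def firstCoord {R : Type*} [CommRing R] [Algebra (ZMod 2) R] (pb : PowerBasis (ZMod 2) R) :
    R →ₗ[ZMod 2] ZMod 2 :=
  pb.basis.constr (ZMod 2) fun i => if (i : ℕ) = 0 then 1 else 0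

lemma firstCoord_pow {R : Type*} [CommRing R] [Algebra (ZMod 2) R] (pb : PowerBasis (ZMod 2) R)
    {i : ℕ} (hi : i < pb.dim) : firstCoord pb (pb.gen ^ i) = if i = 0 then 1 else 0 := by
  have := pb.basis.constr_basis (ZMod 2) (fun i => if (i : ℕ) = 0 then (1 : ZMod 2) else 0) ⟨i, hi⟩
  rwa [pb.basis_eq_pow] at this

/-- The character attached to the first coordinate. -/
def firstCoordChar {R : Type*} [CommRing R] [Algebra (ZMod 2) R] (pb : PowerBasis (ZMod 2) R) :
    AddChar R ℝ :=
  signChar.compAddMonoidHom (firstCoord pb).toAddMonoidHom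

lemma firstCoordChar_apply {R : Type*} [CommRing R] [Algebra (ZMod 2) R]
    (pb : PowerBasis (ZMod 2) R) (x : R) : firstCoordChar pb x = signChar (firstCoord pb x) := rfl

/-- A field of order `2 ^ r` with a primitive element `α` and a sign character `ψ`, `ψ 1 = -1`,
such that `S t = ψ (α ^ t)` over a period. -/
def IsFieldSequence (r : ℕ) (S : ℕ → ℝ) : Prop :=
  ∃ (F : Type) (_ : Field F) (_ : Fintype F) (_ : CharP F 2) (α : F) (ψ : AddChar F ℝ),
    Fintype.card F = 2 ^ r ∧ ψ 1 = -1 ∧ orderOf α = 2 ^ r - 1 ∧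
      ∀ t < 2 ^ r - 1, S t = ψ (α ^ t)

open Polynomial Classical in
/-- The polynomial whose coefficients are the taps. -/
def tapPoly (r c : ℕ) : (ZMod 2)[X] :=
  X ^ r + ∑ i ∈ Finset.range r, C (if topBit r c i then 1 else 0) * X ^ i

open Polynomial in
lemma tapPoly_degree_lt (r c : ℕ) :
    (∑ i ∈ Finset.range r, C (open Classical in if topBit r c i then (1 : ZMod 2) else 0) *
      X ^ i).degree < (r : WithBot ℕ) := by
  refine (degree_sum_le _ _).trans_lt ((Finset.sup_lt_iff (WithBot.bot_lt_coe r)).2 fun i hi => ?_)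
  exact (degree_C_mul_X_pow_le _ _).trans_lt (WithBot.coe_lt_coe.2 (Finset.mem_range.1 hi))

lemma tapPoly_monic (r c : ℕ) : (tapPoly r c).Monic :=
  Polynomial.monic_X_pow_add (tapPoly_degree_lt r c)

lemma tapPoly_natDegree (r c : ℕ) : (tapPoly r c).natDegree = r := by
  have := Polynomial.degree_add_eq_left_of_degree_lt
    (p := (Polynomial.X ^ r : Polynomial (ZMod 2)))
    ((tapPoly_degree_lt r c).trans_eq (Polynomial.degree_X_pow r).symm)
  rw [Polynomial.degree_X_pow] at this
  exact Polynomial.natDegree_eq_of_degree_eq_some this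

open Classical in
lemma root_tapPoly_pow (r c : ℕ) : AdjoinRoot.root (tapPoly r c) ^ r =
    ∑ i ∈ Finset.range r, if topBit r c i then AdjoinRoot.root (tapPoly r c) ^ i else 0 := by
  have h : AdjoinRoot.mk (tapPoly r c) (tapPoly r c) = 0 := AdjoinRoot.mk_self
  conv at h => lhs; arg 2; rw [tapPoly]
  rw [map_add, map_pow, AdjoinRoot.mk_X, map_sum] at h
  have hchar : ∀ x : AdjoinRoot (tapPoly r c), x + x = 0 := fun x => by
    rw [← two_smul (ZMod 2) x, show (2 : ZMod 2) = 0 from rfl, zero_smul]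
  have h2 : AdjoinRoot.root (tapPoly r c) ^ r = ∑ i ∈ Finset.range r,
      AdjoinRoot.mk (tapPoly r c)
        (Polynomial.C (if topBit r c i then 1 else 0) * Polynomial.X ^ i) := by
    rw [eq_neg_of_add_eq_zero_left h]
    exact (eq_neg_of_add_eq_zero_left (hchar _)).symm
  rw [h2]
  refine Finset.sum_congr rfl fun i _ => ?_
  split_ifs <;> simp

/-- If the initial window does not return early, then the root of the tap polynomial has order
`2 ^ r - 1`, so its powers exhaust the nonzero elements and the quotient ring is a field. -/
theorem isFieldSequence_of_noEarlyReturn {r c N : ℕ} {S : ℕ → ℝ} (hr : 2 ≤ r)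
    (hc : 2 ^ (r - 1) ≤ c) (hc' : c < 2 ^ r) (hN : 2 ^ r - 1 ≤ N) (hS : IsLFSR r c N S)
    (hret : NoEarlyReturn r S) : IsFieldSequence r S := by
  classical
  set P := tapPoly r c with hP
  set α := AdjoinRoot.root P with hα
  set pb : PowerBasis (ZMod 2) (AdjoinRoot P) := AdjoinRoot.powerBasis' (tapPoly_monic r c) with hpb
  have hgen : pb.gen = α := rfl
  have hdim : pb.dim = r := tapPoly_natDegree r c
  have hnt : Nontrivial (AdjoinRoot P) := by
    refine AdjoinRoot.nontrivial P ?_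
    rw [Polynomial.degree_eq_natDegree (tapPoly_monic r c).ne_zero, tapPoly_natDegree]
    exact_mod_cast (by omega : r ≠ 0)
  have hfin : Module.Finite (ZMod 2) (AdjoinRoot P) := pb.finite
  have hfin' : Finite (AdjoinRoot P) := Module.finite_of_finite (ZMod 2)
  let _ : Fintype (AdjoinRoot P) := Fintype.ofFinite _
  have hcard : Fintype.card (AdjoinRoot P) = 2 ^ r := by
    rw [Module.card_eq_pow_finrank (K := ZMod 2), ZMod.card, pb.finrank, hdim]
  have hchar : CharP (AdjoinRoot P) 2 :=
    charP_of_injective_algebraMap (algebraMap (ZMod 2) (AdjoinRoot P)).injective 2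
  have hpow : α ^ r = ∑ i ∈ Finset.range r, if topBit r c i then α ^ i else 0 :=
    root_tapPoly_pow r c
  have h1 : firstCoordChar pb 1 = -1 := by
    have := firstCoord_pow pb (i := 0) (by omega)
    rw [pow_zero, if_pos rfl] at this
    rw [firstCoordChar_apply, this, signChar_one]
  have hchr : ∀ t < N + r, S t = firstCoordChar pb (α ^ t) := by
    refine hS.eq_char hpow h1 fun i hi hir => ?_
    rw [firstCoordChar_apply, ← hgen, firstCoord_pow pb (by omega), if_neg (by omega),
      AddChar.map_zero_eq_one]
  -- The constant coefficient is nonzero, so `α` is invertible.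
  have hunit : IsUnit α := by
    obtain ⟨k, rfl⟩ : ∃ k, r = k + 1 := ⟨r - 1, by omega⟩
    rw [Finset.sum_range_succ', if_pos] at hpow
    · refine IsUnit.of_mul_eq_one
        (α ^ k - ∑ i ∈ Finset.range k, if topBit (k + 1) c (i + 1) then α ^ i else 0) ?_
      rw [mul_sub, ← pow_succ', hpow, Finset.mul_sum]
      have : ∀ i ∈ Finset.range k, (if topBit (k + 1) c (i + 1) then α ^ (i + 1) else 0) =
          α * if topBit (k + 1) c (i + 1) then α ^ i else 0 := by
        intro i _
        split_ifs
        · rw [pow_succ']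
        · rw [mul_zero]
      rw [Finset.sum_congr rfl this]
      simp
    · rw [topBit, pow_zero, one_mul, Nat.mod_eq_of_lt hc', pow_succ']
      simpa using hc
  have hne : ∀ t, 0 < t → t < 2 ^ r - 1 → α ^ t ≠ 1 := by
    intro t ht ht' h
    obtain ⟨i, hi, hne⟩ := hret t ht ht'
    apply hne
    rw [hchr _ (by omega), hchr _ (by omega), pow_add, h, one_mul]
  obtain ⟨u, hu⟩ := hunit
  have hord : orderOf α = 2 ^ r - 1 := by
    have h2 : orderOf u ≤ Fintype.card (AdjoinRoot P)ˣ := orderOf_le_card_univ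
    have h3 := card_units_lt (AdjoinRoot P)
    rw [← hu, orderOf_units]
    refine le_antisymm (by omega) (not_lt.1 fun hlt => ?_)
    refine hne (orderOf u) (orderOf_pos u) hlt ?_
    rw [← hu, ← orderOf_units, pow_orderOf_eq_one]
  have hall : ∀ x : AdjoinRoot P, x ≠ 0 → ∃ t, α ^ t = x := by
    set s := (Finset.range (2 ^ r - 1)).image (fun t => α ^ t) with hs
    have hscard : s.card = 2 ^ r - 1 := by
      rw [hs, Finset.card_image_of_injOn, Finset.card_range]
      intro i hi j hj hij
      rw [← hord] at hi hj
      exact pow_injOn_Iio_orderOf (by simpa using hi) (by simpa using hj) hij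
    have h0 : (0 : AdjoinRoot P) ∉ s := by
      intro h
      obtain ⟨t, -, ht⟩ := Finset.mem_image.1 h
      rw [← hu, ← Units.val_pow_eq_pow_val] at ht
      exact (u ^ t).ne_zero ht
    have huniv : insert 0 s = Finset.univ := by
      rw [← Finset.card_eq_iff_eq_univ, Finset.card_insert_of_notMem h0, hscard, hcard]
      have : 0 < 2 ^ r := by positivity
      omega
    intro x hx
    have : x ∈ insert 0 s := huniv ▸ Finset.mem_univ x
    obtain ⟨t, -, ht⟩ := Finset.mem_image.1 ((Finset.mem_insert.1 this).resolve_left hx)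
    exact ⟨t, ht⟩
  have hfield : IsField (AdjoinRoot P) := by
    refine ⟨hnt.exists_pair_ne, mul_comm, fun {x} hx => ?_⟩
    obtain ⟨t, rfl⟩ := hall x hx
    refine ⟨((u ^ t)⁻¹ : (AdjoinRoot P)ˣ), ?_⟩
    rw [← hu, ← Units.val_pow_eq_pow_val, Units.mul_inv]
  exact ⟨AdjoinRoot P, hfield.toField, inferInstance, hchar, α, firstCoordChar pb, hcard, h1, hord,
    fun t ht => hchr t (by omega)⟩

/-- Taps with the required property exist: the minimal polynomial of a primitive element. -/
theorem exists_noEarlyReturn {r : ℕ} (hr : 2 ≤ r) :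
    ∃ c, 2 ^ (r - 1) ≤ c ∧ c < 2 ^ r ∧ ∀ N S, 2 ^ r - 1 ≤ N → IsLFSR r c N S →
      NoEarlyReturn r S := by
  classical
  set F := GaloisField 2 r
  let _ : Fintype F := Fintype.ofFinite F
  have hcard : Fintype.card F = 2 ^ r := by
    rw [← Nat.card_eq_fintype_card, GaloisField.card 2 r (by omega)]
  obtain ⟨g, hg⟩ := IsCyclic.exists_generator (α := Fˣ)
  set α : F := (g : F) with hα
  have hint : IsIntegral (ZMod 2) α := IsIntegral.of_finite _ _
  have htop : Algebra.adjoin (ZMod 2) {α} = ⊤ := by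
    rw [eq_top_iff]
    intro x _
    by_cases hx : x = 0
    · rw [hx]; exact zero_mem _
    · obtain ⟨k, hk⟩ := (Subgroup.mem_zpowers_iff.1 (hg (Units.mk0 x hx)))
      obtain ⟨j, hj⟩ := (mem_powers_iff_mem_zpowers (x := g)).2 ⟨k, hk⟩
      have : x = α ^ j := by
        have := congrArg Units.val hj
        simpa using this.symm
      rw [this]
      exact pow_mem (Algebra.self_mem_adjoin_singleton _ _) j
  set pb := PowerBasis.ofAdjoinEqTop' hint htop with hpb
  have hgen : pb.gen = α := PowerBasis.ofAdjoinEqTop'_gen _ _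
  have hdim : pb.dim = r := by
    rw [← pb.finrank]
    have := Module.card_eq_pow_finrank (K := ZMod 2) (V := F)
    rw [hcard, ZMod.card] at this
    exact (Nat.pow_right_injective le_rfl this).symm
  have hdeg : (minpoly (ZMod 2) α).natDegree = r := by
    exact (PowerBasis.ofAdjoinEqTop'_dim hint htop).symm.trans hdim
  obtain ⟨c, hc, hbit⟩ := exists_topBit r fun i => (minpoly (ZMod 2) α).coeff i ≠ 0
  have h01 : ∀ x : ZMod 2, x ≠ 0 → x = 1 := by decide
  have hpow : α ^ r = ∑ i ∈ Finset.range r, if topBit r c i then α ^ i else 0 := by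
    have h := minpoly.aeval (ZMod 2) α
    rw [(minpoly.monic hint).as_sum, hdeg] at h
    simp only [map_add, map_pow, Polynomial.aeval_X, map_sum, map_mul, Polynomial.aeval_C] at h
    rw [CharTwo.add_eq_zero.1 h]
    refine Finset.sum_congr rfl fun i hi => ?_
    have := hbit i (Finset.mem_range.1 hi)
    split_ifs with h2
    · rw [h01 _ (this.1 h2), map_one, one_mul]
    · rw [not_not.1 (mt this.2 h2), map_zero, zero_mul]
  refine ⟨c, ?_, hc, ?_⟩
  · have h0 := (hbit 0 (by omega)).2 (minpoly.coeff_zero_ne_zero hint g.ne_zero)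
    rw [topBit, pow_zero, one_mul, Nat.mod_eq_of_lt hc] at h0
    obtain ⟨k, rfl⟩ : ∃ k, r = k + 1 := ⟨r - 1, by omega⟩
    rw [pow_succ'] at h0
    simpa using h0
  · intro N S hN hS t ht ht'
    by_contra! hall
    have h1 : firstCoord pb 1 = 1 := by
      have := firstCoord_pow pb (i := 0) (by omega)
      rwa [pow_zero, if_pos rfl] at this
    have hchr : ∀ t < N + r, S t = firstCoordChar pb (α ^ t) := by
      refine hS.eq_char hpow (by rw [firstCoordChar_apply, h1, signChar_one])
        fun i hi hir => ?_
      rw [firstCoordChar_apply, ← hgen, firstCoord_pow pb (by omega), if_neg (by omega),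
        AddChar.map_zero_eq_one]
    -- The functional vanishes on the ideal generated by `α ^ t - 1`.
    have hzero : (firstCoord pb).comp (LinearMap.mulLeft (ZMod 2) (α ^ t - 1)) = 0 := by
      refine pb.basis.ext fun i => ?_
      have hi : (i : ℕ) < r := i.2.trans_eq hdim
      have h := hall i hi
      rw [hchr _ (by omega), hchr _ (by omega)] at h
      simp only [pb.basis_eq_pow, hgen, LinearMap.comp_apply, LinearMap.mulLeft_apply,
        LinearMap.zero_apply]
      apply eq_zero_of_signChar
      rw [← firstCoordChar_apply, CharTwo.sub_eq_add, add_mul, one_mul, ← pow_add,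
        AddChar.map_add_eq_mul, h, addChar_mul_self]
    have hne : α ^ t - 1 ≠ 0 := by
      intro h
      have h2 : g ^ t = 1 := Units.ext (by
        rw [Units.val_pow_eq_pow_val, Units.val_one]; exact sub_eq_zero.1 h)
      have h3 := orderOf_dvd_of_pow_eq_one h2
      rw [orderOf_eq_card_of_forall_mem_zpowers hg, Nat.card_eq_fintype_card, Fintype.card_units,
        hcard] at h3
      exact absurd (Nat.le_of_dvd ht h3) (by omega)
    have h2 := LinearMap.congr_fun hzero (α ^ t - 1)⁻¹
    simp only [LinearMap.comp_apply, LinearMap.mulLeft_apply, LinearMap.zero_apply] at h2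
    rw [mul_inv_cancel₀ hne, h1] at h2
    exact one_ne_zero h2

/-! ### Moments of the three measures -/

/-- The value of the monomial with exponents `d`. -/
def monomialValue {n : ℕ} (d : Fin n → ℕ) (x : EuclideanSpace ℝ (Fin n)) : ℝ := ∏ i, x i ^ d i

/-- The `k`-th moment of the standard Gaussian distribution on `ℝ`. -/
def gaussMoment (k : ℕ) : ℝ := ∫ x, x ^ k ∂(ProbabilityTheory.gaussianReal 0 1)

/-- The moments of `μ` are proportional to those of the standard Gaussian measure in each degree,
as for every rotation invariant measure; the factors in degrees `0`, `2`, `4` are `1`, `c₂`,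
`c₄`. -/
def HasMoments {n : ℕ} (μ : Measure (EuclideanSpace ℝ (Fin n))) (c₂ c₄ : ℝ) : Prop :=
  ∃ κ : ℕ → ℝ, κ 0 = 1 ∧ κ 2 = c₂ ∧ κ 4 = c₄ ∧ ∀ d : Fin n → ℕ,
    Integrable (monomialValue d) μ ∧
      ∫ x, monomialValue d x ∂μ = κ (∑ i, d i) * ∏ i, gaussMoment (d i)

/-- The integral of `y ^ k * exp (-y² / 2)` over the positive half-line. -/
def radialIntegral (k : ℕ) : ℝ := ∫ y in Set.Ioi (0 : ℝ), y ^ k * Real.exp (-(y ^ 2 / 2))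

lemma radialIntegral_eq (k : ℕ) : radialIntegral k =
    (1 / 2 : ℝ) ^ (-((k : ℝ) + 1) / 2) * (1 / 2) * Real.Gamma (((k : ℝ) + 1) / 2) := by
  have := integral_rpow_mul_exp_neg_mul_rpow (p := 2) (q := k) (b := 1 / 2) (by norm_num)
    (by have : (0 : ℝ) ≤ k := k.cast_nonneg
        linarith) (by norm_num)
  rw [← this, radialIntegral]
  refine setIntegral_congr_fun measurableSet_Ioi fun y hy => ?_
  simp only [Real.rpow_natCast, Real.rpow_two]
  ring_nf

lemma radialIntegral_pos (k : ℕ) : 0 < radialIntegral k := by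
  rw [radialIntegral_eq]
  have : 0 < Real.Gamma (((k : ℝ) + 1) / 2) := Real.Gamma_pos_of_pos (by positivity)
  positivity

lemma radialIntegral_add_two (k : ℕ) : radialIntegral (k + 2) = (k + 1) * radialIntegral k := by
  rw [radialIntegral_eq, radialIntegral_eq]
  have h1 : (((k + 2 : ℕ) : ℝ) + 1) / 2 = ((k : ℝ) + 1) / 2 + 1 := by push_cast; ring
  have h2 : -(((k + 2 : ℕ) : ℝ) + 1) / 2 = -((k : ℝ) + 1) / 2 - 1 := by push_cast; ring
  rw [h1, h2, Real.Gamma_add_one (by positivity), Real.rpow_sub_one (by norm_num)]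
  ring

lemma gaussMoment_eq (k : ℕ) : gaussMoment k =
    (√(2 * Real.pi))⁻¹ * ∫ x : ℝ, x ^ k * Real.exp (-(x ^ 2 / 2)) := by
  rw [gaussMoment, ProbabilityTheory.integral_gaussianReal_eq_integral_smul one_ne_zero,
    ← integral_const_mul]
  refine integral_congr_ae (ae_of_all _ fun x => ?_)
  simp only [ProbabilityTheory.gaussianPDFReal, smul_eq_mul]
  rw [show -(x - 0) ^ 2 / (2 * ((1 : NNReal) : ℝ)) = -(x ^ 2 / 2) by push_cast; ring]
  push_cast
  ring_nf

lemma integral_pow_mul_exp (k : ℕ) : ∫ x : ℝ, x ^ k * Real.exp (-(x ^ 2 / 2)) =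
    √(2 * Real.pi) * gaussMoment k := by
  rw [gaussMoment_eq, ← mul_assoc, mul_inv_cancel₀ (by positivity), one_mul]

lemma gaussMoment_even (k : ℕ) (hk : Even k) :
    gaussMoment k = (√(2 * Real.pi))⁻¹ * (2 * radialIntegral k) := by
  rw [gaussMoment_eq, radialIntegral,
    ← integral_comp_abs (f := fun y => y ^ k * Real.exp (-(y ^ 2 / 2)))]
  simp only [hk.pow_abs, sq_abs]

lemma gaussMoment_zero : gaussMoment 0 = 1 := by
  simp [gaussMoment]

lemma gaussMoment_odd (k : ℕ) (hk : Odd k) : gaussMoment k = 0 := by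
  have h := integral_neg_eq_self (fun x : ℝ => x ^ k * Real.exp (-(x ^ 2 / 2))) volume
  simp only [hk.neg_pow, even_two.neg_pow, neg_mul, integral_neg] at h
  rw [gaussMoment_eq]
  have : ∫ x : ℝ, x ^ k * Real.exp (-(x ^ 2 / 2)) = 0 := by linarith
  rw [this, mul_zero]

lemma gaussMoment_add_two (k : ℕ) (hk : Even k) :
    gaussMoment (k + 2) = (k + 1) * gaussMoment k := by
  rw [gaussMoment_even _ hk, gaussMoment_even _ (hk.add even_two), radialIntegral_add_two]; ring

lemma gaussMoment_two : gaussMoment 2 = 1 := by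
  rw [gaussMoment_add_two 0 (by decide), gaussMoment_zero]; norm_num

lemma gaussMoment_four : gaussMoment 4 = 3 := by
  rw [gaussMoment_add_two 2 (by decide), gaussMoment_two]; norm_num

lemma continuous_monomialValue {n : ℕ} (d : Fin n → ℕ) : Continuous (monomialValue d) := by
  unfold monomialValue; fun_prop

lemma monomialValue_smul {n : ℕ} (d : Fin n → ℕ) (r : ℝ) (x : EuclideanSpace ℝ (Fin n)) :
    monomialValue d (r • x) = r ^ (∑ i, d i) * monomialValue d x := by
  simp [monomialValue, mul_pow, Finset.prod_mul_distrib, Finset.prod_pow_eq_pow_sum]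

lemma monomialValue_zero {n : ℕ} (x : EuclideanSpace ℝ (Fin n)) :
    monomialValue (fun _ => 0) x = 1 := by
  simp [monomialValue]

theorem gaussianMeasure_hasMoments (n : ℕ) : HasMoments (gaussianMeasure n) 1 1 := by
  refine ⟨fun _ => 1, rfl, rfl, rfl, fun d => ?_⟩
  have hmap : gaussianMeasure n =
      (Measure.pi fun _ : Fin n => ProbabilityTheory.gaussianReal 0 1).map (WithLp.toLp 2) :=
    ProbabilityTheory.map_pi_eq_stdGaussian.symm
  have hm : AEMeasurable (WithLp.toLp 2 : (Fin n → ℝ) → EuclideanSpace ℝ (Fin n))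
      (Measure.pi fun _ : Fin n => ProbabilityTheory.gaussianReal 0 1) := by
    fun_prop
  have hs := (continuous_monomialValue d).aestronglyMeasurable (μ := gaussianMeasure n)
  rw [hmap] at hs ⊢
  constructor
  · rw [integrable_map_measure hs hm]
    have : Integrable (fun x : Fin n → ℝ => ∏ i, (fun t : ℝ => t ^ d i) (x i))
        (Measure.pi fun _ : Fin n => ProbabilityTheory.gaussianReal 0 1) := by
      refine Integrable.fintype_prod (f := fun i (t : ℝ) => t ^ d i) fun i => ?_
      have h := ProbabilityTheory.memLp_id_gaussianReal (μ := 0) (v := 1) (d i)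
      rcases Nat.eq_zero_or_pos (d i) with h0 | h0
      · simp [h0]
      · refine (integrable_norm_iff (by fun_prop)).1 ?_
        simpa [norm_pow] using h.integrable_norm_pow (p := d i) (by omega)
    exact this
  · rw [integral_map hm hs, one_mul]
    exact integral_fintype_prod_eq_prod (fun i (t : ℝ) => t ^ d i)

/-- Integration in polar coordinates of a homogeneous function times a radial one. -/
lemma integral_homogeneous_mul_radial {n : ℕ} {D : ℕ} {f : EuclideanSpace ℝ (Fin n) → ℝ}
    (hn : 0 < n) (hf : ∀ (r : ℝ) x, f (r • x) = r ^ D * f x) (w : ℝ → ℝ) :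
    ∫ x, f x * w ‖x‖ = (∫ s, f s.1 ∂(volume : Measure (EuclideanSpace ℝ (Fin n))).toSphere) *
      ∫ y in Set.Ioi (0 : ℝ), y ^ (n - 1 + D) * w y := by
  have hnt : Nontrivial (EuclideanSpace ℝ (Fin n)) := by
    have : Nonempty (Fin n) := ⟨⟨0, hn⟩⟩
    infer_instance
  set μ := (volume : Measure (EuclideanSpace ℝ (Fin n)))
  have hdim : Module.finrank ℝ (EuclideanSpace ℝ (Fin n)) = n := by simp
  calc
    ∫ x, f x * w ‖x‖ ∂μ
      = ∫ x : ({(0)}ᶜ : Set (EuclideanSpace ℝ (Fin n))), f x.1 * w ‖x.1‖ ∂(μ.comap (↑)) := by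
      rw [integral_subtype_comap (measurableSet_singleton _).compl fun x ↦ f x * w ‖x‖,
        restrict_compl_singleton]
    _ = ∫ x, f x.1.1 * (x.2.1 ^ D * w x.2.1) ∂μ.toSphere.prod (.volumeIoiPow (n - 1)) := by
      have h := μ.measurePreserving_homeomorphUnitSphereProd
      rw [hdim] at h
      rw [← h.integral_comp (Homeomorph.measurableEmbedding _)]
      refine integral_congr_ae (ae_of_all _ fun x => ?_)
      have hx : ‖x.1‖ ≠ 0 := norm_ne_zero_iff.2 x.2
      simp only [homeomorphUnitSphereProd_apply_snd_coe, homeomorphUnitSphereProd_apply_fst_coe,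
        hf, inv_pow]
      have hD := pow_ne_zero D hx
      generalize ‖x.1‖ ^ D = z at hD
      field_simp
    _ = (∫ s, f s.1 ∂μ.toSphere) *
        ∫ y : Set.Ioi (0 : ℝ), y.1 ^ D * w y.1 ∂(Measure.volumeIoiPow (n - 1)) :=
      integral_prod_mul (fun s : Metric.sphere (0 : EuclideanSpace ℝ (Fin n)) 1 => f s.1)
        (fun y : Set.Ioi (0 : ℝ) => y.1 ^ D * w y.1)
    _ = _ := by
      congr 1
      simp only [Measure.volumeIoiPow, ENNReal.ofReal]
      rw [integral_withDensity_eq_integral_smul,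
        integral_subtype_comap measurableSet_Ioi
          fun a ↦ Real.toNNReal (a ^ (n - 1)) • (a ^ D * w a),
        setIntegral_congr_fun measurableSet_Ioi fun x hx ↦ ?_]
      · rw [NNReal.smul_def, Real.coe_toNNReal _ (pow_nonneg (le_of_lt hx) _), smul_eq_mul, pow_add,
          mul_assoc]
      · exact (measurable_subtype_coe.pow_const _).real_toNNReal

/-- The integral of a monomial over the unit sphere, for the surface measure. -/
def sphereIntegral {n : ℕ} (d : Fin n → ℕ) : ℝ :=
  ∫ s, monomialValue d s.1 ∂(volume : Measure (EuclideanSpace ℝ (Fin n))).toSphere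

lemma sphereIntegral_mul {n : ℕ} (hn : 0 < n) (d : Fin n → ℕ) :
    sphereIntegral d * radialIntegral (n - 1 + ∑ i, d i) =
      √(2 * Real.pi) ^ n * ∏ i, gaussMoment (d i) := by
  have h := integral_homogeneous_mul_radial hn (fun r x => monomialValue_smul d r x)
    (fun y => Real.exp (-(y ^ 2 / 2)))
  rw [sphereIntegral, radialIntegral, ← h,
    ← (PiLp.volume_preserving_toLp (Fin n)).integral_comp
      (MeasurableEquiv.toLp 2 (Fin n → ℝ)).measurableEmbedding]
  have h2 := integral_fintype_prod_volume_eq_prod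
    (fun (i : Fin n) (t : ℝ) => t ^ d i * Real.exp (-(t ^ 2 / 2)))
  simp only [integral_pow_mul_exp, Finset.prod_mul_distrib, Finset.prod_const, Finset.card_univ,
    Fintype.card_fin] at h2
  rw [← h2]
  refine integral_congr_ae (ae_of_all _ fun x => ?_)
  simp only [EuclideanSpace.norm_sq_eq, monomialValue, Real.norm_eq_abs, sq_abs]
  rw [← Real.exp_sum]
  congr 2
  rw [Finset.sum_div, Finset.sum_neg_distrib]

lemma sphereIntegral_zero (n : ℕ) : sphereIntegral (fun _ : Fin n => 0) =
    ((volume : Measure (EuclideanSpace ℝ (Fin n))).toSphere Set.univ).toReal := by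
  simp [sphereIntegral, monomialValue_zero, Measure.real]

lemma sphereIntegral_zero_pos {n : ℕ} (hn : 0 < n) : 0 < sphereIntegral (fun _ : Fin n => 0) := by
  have h := sphereIntegral_mul hn (fun _ => 0)
  simp only [gaussMoment_zero, Finset.prod_const_one, mul_one, Finset.sum_const_zero, add_zero] at h
  have h2 := radialIntegral_pos (n - 1)
  have h3 : 0 < √(2 * Real.pi) ^ n := by positivity
  rw [← h] at h3
  exact pos_of_mul_pos_left h3 h2.le

lemma sphereIntegral_div {n : ℕ} (hn : 0 < n) (d : Fin n → ℕ) :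
    (sphereIntegral fun _ : Fin n => 0)⁻¹ * sphereIntegral d =
      radialIntegral (n - 1) / radialIntegral (n - 1 + ∑ i, d i) * ∏ i, gaussMoment (d i) := by
  have h := sphereIntegral_mul hn (fun _ : Fin n => 0)
  have h1 := sphereIntegral_mul hn d
  have h0 := sphereIntegral_zero_pos hn
  have h2 := radialIntegral_pos (n - 1)
  have h3 := radialIntegral_pos (n - 1 + ∑ i, d i)
  simp only [gaussMoment_zero, Finset.prod_const_one, mul_one, Finset.sum_const_zero, add_zero] at h
  rw [← h] at h1
  field_simp
  linear_combination h1

lemma radialIntegral_ratio_two {n : ℕ} (hn : 0 < n) :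
    radialIntegral (n - 1) / radialIntegral (n - 1 + 2) = 1 / n := by
  have h := radialIntegral_pos (n - 1)
  rw [radialIntegral_add_two, Nat.cast_pred hn, sub_add_cancel]
  have : (0 : ℝ) < n := by exact_mod_cast hn
  field_simp

lemma radialIntegral_ratio_four {n : ℕ} (hn : 0 < n) :
    radialIntegral (n - 1) / radialIntegral (n - 1 + 4) = 1 / (n * (n + 2)) := by
  have h := radialIntegral_pos (n - 1)
  rw [show n - 1 + 4 = n - 1 + 2 + 2 by rfl, radialIntegral_add_two, radialIntegral_add_two]
  push_cast [Nat.cast_pred hn]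
  have : (0 : ℝ) < n := by exact_mod_cast hn
  have h3 : (n : ℝ) - 1 + 2 + 1 = n + 2 := by ring
  rw [h3, sub_add_cancel]
  field_simp

lemma integrable_monomialValue_sphere {n : ℕ} (d : Fin n → ℕ) :
    Integrable (fun s : Metric.sphere (0 : EuclideanSpace ℝ (Fin n)) 1 => monomialValue d s.1)
      (volume : Measure (EuclideanSpace ℝ (Fin n))).toSphere :=
  ((continuous_monomialValue d).comp continuous_subtype_val).integrable_of_hasCompactSupport
    (HasCompactSupport.of_compactSpace _)

theorem sphereMeasure_hasMoments {n : ℕ} (hn : 0 < n) :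
    HasMoments (sphereMeasure n) (1 / n) (1 / (n * (n + 2))) := by
  refine ⟨fun D => radialIntegral (n - 1) / radialIntegral (n - 1 + D),
    div_self (radialIntegral_pos _).ne', radialIntegral_ratio_two hn, radialIntegral_ratio_four hn,
    fun d => ?_⟩
  have hemb : MeasurableEmbedding (Subtype.val :
      Metric.sphere (0 : EuclideanSpace ℝ (Fin n)) 1 → EuclideanSpace ℝ (Fin n)) :=
    MeasurableEmbedding.subtype_coe Metric.isClosed_sphere.measurableSet
  have h0 := sphereIntegral_zero_pos hn
  rw [sphereIntegral_zero] at h0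
  constructor
  · refine Integrable.smul_measure ?_ (ENNReal.inv_ne_top.2 fun h => ?_)
    · rw [hemb.integrable_map_iff]
      exact integrable_monomialValue_sphere d
    · rw [h] at h0; simp at h0
  · rw [sphereMeasure, integral_smul_measure, hemb.integral_map, ENNReal.toReal_inv,
      ← sphereIntegral_zero, ← sphereIntegral_div hn]
    rfl

lemma integral_closedBall_monomialValue {n : ℕ} (hn : 0 < n) (d : Fin n → ℕ) :
    ∫ x in Metric.closedBall (0 : EuclideanSpace ℝ (Fin n)) 1, monomialValue d x =
      sphereIntegral d / (n + ∑ i, d i : ℕ) := by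
  have h := integral_homogeneous_mul_radial hn (fun r x => monomialValue_smul d r x)
    (Set.indicator (Set.Iic 1) fun _ => 1)
  have h1 : ∫ x in Metric.closedBall (0 : EuclideanSpace ℝ (Fin n)) 1, monomialValue d x =
      ∫ x, monomialValue d x * (Set.indicator (Set.Iic 1) fun _ => 1) ‖x‖ := by
    rw [← integral_indicator Metric.isClosed_closedBall.measurableSet]
    refine integral_congr_ae (ae_of_all _ fun x => ?_)
    by_cases hx : ‖x‖ ≤ 1
    · simp [Set.indicator, hx]
    · simp [Set.indicator, hx]
  have h2 : ∫ y in Set.Ioi (0 : ℝ), y ^ (n - 1 + ∑ i, d i) * (Set.indicator (Set.Iic 1)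
      fun _ => 1) y = 1 / (n + ∑ i, d i : ℕ) := by
    have h3 : ∀ y : ℝ, y ^ (n - 1 + ∑ i, d i) * (Set.indicator (Set.Iic 1) fun _ => 1) y =
        (Set.Iic 1).indicator (fun y => y ^ (n - 1 + ∑ i, d i)) y := by
      intro y
      by_cases hy : y ≤ 1 <;> simp [Set.indicator, hy]
    simp only [h3]
    rw [setIntegral_indicator measurableSet_Iic, Set.Ioi_inter_Iic,
      ← intervalIntegral.integral_of_le zero_le_one, integral_pow]
    have h4 : n - 1 + ∑ i, d i + 1 = n + ∑ i, d i := by omega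
    rw [one_pow, zero_pow (by omega), ← Nat.cast_succ, Nat.succ_eq_add_one, h4, sub_zero]
  rw [h1, h, h2, mul_one_div]
  rfl

theorem ballMeasure_hasMoments {n : ℕ} (hn : 0 < n) :
    HasMoments (ballMeasure n) (1 / (n + 2)) (1 / ((n + 2) * (n + 4))) := by
  have hn' : (0 : ℝ) < n := by exact_mod_cast hn
  refine ⟨fun D => radialIntegral (n - 1) / radialIntegral (n - 1 + D) * (n / (n + D : ℕ)),
    ?_, ?_, ?_, fun d => ?_⟩
  · dsimp only
    rw [add_zero, add_zero, div_self (radialIntegral_pos _).ne', div_self hn'.ne', one_mul]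
  · dsimp only
    rw [radialIntegral_ratio_two hn]; push_cast; field_simp
  · dsimp only
    rw [radialIntegral_ratio_four hn]; push_cast; field_simp
  have h0 := sphereIntegral_zero_pos hn
  have hvol : (volume (Metric.closedBall (0 : EuclideanSpace ℝ (Fin n)) 1)).toReal =
      (sphereIntegral fun _ : Fin n => 0) / n := by
    have := integral_closedBall_monomialValue hn (fun _ => 0)
    simpa [monomialValue_zero, Measure.real] using this
  constructor
  · rw [ballMeasure, ProbabilityTheory.cond]
    refine Integrable.smul_measure ?_ (ENNReal.inv_ne_top.2 fun h => ?_)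
    · exact (continuous_monomialValue d).continuousOn.integrableOn_compact
        (isCompact_closedBall _ _)
    · rw [h] at hvol
      have : 0 < (sphereIntegral fun _ : Fin n => 0) / (n : ℝ) := by positivity
      rw [← hvol] at this; simp at this
  · rw [ballMeasure, ProbabilityTheory.cond, integral_smul_measure,
      integral_closedBall_monomialValue hn, ENNReal.toReal_inv, hvol]
    have h2 := sphereIntegral_div hn d
    have h3 : ((n + ∑ i, d i : ℕ) : ℝ) ≠ 0 := by positivity
    rw [mul_right_comm, ← h2]
    simp only [smul_eq_mul]
    field_simp

/-! ### The cubature formula of an array of signs -/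

section DesignFormula

variable {n : ℕ}

/-- The point with coordinates `ρ * s p`. -/
def codePoint (ρ : ℝ) (s : Fin n → ℝ) : EuclideanSpace ℝ (Fin n) :=
  WithLp.toLp 2 fun p => ρ * s p

/-- The point at position `b` on the `j`-th coordinate axis. -/
def axisPoint (b : ℝ) (j : Fin n) : EuclideanSpace ℝ (Fin n) :=
  WithLp.toLp 2 fun p => if p = j then b else 0

open Classical in
/-- The points `ρ * σ i`, `i : ι`, with weight `w`, and the points `± β` on the coordinate axes
with weight `w'`. The latter are recognized by their vanishing coordinates. -/
def designFormula {ι : Type*} [Fintype ι] (σ : ι → Fin n → ℝ) (ρ w β w' : ℝ) : Formula n where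
  points := Finset.univ.image (fun i => codePoint ρ (σ i)) ∪
    (Finset.univ.image (axisPoint β) ∪ Finset.univ.image (axisPoint (-β)))
  weight p := if ∃ j, p j = 0 then w' else w

variable {ι : Type*} [Fintype ι] {σ : ι → Fin n → ℝ} {ρ w β w' c₂ c₄ : ℝ}

lemma codePoint_apply (s : Fin n → ℝ) (p : Fin n) : codePoint ρ s p = ρ * s p := rfl

lemma axisPoint_apply (b : ℝ) (j p : Fin n) : axisPoint b j p = if p = j then b else 0 := rfl

lemma axisPoint_injective {b : ℝ} (hb : b ≠ 0) : Function.Injective (axisPoint (n := n) b) := by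
  intro j j' h
  have := congrArg (fun x : EuclideanSpace ℝ (Fin n) => x j) h
  simp only [axisPoint_apply, if_true] at this
  by_contra hne
  rw [if_neg hne] at this
  exact hb this

lemma codePoint_injective (hσ : IsSignDesign σ) (hρ : ρ ≠ 0) :
    Function.Injective fun i => codePoint ρ (σ i) := by
  intro i i' h
  apply hσ.inj
  funext p
  have := congrArg (fun x : EuclideanSpace ℝ (Fin n) => x p) h
  exact mul_left_cancel₀ hρ this

lemma codePoint_ne_zero (hσ : IsSignDesign σ) (hρ : ρ ≠ 0) (i : ι) (p : Fin n) :
    codePoint ρ (σ i) p ≠ 0 := by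
  rw [codePoint_apply]
  rcases hσ.sign i p with h | h <;> rw [h] <;> simpa using hρ

lemma axisPoint_eq_zero (hn : 2 ≤ n) (b : ℝ) (j : Fin n) : ∃ p, axisPoint b j p = 0 := by
  have : Nontrivial (Fin n) := Fin.nontrivial_iff_two_le.2 hn
  obtain ⟨p, hp⟩ := exists_ne j
  exact ⟨p, by rw [axisPoint_apply, if_neg hp]⟩

lemma weight_codePoint (hσ : IsSignDesign σ) (hρ : ρ ≠ 0) (i : ι) :
    (designFormula σ ρ w β w').weight (codePoint ρ (σ i)) = w :=
  if_neg fun ⟨p, hp⟩ => codePoint_ne_zero hσ hρ i p hp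

lemma weight_axisPoint (hn : 2 ≤ n) (b : ℝ) (j : Fin n) :
    (designFormula σ ρ w β w').weight (axisPoint b j) = w' :=
  if_pos (axisPoint_eq_zero hn b j)

lemma codePoint_ne_axisPoint (hσ : IsSignDesign σ) (hρ : ρ ≠ 0) (hn : 2 ≤ n) (i : ι) (b : ℝ)
    (j : Fin n) : codePoint ρ (σ i) ≠ axisPoint b j := by
  intro h
  obtain ⟨p, hp⟩ := axisPoint_eq_zero hn b j
  exact codePoint_ne_zero hσ hρ i p (by rw [h, hp])

lemma axisPoint_ne_axisPoint_neg (hβ : 0 < β) (j j' : Fin n) :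
    axisPoint β j ≠ axisPoint (-β) j' := by
  intro h
  have := congrArg (fun x : EuclideanSpace ℝ (Fin n) => x j) h
  simp only [axisPoint_apply, if_true] at this
  split_ifs at this <;> linarith

lemma sum_designFormula (hσ : IsSignDesign σ) (hρ : ρ ≠ 0) (hβ : 0 < β) (hn : 2 ≤ n)
    (f : EuclideanSpace ℝ (Fin n) → ℝ) :
    ∑ p ∈ (designFormula σ ρ w β w').points, (designFormula σ ρ w β w').weight p * f p =
      w * ∑ i, f (codePoint ρ (σ i)) + w' * ∑ j, (f (axisPoint β j) + f (axisPoint (-β) j)) := by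
  classical
  have hd1 : Disjoint (Finset.univ.image (axisPoint (n := n) β))
      (Finset.univ.image (axisPoint (n := n) (-β))) := by
    simp only [Finset.disjoint_left, Finset.mem_image, Finset.mem_univ, true_and, not_exists]
    rintro _ ⟨j, rfl⟩ j' h
    exact axisPoint_ne_axisPoint_neg hβ j j' h.symm
  have hd2 : Disjoint (Finset.univ.image fun i => codePoint ρ (σ i))
      (Finset.univ.image (axisPoint (n := n) β) ∪
      (Finset.univ.image (axisPoint (n := n) (-β)))) := by
    simp only [Finset.disjoint_left, Finset.mem_union, Finset.mem_image, Finset.mem_univ, true_and]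
    rintro _ ⟨i, rfl⟩ (⟨j, h⟩ | ⟨j, h⟩) <;> exact codePoint_ne_axisPoint hσ hρ hn i _ j h.symm
  simp only [designFormula] at *
  rw [Finset.sum_union (by convert hd2), Finset.sum_union (by convert hd1),
    Finset.sum_image fun i _ i' _ h => codePoint_injective hσ hρ h,
    Finset.sum_image fun i _ i' _ h => axisPoint_injective hβ.ne' h,
    Finset.sum_image fun i _ i' _ h => axisPoint_injective (neg_ne_zero.2 hβ.ne') h,
    Finset.sum_add_distrib, mul_add, Finset.mul_sum, Finset.mul_sum, Finset.mul_sum]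
  congr 1
  · refine Finset.sum_congr rfl fun i _ => ?_
    rw [if_neg fun ⟨p, hp⟩ => codePoint_ne_zero hσ hρ i p hp]
  congr 1 <;> refine Finset.sum_congr rfl fun j _ => ?_ <;>
    rw [if_pos (axisPoint_eq_zero hn _ j)]

lemma card_designFormula (hσ : IsSignDesign σ) (hρ : ρ ≠ 0) (hβ : 0 < β) (hn : 2 ≤ n) :
    (designFormula σ ρ w β w').points.card = Fintype.card ι + 2 * n := by
  have h := sum_designFormula (w := 1) (w' := 1) hσ hρ hβ hn (fun _ => 1)
  have h1 : ∀ p, (designFormula σ ρ 1 β 1).weight p = 1 := fun p => by simp [designFormula]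
  have h2 : ((designFormula σ ρ w β w').points.card : ℝ) = (Fintype.card ι + 2 * n : ℕ) := by
    simp only [h1] at h
    simp only [one_mul, Finset.sum_const, nsmul_eq_mul, mul_one, Finset.card_univ,
      Fintype.card_fin] at h
    push_cast
    rw [show (designFormula σ ρ w β w').points = (designFormula σ ρ 1 β 1).points from rfl, h]
    ring
  exact_mod_cast h2

lemma monomialValue_codePoint (d : Fin n → ℕ) (s : Fin n → ℝ) :
    monomialValue d (codePoint ρ s) = ρ ^ (∑ p, d p) * ∏ p, s p ^ d p := by
  simp [monomialValue, codePoint_apply, mul_pow, Finset.prod_mul_distrib,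
    Finset.prod_pow_eq_pow_sum]

/-- The moments of the array: strength five kills every monomial with an odd exponent. -/
lemma sum_prod_sign_pow (hσ : IsSignDesign σ) (d : Fin n → ℕ) (hd : ∑ p, d p ≤ 5) :
    ∑ i, ∏ p, σ i p ^ d p = if ∀ p, Even (d p) then (Fintype.card ι : ℝ) else 0 := by
  have hpow : ∀ i, ∏ p, σ i p ^ d p = ∏ p ∈ Finset.univ.filter (fun p => Odd (d p)), σ i p := by
    intro i
    rw [Finset.prod_filter]
    refine Finset.prod_congr rfl fun p _ => ?_
    rcases Nat.even_or_odd (d p) with h | h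
    · rw [if_neg (Nat.not_odd_iff_even.2 h)]
      rcases hσ.sign i p with h1 | h1 <;> rw [h1] <;> simp [h.neg_one_pow]
    · rw [if_pos h]
      rcases hσ.sign i p with h1 | h1 <;> rw [h1] <;> simp [h.neg_one_pow]
  simp only [hpow]
  split_ifs with h
  · rw [Finset.filter_false_of_mem fun p _ => Nat.not_odd_iff_even.2 (h p)]
    simp
  · push Not at h
    obtain ⟨p, hp⟩ := h
    refine hσ.balanced _ ⟨p, by simpa using hp⟩ (le_trans ?_ hd)
    rw [Finset.card_eq_sum_ones]
    refine (Finset.sum_le_sum (g := d) fun p hp => ?_).trans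
      (Finset.sum_le_sum_of_subset (Finset.filter_subset _ _))
    exact (Finset.mem_filter.1 hp).2.pos

lemma monomialValue_axisPoint (d : Fin n → ℕ) (b : ℝ) (j : Fin n) :
    monomialValue d (axisPoint b j) = if ∀ p, p ≠ j → d p = 0 then b ^ d j else 0 := by
  split_ifs with h
  · rw [monomialValue, Finset.prod_eq_single j]
    · simp [axisPoint_apply]
    · intro p _ hp
      rw [h p hp, pow_zero]
    · simp
  · push Not at h
    obtain ⟨p, hp, hdp⟩ := h
    refine Finset.prod_eq_zero (Finset.mem_univ p) ?_
    rw [axisPoint_apply, if_neg hp, zero_pow hdp]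

/-- Even exponents of total degree at most five. -/
lemma even_exponents_cases (d : Fin n → ℕ) (hd : ∑ p, d p ≤ 5) (he : ∀ p, Even (d p)) :
    d = 0 ∨ (∃ j, d = Pi.single j 2) ∨ (∃ j, d = Pi.single j 4) ∨
      ∃ j j', j ≠ j' ∧ d = Pi.single j 2 + Pi.single j' 2 := by
  by_cases h0 : d = 0
  · exact Or.inl h0
  right
  obtain ⟨j, hj⟩ := Function.ne_iff.1 h0
  have hsum : d j + ∑ p ∈ Finset.univ.erase j, d p = ∑ p, d p :=
    Finset.add_sum_erase _ _ (Finset.mem_univ j)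
  have hle : ∀ p, p ≠ j → d p ≤ ∑ p ∈ Finset.univ.erase j, d p := fun p hp =>
    Finset.single_le_sum (f := d) (fun _ _ => Nat.zero_le _) (by simpa using hp)
  obtain ⟨k, hk⟩ := he j
  have hj' : d j ≠ 0 := hj
  by_cases h1 : ∀ p, p ≠ j → d p = 0
  · have hd1 : d = Pi.single j (d j) := by
      funext p
      by_cases hp : p = j
      · rw [hp, Pi.single_eq_same]
      · rw [Pi.single_eq_of_ne hp, h1 p hp]
    have : d j = 2 ∨ d j = 4 := by omega
    rcases this with h | h
    · exact Or.inl ⟨j, h ▸ hd1⟩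
    · exact Or.inr (Or.inl ⟨j, h ▸ hd1⟩)
  · right; right
    push Not at h1
    obtain ⟨j', hne, hj'0⟩ := h1
    refine ⟨j, j', hne.symm, ?_⟩
    have hsum' : d j' + ∑ p ∈ (Finset.univ.erase j).erase j', d p =
        ∑ p ∈ Finset.univ.erase j, d p :=
      Finset.add_sum_erase _ _ (by simpa using hne)
    obtain ⟨k', hk'⟩ := he j'
    have h2 : d j = 2 := by omega
    have h2' : d j' = 2 := by omega
    funext p
    by_cases hp : p = j
    · subst hp; simp [hne.symm, h2]
    by_cases hp' : p = j'
    · subst hp'; simp [hne, h2']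
    have hle' : d p ≤ ∑ p ∈ (Finset.univ.erase j).erase j', d p :=
      Finset.single_le_sum (f := d) (fun _ _ => Nat.zero_le _) (by simp [hp, hp'])
    obtain ⟨k'', hk''⟩ := he p
    simp only [Pi.add_apply, Pi.single_eq_of_ne hp, Pi.single_eq_of_ne hp']
    omega

lemma sum_monomialValue_designFormula (hσ : IsSignDesign σ) (hn : 2 ≤ n)
    (h0 : w * Fintype.card ι + 2 * n * w' = 1)
    (h2 : w * Fintype.card ι * ρ ^ 2 + 2 * w' * β ^ 2 = c₂)
    (h4 : w * Fintype.card ι * ρ ^ 4 = c₄) (h4' : w' * β ^ 4 = c₄)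
    (κ : ℕ → ℝ) (k0 : κ 0 = 1) (k2 : κ 2 = c₂) (k4 : κ 4 = c₄)
    (d : Fin n → ℕ) (hd : ∑ p, d p ≤ 5) :
    w * ∑ i, monomialValue d (codePoint ρ (σ i)) +
      w' * ∑ j, (monomialValue d (axisPoint β j) + monomialValue d (axisPoint (-β) j)) =
        κ (∑ p, d p) * ∏ p, gaussMoment (d p) := by
  have hnt : Nontrivial (Fin n) := Fin.nontrivial_iff_two_le.2 hn
  simp only [monomialValue_codePoint, ← Finset.mul_sum, sum_prod_sign_pow hσ d hd,
    monomialValue_axisPoint]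
  by_cases he : ∀ p, Even (d p)
  · rw [if_pos he]
    simp only [fun j => (he j).neg_pow β]
    rcases even_exponents_cases d hd he with rfl | ⟨j, rfl⟩ | ⟨j, rfl⟩ | ⟨j, j', hne, rfl⟩
    · simp [gaussMoment_zero, k0]
      linear_combination h0
    · have hcond : ∀ i, (∀ p, p ≠ i → (Pi.single j 2 : Fin n → ℕ) p = 0) ↔ i = j := by
        intro i
        refine ⟨fun h => ?_, fun h p hp => Pi.single_eq_of_ne (h ▸ hp) _⟩
        by_contra hij
        simpa using h j (Ne.symm hij)
      have hprod : ∏ p, gaussMoment ((Pi.single j 2 : Fin n → ℕ) p) = 1 := by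
        rw [Fintype.prod_eq_single j fun p hp => by rw [Pi.single_eq_of_ne hp, gaussMoment_zero],
          Pi.single_eq_same, gaussMoment_two]
      rw [hprod, Finset.sum_pi_single' , if_pos (Finset.mem_univ j), k2, ← h2]
      simp only [hcond, ← two_mul, ← Finset.mul_sum, Finset.sum_ite_eq', Finset.mem_univ, if_true,
        Pi.single_eq_same]
      ring
    · have hcond : ∀ i, (∀ p, p ≠ i → (Pi.single j 4 : Fin n → ℕ) p = 0) ↔ i = j := by
        intro i
        refine ⟨fun h => ?_, fun h p hp => Pi.single_eq_of_ne (h ▸ hp) _⟩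
        by_contra hij
        simpa using h j (Ne.symm hij)
      have hprod : ∏ p, gaussMoment ((Pi.single j 4 : Fin n → ℕ) p) = 3 := by
        rw [Fintype.prod_eq_single j fun p hp => by rw [Pi.single_eq_of_ne hp, gaussMoment_zero],
          Pi.single_eq_same, gaussMoment_four]
      rw [hprod, Finset.sum_pi_single', if_pos (Finset.mem_univ j), k4]
      simp only [hcond, ← two_mul, ← Finset.mul_sum, Finset.sum_ite_eq', Finset.mem_univ, if_true,
        Pi.single_eq_same]
      linear_combination h4 + 2 * h4'
    · have hcond : ∀ i, ¬ ∀ p, p ≠ i → (Pi.single j 2 + Pi.single j' 2 : Fin n → ℕ) p = 0 := by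
        intro i h
        by_cases hij : j = i
        · have := h j' (hij ▸ hne.symm); simp at this
        · have := h j hij; simp at this
      have hprod : ∏ p, gaussMoment ((Pi.single j 2 + Pi.single j' 2 : Fin n → ℕ) p) = 1 := by
        refine Finset.prod_eq_one fun p _ => ?_
        by_cases hp : p = j
        · subst hp; simp [hne, gaussMoment_two]
        by_cases hp' : p = j'
        · subst hp'; simp [hp, gaussMoment_two]
        · simp [hp, hp', gaussMoment_zero]
      rw [hprod]
      simp only [hcond, if_false, add_zero, Finset.sum_const_zero, mul_zero, mul_one]
      simp only [Pi.add_apply, Finset.sum_add_distrib, Finset.sum_pi_single', Finset.mem_univ,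
        if_true]
      rw [k4]
      linear_combination h4
  · rw [if_neg he]
    push Not at he
    obtain ⟨q, hq⟩ := he
    have hq : Odd (d q) := Nat.not_even_iff_odd.1 hq
    rw [Finset.prod_eq_zero (Finset.mem_univ q) (gaussMoment_odd _ hq),
      mul_zero, mul_zero, mul_zero, zero_add, Finset.sum_eq_zero, mul_zero]
    · intro j _
      split_ifs with h
      · have : q = j := by
          by_contra hne
          rw [h q hne] at hq
          simp at hq
        rw [← this, hq.neg_pow, add_neg_cancel]
      · rw [add_zero]

theorem designFormula_isCubature {μ : Measure (EuclideanSpace ℝ (Fin n))}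
    (hμ : HasMoments μ c₂ c₄) (hσ : IsSignDesign σ) (hn : 2 ≤ n) (hρ : ρ ≠ 0) (hβ : 0 < β)
    (h0 : w * Fintype.card ι + 2 * n * w' = 1)
    (h2 : w * Fintype.card ι * ρ ^ 2 + 2 * w' * β ^ 2 = c₂)
    (h4 : w * Fintype.card ι * ρ ^ 4 = c₄) (h4' : w' * β ^ 4 = c₄) :
    (designFormula σ ρ w β w').IsCubature 5 μ := by
  obtain ⟨κ, k0, k2, k4, hκ⟩ := hμ
  intro P hP
  have hval : polyValue P = fun x => ∑ d ∈ P.support, P.coeff d * monomialValue d x := by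
    funext x
    exact MvPolynomial.eval_eq' _ _
  rw [hval]
  have hint : ∀ d ∈ P.support, Integrable (fun x => P.coeff d * monomialValue d x) μ :=
    fun d _ => (hκ d).1.const_mul _
  refine ⟨integrable_finsetSum _ hint, ?_⟩
  rw [integral_finsetSum _ hint]
  simp only [Finset.mul_sum]
  rw [Finset.sum_comm]
  refine Finset.sum_congr rfl fun d hd => ?_
  have hdeg : ∑ p, d p ≤ 5 := by
    have := (MvPolynomial.le_totalDegree hd).trans hP
    rwa [Finsupp.sum_fintype _ _ fun _ => rfl] at this
  rw [integral_const_mul, (hκ d).2,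
    ← sum_monomialValue_designFormula hσ hn h0 h2 h4 h4' κ k0 k2 k4 d hdeg,
    ← sum_designFormula hσ hρ hβ hn, Finset.mul_sum]
  exact Finset.sum_congr rfl fun p _ => by ring

lemma designFormula_isPositive (hw : 0 < w) (hw' : 0 < w') :
    (designFormula σ ρ w β w').IsPositive := by
  intro p _
  simp only [designFormula]
  split_ifs <;> assumption

lemma norm_sq_codePoint (hσ : IsSignDesign σ) (i : ι) : ‖codePoint ρ (σ i)‖ ^ 2 = n * ρ ^ 2 := by
  rw [EuclideanSpace.norm_sq_eq]
  have : ∀ p, ‖codePoint ρ (σ i) p‖ ^ 2 = ρ ^ 2 := by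
    intro p
    rw [codePoint_apply, Real.norm_eq_abs, sq_abs]
    rcases hσ.sign i p with h | h <;> rw [h] <;> ring
  simp only [this, Finset.sum_const, Finset.card_univ, Fintype.card_fin, nsmul_eq_mul]

lemma norm_sq_axisPoint (b : ℝ) (j : Fin n) : ‖axisPoint b j‖ ^ 2 = b ^ 2 := by
  rw [EuclideanSpace.norm_sq_eq]
  simp only [axisPoint_apply, Real.norm_eq_abs, sq_abs]
  rw [Finset.sum_eq_single j] <;> simp +contextual

lemma designFormula_isInterior {μ : Measure (EuclideanSpace ℝ (Fin n))} (hσ : IsSignDesign σ)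
    (h : ∀ x : EuclideanSpace ℝ (Fin n), (‖x‖ ^ 2 = n * ρ ^ 2 ∨ ‖x‖ ^ 2 = β ^ 2) →
      x ∈ geomInterior μ.support) : (designFormula σ ρ w β w').IsInterior μ := by
  classical
  intro p hp
  apply h
  simp only [designFormula, Finset.mem_union, Finset.mem_image, Finset.mem_univ, true_and] at hp
  rcases hp with ⟨i, rfl⟩ | ⟨j, rfl⟩ | ⟨j, rfl⟩
  · exact Or.inl (norm_sq_codePoint hσ i)
  · exact Or.inr (norm_sq_axisPoint _ j)
  · exact Or.inr (by rw [norm_sq_axisPoint, neg_sq])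

end DesignFormula

/-! ### Supports and their interiors -/

lemma mem_geomInterior_of_mem_interior {n : ℕ} {X : Set (EuclideanSpace ℝ (Fin n))}
    {x : EuclideanSpace ℝ (Fin n)} (hx : x ∈ interior X) : x ∈ geomInterior X := by
  have hX : interior X ⊆ X := interior_subset
  have : Nonempty (interior X) := ⟨⟨x, hx⟩⟩
  have h1 : Topology.IsOpenEmbedding (Set.inclusion hX) :=
    ⟨Topology.IsEmbedding.inclusion hX, by
      rw [Set.range_inclusion]
      exact isOpen_interior.preimage continuous_subtype_val⟩
  have h2 : Topology.IsOpenEmbedding (Subtype.val : interior X → EuclideanSpace ℝ (Fin n)) :=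
    isOpen_interior.isOpenEmbedding_subtypeVal
  refine ⟨hX hx, n, (h1.toOpenPartialHomeomorph _).symm.trans (h2.toOpenPartialHomeomorph _), ?_⟩
  simp only [OpenPartialHomeomorph.trans_source, OpenPartialHomeomorph.symm_source,
    Topology.IsOpenEmbedding.toOpenPartialHomeomorph_target,
    Topology.IsOpenEmbedding.toOpenPartialHomeomorph_source, Set.preimage_univ, Set.inter_univ]
  exact ⟨⟨x, hx⟩, rfl⟩

lemma mem_geomInterior_gaussian {n : ℕ} (x : EuclideanSpace ℝ (Fin n)) :
    x ∈ geomInterior (gaussianMeasure n).support := by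
  apply mem_geomInterior_of_mem_interior
  have hpos : (gaussianMeasure n).IsOpenPosMeasure := by
    have hac : (volume : Measure ℝ) ≪ ProbabilityTheory.gaussianReal 0 1 :=
      ProbabilityTheory.gaussianReal_absolutelyContinuous' 0 one_ne_zero
    have h1 : (ProbabilityTheory.gaussianReal 0 1).IsOpenPosMeasure := hac.isOpenPosMeasure
    have hmap : gaussianMeasure n =
        (Measure.pi fun _ : Fin n => ProbabilityTheory.gaussianReal 0 1).map (WithLp.toLp 2) :=
      ProbabilityTheory.map_pi_eq_stdGaussian.symm
    rw [hmap]
    exact (PiLp.continuous_toLp 2 _).isOpenPosMeasure_map (WithLp.toLp_surjective 2)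
  rw [Measure.support_eq_univ, interior_univ]
  exact Set.mem_univ x

lemma support_ballMeasure {n : ℕ} :
    Metric.ball (0 : EuclideanSpace ℝ (Fin n)) 1 ⊆ interior (ballMeasure n).support := by
  refine interior_maximal (fun x hx => ?_) Metric.isOpen_ball
  rw [Measure.mem_support_iff_forall]
  intro U hU
  rw [ballMeasure, ProbabilityTheory.cond_apply Metric.isClosed_closedBall.measurableSet]
  refine ENNReal.mul_pos (ENNReal.inv_ne_zero.2 measure_closedBall_lt_top.ne) ?_
  refine (Measure.measure_pos_of_mem_nhds volume (x := x) (Filter.inter_mem ?_ hU)).ne'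
  exact Filter.mem_of_superset (Metric.isOpen_ball.mem_nhds hx) Metric.ball_subset_closedBall

lemma mem_geomInterior_ball {n : ℕ} {x : EuclideanSpace ℝ (Fin n)} (hx : ‖x‖ < 1) :
    x ∈ geomInterior (ballMeasure n).support :=
  mem_geomInterior_of_mem_interior (support_ballMeasure (by simpa using hx))

lemma support_sphereMeasure {n : ℕ} :
    (sphereMeasure n).support = Metric.sphere 0 1 := by
  have hfin : (volume : Measure (EuclideanSpace ℝ (Fin n))).toSphere Set.univ ≠ ⊤ :=
    measure_ne_top _ _
  have hmeas : Measurable (Subtype.val :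
      Metric.sphere (0 : EuclideanSpace ℝ (Fin n)) 1 → EuclideanSpace ℝ (Fin n)) :=
    measurable_subtype_coe
  refine Set.Subset.antisymm ?_ fun x hx => ?_
  · refine Measure.support_subset_of_isClosed Metric.isClosed_sphere ?_
    rw [mem_ae_iff, sphereMeasure, Measure.smul_apply,
      Measure.map_apply hmeas Metric.isClosed_sphere.measurableSet.compl]
    have : (Subtype.val ⁻¹' (Metric.sphere (0 : EuclideanSpace ℝ (Fin n)) 1)ᶜ :
        Set (Metric.sphere (0 : EuclideanSpace ℝ (Fin n)) 1)) = ∅ := by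
      ext y; simp
    rw [this, measure_empty, smul_zero]
  · rw [Measure.mem_support_iff_forall]
    intro U hU
    obtain ⟨V, hVU, hV, hxV⟩ := mem_nhds_iff.1 hU
    refine lt_of_lt_of_le ?_ (measure_mono hVU)
    rw [sphereMeasure, Measure.smul_apply, Measure.map_apply hmeas hV.measurableSet, smul_eq_mul]
    refine ENNReal.mul_pos (ENNReal.inv_ne_zero.2 hfin) ?_
    exact ((hV.preimage continuous_subtype_val).measure_pos _ ⟨⟨x, hx⟩, hxV⟩).ne'

lemma mem_geomInterior_sphere {n : ℕ} (hn : 0 < n) {x : EuclideanSpace ℝ (Fin n)} (hx : ‖x‖ = 1) :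
    x ∈ geomInterior (sphereMeasure n).support := by
  rw [support_sphereMeasure]
  have hx' : x ∈ Metric.sphere (0 : EuclideanSpace ℝ (Fin n)) 1 := by simpa using hx
  have : Fact (Module.finrank ℝ (EuclideanSpace ℝ (Fin n)) = (n - 1) + 1) :=
    ⟨by rw [finrank_euclideanSpace_fin]; omega⟩
  exact ⟨hx', n - 1, chartAt (EuclideanSpace ℝ (Fin (n - 1))) (⟨x, hx'⟩ : Metric.sphere _ _),
    mem_chart_source _ _⟩

/-! ### Reasoning about programs -/

set_option linter.unusedSimpArgs false

/-- Started in `s`, the program halts within `T` units of time in a configuration satisfying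
`Q`. -/
def Runs (p : Program) (s : MachineState) (T : ℕ) (Q : MachineState → Prop) : Prop :=
  ∃ t s', Exec p s t s' ∧ t ≤ T ∧ Q s'

/-- Sequential composition of a list of programs. -/
def block (l : List Program) : Program := l.foldr .seq .skip

lemma Runs.mono {p : Program} {s : MachineState} {T T' : ℕ} {Q Q' : MachineState → Prop}
    (h : Runs p s T Q) (hT : T ≤ T') (hQ : ∀ s', Q s' → Q' s') : Runs p s T' Q' := by
  obtain ⟨t, s', h1, h2, h3⟩ := h
  exact ⟨t, s', h1, h2.trans hT, hQ s' h3⟩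

lemma Runs.seq {p q : Program} {s : MachineState} {T T' : ℕ} {P Q : MachineState → Prop}
    (h : Runs p s T P) (h' : ∀ s', P s' → Runs q s' T' Q) : Runs (.seq p q) s (T + T') Q := by
  obtain ⟨t, s₁, h1, h2, h3⟩ := h
  obtain ⟨t', s₂, h1', h2', h3'⟩ := h' s₁ h3
  exact ⟨t + t', s₂, .seq _ _ _ _ _ _ _ h1 h1', by omega, h3'⟩

lemma Runs.block_nil {s : MachineState} {Q : MachineState → Prop} (h : Q s) :
    Runs (block []) s 1 Q :=
  ⟨1, s, .skip s, le_rfl, h⟩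

lemma Runs.block_cons {p : Program} {l : List Program} {s : MachineState} {T T' : ℕ}
    {P Q : MachineState → Prop} (h : Runs p s T P) (h' : ∀ s', P s' → Runs (block l) s' T' Q) :
    Runs (block (p :: l)) s (T + T') Q :=
  h.seq h'

/-- Rule for loops: the invariant `I` carries a counter, bounded by `N` as long as the loop runs. -/
lemma Runs.while {i j : ℕ} {p : Program} {C N : ℕ} {I : ℕ → MachineState → Prop}
    (hbody : ∀ t s, I t s → s.nat i < s.nat j → t < N ∧ Runs p s C (I (t + 1)))
    {t : ℕ} {s : MachineState} (h : I t s) :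
    Runs (.whileNat i j p) s ((N - t) * (C + 1) + 1)
      (fun s' => ∃ t', I t' s' ∧ ¬ s'.nat i < s'.nat j) := by
  induction hk : N - t generalizing t s with
  | zero =>
    by_cases hg : s.nat i < s.nat j
    · have := (hbody t s h hg).1; omega
    · exact ⟨1, s, .whileNatFalse _ _ _ _ hg, by omega, t, h, hg⟩
  | succ k ih =>
    by_cases hg : s.nat i < s.nat j
    · obtain ⟨htN, t₁, s₁, h1, h2, h3⟩ := hbody t s h hg
      obtain ⟨t₂, s₂, h1', h2', h3'⟩ := ih h3 (by omega)
      refine ⟨_, s₂, .whileNatTrue _ _ _ _ _ _ _ _ hg h1 h1', ?_, h3'⟩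
      rw [Nat.succ_mul]
      omega
    · exact ⟨1, s, .whileNatFalse _ _ _ _ hg, by omega, t, h, hg⟩

/-- Rule for counting loops: the register `i` runs from `t` to the value `N` of the register
`j`. -/
lemma Runs.for {i j : ℕ} {p : Program} {C N : ℕ} {I : ℕ → MachineState → Prop}
    (hi : ∀ t s, I t s → s.nat i = t) (hj : ∀ t s, I t s → s.nat j = N)
    (hbody : ∀ t s, t < N → I t s → Runs p s C (I (t + 1)))
    {t : ℕ} {s : MachineState} (htN : t ≤ N) (h : I t s) :
    Runs (.whileNat i j p) s (N * (C + 1) + 1) (I N) := by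
  have h1 := Runs.while (i := i) (j := j) (p := p) (C := C) (N := N)
    (I := fun t s => t ≤ N ∧ I t s) (fun t s hI hg => by
      rw [hi t s hI.2, hj t s hI.2] at hg
      exact ⟨hg, (hbody t s hg hI.2).mono le_rfl fun s' hs' => ⟨hg, hs'⟩⟩) ⟨htN, h⟩
  refine h1.mono ?_ ?_
  · have := Nat.mul_le_mul_right (C + 1) (Nat.sub_le N t)
    omega
  · rintro s' ⟨t', ⟨h2, h3⟩, h4⟩
    rw [hi t' s' h3, hj t' s' h3] at h4
    have : t' = N := by omega
    rwa [← this]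

lemma Runs.ifNat {i j : ℕ} {p q : Program} {s : MachineState} {T : ℕ} {Q : MachineState → Prop}
    (h : s.nat i < s.nat j → Runs p s T Q) (h' : ¬ s.nat i < s.nat j → Runs q s T Q) :
    Runs (.ifNat i j p q) s (T + 1) Q := by
  by_cases hg : s.nat i < s.nat j
  · obtain ⟨t, s', h1, h2, h3⟩ := h hg
    exact ⟨_, s', .ifNatTrue _ _ _ _ _ _ _ hg h1, by omega, h3⟩
  · obtain ⟨t, s', h1, h2, h3⟩ := h' hg
    exact ⟨_, s', .ifNatFalse _ _ _ _ _ _ _ hg h1, by omega, h3⟩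

/-- Weakest precondition of a loop-free program. -/
def WP : Program → (MachineState → Prop) → MachineState → Prop
  | .skip, Q, s => Q s
  | .setNat i c, Q, s => Q { s with nat := Function.update s.nat i c }
  | .addNat i j k, Q, s => Q { s with nat := Function.update s.nat i (s.nat j + s.nat k) }
  | .subNat i j k, Q, s => Q { s with nat := Function.update s.nat i (s.nat j - s.nat k) }
  | .loadNat i j, Q, s => Q { s with nat := Function.update s.nat i (s.nat (s.nat j)) }
  | .storeNat i j, Q, s => Q { s with nat := Function.update s.nat (s.nat i) (s.nat j) }
  | .castReal i j, Q, s => Q { s with real := Function.update s.real i (s.nat j : ℝ) }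
  | .addReal i j k, Q, s => Q { s with real := Function.update s.real i (s.real j + s.real k) }
  | .subReal i j k, Q, s => Q { s with real := Function.update s.real i (s.real j - s.real k) }
  | .mulReal i j k, Q, s => Q { s with real := Function.update s.real i (s.real j * s.real k) }
  | .divReal i j k, Q, s => s.real k ≠ 0 ∧
      Q { s with real := Function.update s.real i (s.real j / s.real k) }
  | .sqrtReal i j, Q, s => 0 ≤ s.real j ∧
      Q { s with real := Function.update s.real i (Real.sqrt (s.real j)) }
  | .loadReal i j, Q, s => Q { s with real := Function.update s.real i (s.real (s.nat j)) }
  | .storeReal i j, Q, s => Q { s with real := Function.update s.real (s.nat i) (s.real j) }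
  | .output i, Q, s => Q { s with out := s.out ++ [s.real i] }
  | .seq p q, Q, s => WP p (WP q Q) s
  | .ifNat i j p q, Q, s => (s.nat i < s.nat j → WP p Q s) ∧ (¬ s.nat i < s.nat j → WP q Q s)
  | .ifReal i j p q, Q, s =>
      (s.real i < s.real j → WP p Q s) ∧ (¬ s.real i < s.real j → WP q Q s)
  | .whileNat _ _ _, _, _ => False

/-- A bound for the running time of a loop-free program. -/
def cost : Program → ℕ
  | .seq p q => cost p + cost q
  | .ifNat _ _ p q => max (cost p) (cost q) + 1
  | .ifReal _ _ p q => max (cost p) (cost q) + 1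
  | _ => 1

theorem WP.runs {p : Program} {Q : MachineState → Prop} {s : MachineState} (h : WP p Q s) :
    Runs p s (cost p) Q := by
  induction p generalizing Q s with
  | skip => exact ⟨1, _, .skip _, le_rfl, h⟩
  | setNat => exact ⟨1, _, .setNat _ _ _, le_rfl, h⟩
  | addNat => exact ⟨1, _, .addNat _ _ _ _, le_rfl, h⟩
  | subNat => exact ⟨1, _, .subNat _ _ _ _, le_rfl, h⟩
  | loadNat => exact ⟨1, _, .loadNat _ _ _, le_rfl, h⟩
  | storeNat => exact ⟨1, _, .storeNat _ _ _, le_rfl, h⟩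
  | castReal => exact ⟨1, _, .castReal _ _ _, le_rfl, h⟩
  | addReal => exact ⟨1, _, .addReal _ _ _ _, le_rfl, h⟩
  | subReal => exact ⟨1, _, .subReal _ _ _ _, le_rfl, h⟩
  | mulReal => exact ⟨1, _, .mulReal _ _ _ _, le_rfl, h⟩
  | divReal => exact ⟨1, _, .divReal _ _ _ _ h.1, le_rfl, h.2⟩
  | sqrtReal => exact ⟨1, _, .sqrtReal _ _ _ h.1, le_rfl, h.2⟩
  | loadReal => exact ⟨1, _, .loadReal _ _ _, le_rfl, h⟩
  | storeReal => exact ⟨1, _, .storeReal _ _ _, le_rfl, h⟩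
  | output => exact ⟨1, _, .output _ _, le_rfl, h⟩
  | seq p q ihp ihq => exact (ihp h).seq fun s' hs' => ihq hs'
  | ifNat i j p q ihp ihq =>
    by_cases hg : s.nat i < s.nat j
    · obtain ⟨t, s', h1, h2, h3⟩ := ihp (h.1 hg)
      exact ⟨_, s', .ifNatTrue _ _ _ _ _ _ _ hg h1, by simp only [cost]; omega, h3⟩
    · obtain ⟨t, s', h1, h2, h3⟩ := ihq (h.2 hg)
      exact ⟨_, s', .ifNatFalse _ _ _ _ _ _ _ hg h1, by simp only [cost]; omega, h3⟩
  | ifReal i j p q ihp ihq =>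
    by_cases hg : s.real i < s.real j
    · obtain ⟨t, s', h1, h2, h3⟩ := ihp (h.1 hg)
      exact ⟨_, s', .ifRealTrue _ _ _ _ _ _ _ hg h1, by simp only [cost]; omega, h3⟩
    · obtain ⟨t, s', h1, h2, h3⟩ := ihq (h.2 hg)
      exact ⟨_, s', .ifRealFalse _ _ _ _ _ _ _ hg h1, by simp only [cost]; omega, h3⟩
  | whileNat => exact h.elim

lemma WP.runs_le {p : Program} {Q : MachineState → Prop} {s : MachineState} {T : ℕ}
    (h : WP p Q s) (hT : cost p ≤ T) : Runs p s T Q :=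
  h.runs.mono hT fun _ h => h

/-! ### Memory layout -/

/-- The quantities that stay in fixed memory cells once they have been computed. -/
structure Config where
  n : ℕ
  /-- The case distinguished by the size of `n`: `0`, `1`, `2` for the Kerdock array and for the
  arrays from the cubing map with and without additional columns. -/
  kind : ℕ
  m : ℕ
  r : ℕ
  q : ℕ
  /-- Half of `q`, where the search for the taps begins. -/
  half : ℕ
  ρ : ℝ
  w : ℝ
  β : ℝ
  w' : ℝ

/-- The cells `0, …, 19` and `0, …, 6` of the two memories contain the values belonging to `P`. The
cells from `20` on and from `10` on are work space, and tables start at cell `64`. -/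
structure Env (P : Config) (N : ℕ → ℕ) (R : ℕ → ℝ) : Prop where
  n0 : N 0 = P.n
  n1 : N 1 = 1
  n2 : N 2 = 0
  n3 : N 3 = P.m
  n4 : N 4 = 2 ^ P.m
  n5 : N 5 = P.q
  n6 : N 6 = P.r
  n7 : N 7 = P.q - 1
  n8 : N 8 = P.kind
  n9 : N 9 = 4 * P.q
  n10 : N 10 = 64
  n11 : N 11 = 64 + 2 * P.q
  n12 : N 12 = 64 + 20 * P.q
  n13 : N 13 = 64 + 40 * P.q
  n14 : N 14 = 64
  n15 : N 15 = 64 + P.n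
  n16 : N 16 = P.m - 1
  n17 : N 17 = 17 * P.q
  n18 : N 18 = 2 ^ P.m - 1
  n19 : N 19 = P.half
  r0 : R 0 = 0
  r1 : R 1 = 1
  r2 : R 2 = -1
  r3 : R 3 = P.ρ
  r4 : R 4 = P.w
  r5 : R 5 = P.β
  r6 : R 6 = P.w'

lemma Env.congr {P : Config} {N N' : ℕ → ℕ} {R R' : ℕ → ℝ} (h : Env P N R)
    (hN : ∀ a < 20, N' a = N a) (hR : ∀ a < 10, R' a = R a) : Env P N' R' := by
  constructor
  case n0 => exact (hN 0 (by norm_num)).trans h.n0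
  case n1 => exact (hN 1 (by norm_num)).trans h.n1
  case n2 => exact (hN 2 (by norm_num)).trans h.n2
  case n3 => exact (hN 3 (by norm_num)).trans h.n3
  case n4 => exact (hN 4 (by norm_num)).trans h.n4
  case n5 => exact (hN 5 (by norm_num)).trans h.n5
  case n6 => exact (hN 6 (by norm_num)).trans h.n6
  case n7 => exact (hN 7 (by norm_num)).trans h.n7
  case n8 => exact (hN 8 (by norm_num)).trans h.n8
  case n9 => exact (hN 9 (by norm_num)).trans h.n9
  case n10 => exact (hN 10 (by norm_num)).trans h.n10
  case n11 => exact (hN 11 (by norm_num)).trans h.n11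
  case n12 => exact (hN 12 (by norm_num)).trans h.n12
  case n13 => exact (hN 13 (by norm_num)).trans h.n13
  case n14 => exact (hN 14 (by norm_num)).trans h.n14
  case n15 => exact (hN 15 (by norm_num)).trans h.n15
  case n16 => exact (hN 16 (by norm_num)).trans h.n16
  case n17 => exact (hN 17 (by norm_num)).trans h.n17
  case n18 => exact (hN 18 (by norm_num)).trans h.n18
  case n19 => exact (hN 19 (by norm_num)).trans h.n19
  case r0 => exact (hR 0 (by norm_num)).trans h.r0
  case r1 => exact (hR 1 (by norm_num)).trans h.r1
  case r2 => exact (hR 2 (by norm_num)).trans h.r2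
  case r3 => exact (hR 3 (by norm_num)).trans h.r3
  case r4 => exact (hR 4 (by norm_num)).trans h.r4
  case r5 => exact (hR 5 (by norm_num)).trans h.r5
  case r6 => exact (hR 6 (by norm_num)).trans h.r6

lemma Env.update_nat {P : Config} {N : ℕ → ℕ} {R : ℕ → ℝ} {i v : ℕ} (hi : 20 ≤ i) :
    Env P (Function.update N i v) R ↔ Env P N R := by
  have h : ∀ a < 20, Function.update N i v a = N a := fun a ha =>
    Function.update_of_ne (by omega) _ _
  exact ⟨fun hE => hE.congr (fun a ha => (h a ha).symm) fun _ _ => rfl,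
    fun hE => hE.congr h fun _ _ => rfl⟩

lemma Env.update_real {P : Config} {N : ℕ → ℕ} {R : ℕ → ℝ} {i : ℕ} {v : ℝ} (hi : 10 ≤ i) :
    Env P N (Function.update R i v) ↔ Env P N R := by
  have h : ∀ a < 10, Function.update R i v a = R a := fun a ha =>
    Function.update_of_ne (by omega) _ _
  exact ⟨fun hE => hE.congr (fun _ _ => rfl) fun a ha => (h a ha).symm,
    fun hE => hE.congr (fun _ _ => rfl) h⟩

/-- The table of the first `N` values of `f` is stored from the address `base` on. -/
def Table {α : Type*} (mem : ℕ → α) (base N : ℕ) (f : ℕ → α) : Prop :=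
  ∀ e < N, mem (base + e) = f e

lemma Table.update {α : Type*} {mem : ℕ → α} {base N a : ℕ} {f : ℕ → α} {v : α}
    (h : a < base ∨ base + N ≤ a) : Table (Function.update mem a v) base N f ↔
      Table mem base N f := by
  refine forall₂_congr fun e he => ?_
  rw [Function.update_of_ne (by omega)]

lemma Table.zero {α : Type*} {mem : ℕ → α} {base : ℕ} {f : ℕ → α} : Table mem base 0 f :=
  fun _ h => absurd h (Nat.not_lt_zero _)

lemma Table.succ {α : Type*} {mem : ℕ → α} {base N : ℕ} {f : ℕ → α} (h : Table mem base N f)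
    {v : α} (hv : v = f N) : Table (Function.update mem (base + N) v) base (N + 1) f := by
  intro e he
  rcases Nat.lt_succ_iff_lt_or_eq.1 he with h1 | rfl
  · rw [Function.update_of_ne (by omega), h e h1]
  · rw [Function.update_self, hv]

lemma Table.mono {α : Type*} {mem : ℕ → α} {base N N' : ℕ} {f : ℕ → α} (h : Table mem base N f)
    (hN : N' ≤ N) : Table mem base N' f :=
  fun e he => h e (he.trans_le hN)

/-! ### The search for the taps -/

open Classical in
/-- The sequence with the taps given by the digits of `c`. -/
def lfsr (r c : ℕ) (t : ℕ) : ℝ :=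
  if t = 0 then -1 else if t < r then 1 else
    ∏ i : Fin r, if topBit r c i then lfsr r c (t - r + i) else 1
termination_by t
decreasing_by have := i.2; omega

lemma lfsr_zero (r c : ℕ) : lfsr r c 0 = -1 := by rw [lfsr, if_pos rfl]

lemma lfsr_init {r c i : ℕ} (hi : 0 < i) (hir : i < r) : lfsr r c i = 1 := by
  rw [lfsr, if_neg (by omega), if_pos hir]

open Classical in
lemma lfsr_step {r : ℕ} (hr : 0 < r) (c t : ℕ) : lfsr r c (t + r) =
    ∏ i ∈ Finset.range r, if topBit r c i then lfsr r c (t + i) else 1 := by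
  rw [lfsr, if_neg (by omega), if_neg (by omega), Finset.prod_range, Nat.add_sub_cancel]

lemma isLFSR_lfsr {r : ℕ} (hr : 0 < r) (c N : ℕ) : IsLFSR r c N (lfsr r c) :=
  ⟨lfsr_zero r c, fun _ => lfsr_init, fun t _ => lfsr_step hr c t⟩

/-- One step of the evaluation of the recurrence at `t`, together with the comparison of the
window at `t` with the initial window. -/
def tapStep : Program := block [
  .addNat 25 10 22, .addNat 25 25 23, .loadReal 12 25, .addNat 26 10 23, .loadReal 13 26,
  .subReal 13 12 13, .mulReal 13 13 13, .addReal 11 11 13, .addNat 24 24 24,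
  .ifNat 24 5 .skip (block [.subNat 24 24 5, .mulReal 10 10 12]), .addNat 23 23 1]

/-- Computes the next value of the sequence at the time in the cell `22`, and records in the cell
`21` whether the window at that time is the initial one. -/
def lfsrStep : Program := block [
  block [.addReal 10 1 0, .addReal 11 0 0, .addNat 24 20 2, .setNat 23 0],
  .whileNat 23 6 tapStep,
  block [.addNat 25 10 22, .addNat 25 25 6, .storeReal 25 10,
    .ifNat 2 22 (.ifReal 0 11 .skip (.setNat 21 1)) .skip, .addNat 22 22 1]]

/-- Test of the next value of the taps. -/
def tapTest : Program := block [
  block [.addNat 20 20 1, .setNat 21 0, .setNat 22 0], .whileNat 22 7 lfsrStep]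

/-- The search for taps without early return. -/
def tapSearch : Program := block [
  block [.addNat 25 10 2, .storeReal 25 2, .setNat 22 1],
  .whileNat 22 6 (block [.addNat 25 10 22, .storeReal 25 1, .addNat 22 22 1]),
  block [.subNat 20 19 1, .setNat 21 1],
  .whileNat 2 21 tapTest]

open Classical in
/-- Invariant of `tapStep`. -/
structure TapInv (P : Config) (c bad t i : ℕ) (s : MachineState) : Prop where
  env : Env P s.nat s.real
  out : s.out = []
  n20 : s.nat 20 = c
  n21 : s.nat 21 = bad
  n22 : s.nat 22 = t
  n23 : s.nat 23 = i
  n24 : s.nat 24 = 2 ^ i * c % 2 ^ P.r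
  r10 : s.real 10 = ∏ j ∈ Finset.range i, if topBit P.r c j then lfsr P.r c (t + j) else 1
  r11 : s.real 11 = ∑ j ∈ Finset.range i, (lfsr P.r c (t + j) - lfsr P.r c j) ^ 2
  table : Table s.real 64 (t + P.r) (lfsr P.r c)

lemma tapStep_runs {P : Config} (hq : P.q = 2 ^ P.r) {c bad t i : ℕ} {s : MachineState}
    (hi : i < P.r) (h : TapInv P c bad t i s) :
    Runs tapStep s 15 (TapInv P c bad t (i + 1)) := by
  have hE := h.env
  refine WP.runs_le ?_ (by simp [tapStep, block, cost])
  have h1 : s.real (64 + t + i) = lfsr P.r c (t + i) := by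
    rw [add_assoc]; exact h.table _ (by omega)
  have h2 : s.real (64 + i) = lfsr P.r c i := h.table _ (by omega)
  have hmod : 2 ^ (i + 1) * c % 2 ^ P.r = 2 * (2 ^ i * c % 2 ^ P.r) % 2 ^ P.r := by
    rw [pow_succ', mul_assoc, Nat.mul_mod_mod]
  have hlt : 2 ^ i * c % 2 ^ P.r < 2 ^ P.r := Nat.mod_lt _ (by positivity)
  simp (disch := omega) [tapStep, block, WP, Function.update_of_ne, hE.n10, hE.n5, h.n22, h.n23,
    h.n24, h1, h2, hE.n1]
  rw [← two_mul, hq]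
  have hx : ∀ j, (topBit P.r c j ↔ ¬ 2 * (2 ^ j * c % 2 ^ P.r) < 2 ^ P.r) := fun j => by
    rw [topBit, not_lt]
  refine ⟨fun hg => ?_, fun hg => ?_⟩
  · constructor <;> simp (disch := omega) [Function.update_of_ne, Env.update_nat, Env.update_real,
      Table.update, h.n20, h.n21, h.n22, h.n23, h.n24, hE, h.table, hE.n1, h.out]
    · rw [hmod, Nat.mod_eq_of_lt hg]
    · rw [Finset.prod_range_succ, if_neg (by rw [hx]; exact not_not.2 hg), mul_one, h.r10]
    · rw [Finset.sum_range_succ, h.r11]; ring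
  · constructor <;> simp (disch := omega) [Function.update_of_ne, Env.update_nat, Env.update_real,
      Table.update, h.n20, h.n21, h.n22, h.n23, h.n24, hE, h.table, hE.n1, h.out]
    · rw [hmod, Nat.mod_eq_sub_mod hg]
      exact (Nat.mod_eq_of_lt (by omega)).symm
    · rw [Finset.prod_range_succ, if_pos ((hx i).2 (by omega)), h.r10]
    · rw [Finset.sum_range_succ, h.r11]; ring

/-- Invariant of `lfsrStep`. The cell `21` records whether the initial window has come back. -/
structure LfsrInv (P : Config) (c t : ℕ) (s : MachineState) : Prop where
  env : Env P s.nat s.real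
  out : s.out = []
  n20 : s.nat 20 = c
  n22 : s.nat 22 = t
  table : Table s.real 64 (t + P.r) (lfsr P.r c)
  bad : (s.nat 21 = 0 ∧ ∀ t', 0 < t' → t' < t → ∃ i < P.r, lfsr P.r c (t' + i) ≠ lfsr P.r c i) ∨
    (s.nat 21 = 1 ∧ ∃ t', 0 < t' ∧ t' < t ∧ ∀ i < P.r, lfsr P.r c (t' + i) = lfsr P.r c i)

lemma lfsrStep_runs {P : Config} (hq : P.q = 2 ^ P.r) (hr : 0 < P.r) {c t : ℕ} {s : MachineState}
    (hc : c < 2 ^ P.r) (h : LfsrInv P c t s) :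
    Runs lfsrStep s (16 * P.r + 15) (LfsrInv P c (t + 1)) := by
  have hE := h.env
  refine Runs.mono (T := 5 + (P.r * 16 + 1 + (8 + 1))) (Runs.block_cons
    (P := TapInv P c (s.nat 21) t 0) (WP.runs_le ?_ (by simp [block, cost])) fun s₁ h₁ =>
    Runs.block_cons (Runs.for (fun _ _ h => h.n23) (fun _ _ h => h.env.n6)
      (fun i s hi h => tapStep_runs hq hi h) (Nat.zero_le _) h₁) fun s₂ h₂ =>
    Runs.block_cons (WP.runs_le (Q := LfsrInv P c (t + 1)) ?_ (by simp [block, cost])) fun s₃ h₃ =>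
    Runs.block_nil h₃) (by omega) fun _ h => h
  · simp [block, WP]
    constructor <;> simp (disch := omega) [Function.update_of_ne, Env.update_nat, Env.update_real,
      Table.update, hE, h.n20, h.n22, h.out, h.table, hE.n2, Nat.mod_eq_of_lt hc, hE.r1, hE.r0]
  · have hbad := h.bad
    clear h hE h₁
    have hE := h₂.env
    have htab : Table (Function.update s₂.real (64 + t + P.r) (s₂.real 10)) 64 (t + 1 + P.r)
        (lfsr P.r c) := by
      have := h₂.table.succ (v := s₂.real 10) (by rw [h₂.r10, lfsr_step hr])
      rwa [show 64 + t + P.r = 64 + (t + P.r) by omega, show t + 1 + P.r = t + P.r + 1 by omega]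
    have hpos : 0 ≤ ∑ j ∈ Finset.range P.r, (lfsr P.r c (t + j) - lfsr P.r c j) ^ 2 :=
      Finset.sum_nonneg fun _ _ => sq_nonneg _
    have hzero := Finset.sum_eq_zero_iff_of_nonneg (s := Finset.range P.r)
      (f := fun j => (lfsr P.r c (t + j) - lfsr P.r c j) ^ 2) fun _ _ => sq_nonneg _
    simp only [Finset.mem_range, sq_eq_zero_iff, sub_eq_zero] at hzero
    have hnew : (s.nat 21 = 0 ∧ (t = 0 ∨ ∃ i < P.r, lfsr P.r c (t + i) ≠ lfsr P.r c i) →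
        ∀ t', 0 < t' → t' ≤ t → ∃ i < P.r, lfsr P.r c (t' + i) ≠ lfsr P.r c i) := by
      rintro ⟨h0, h1⟩ t' ht' ht''
      rcases hbad with hbad | hbad
      · rcases ht''.lt_or_eq with h2 | rfl
        · exact hbad.2 t' ht' h2
        · exact h1.resolve_left (by omega)
      · omega
    simp (disch := omega) [block, WP, Function.update_of_ne, hE.n10, hE.n2, h₂.n22, hE.r0, hE.n6,
      hE.n1]
    refine ⟨fun ht => ⟨fun hg => ?_, fun hg => ?_⟩, fun ht => ?_⟩
    · constructor <;> simp (disch := omega) [Function.update_of_ne, Env.update_nat,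
        Env.update_real, hE, h₂.n20, h₂.n22, h₂.out, htab, h₂.n21]
      refine hbad.imp (fun h => ⟨h.1, hnew ⟨h.1, Or.inr ?_⟩⟩)
        fun ⟨h1, t', h2, h3, h4⟩ => ⟨h1, t', h2, by omega, h4⟩
      by_contra! hne
      rw [h₂.r11, hzero.2 hne] at hg
      exact hg.false
    · constructor <;> simp (disch := omega) [Function.update_of_ne, Env.update_nat,
        Env.update_real, hE, h₂.n20, h₂.n22, h₂.out, htab, h₂.n21]
      refine ⟨t, ht, by omega, hzero.1 ?_⟩
      rw [h₂.r11] at hg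
      exact le_antisymm hg hpos
    · constructor <;> simp (disch := omega) [Function.update_of_ne, Env.update_nat,
        Env.update_real, hE, h₂.n20, h₂.n22, h₂.out, htab, h₂.n21]
      exact hbad.imp (fun h => ⟨h.1, hnew ⟨h.1, Or.inl ht⟩⟩)
        fun ⟨h1, t', h2, h3, h4⟩ => ⟨h1, t', h2, by omega, h4⟩

lemma tapTest_runs {P : Config} (hq : P.q = 2 ^ P.r) (hr : 0 < P.r) {c : ℕ} {s : MachineState}
    (hc : c + 1 < 2 ^ P.r) (hE : Env P s.nat s.real) (hout : s.out = []) (h20 : s.nat 20 = c)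
    (h : Table s.real 64 P.r (lfsr P.r (c + 1))) :
    Runs tapTest s (P.q * (16 * P.r + 16) + 6) (LfsrInv P (c + 1) (P.q - 1)) := by
  refine Runs.mono (T := 4 + (P.q * (16 * P.r + 16) + 1 + 1)) (Runs.block_cons
    (P := LfsrInv P (c + 1) 0) (WP.runs_le ?_ (by simp [block, cost])) fun s₁ h₁ =>
    Runs.block_cons ((Runs.for (fun _ _ h => h.n22) (fun _ _ h => h.env.n7)
      (fun i s hi h => lfsrStep_runs hq hr hc h) (Nat.zero_le _) h₁).mono ?_ fun _ h => h)
      fun s₂ h₂ => Runs.block_nil h₂) (by omega) fun _ h => h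
  · simp [block, WP]
    constructor <;> simp (disch := omega) [Function.update_of_ne, Env.update_nat, Env.update_real,
      Table.update, hE, h20, hout, h, hE.n1, hE.n2]
  · exact Nat.add_le_add_right (Nat.mul_le_mul_right _ (Nat.sub_le _ _)) 1

/-- Invariant of the search. The bound `c₀` for the taps guarantees that the search ends. -/
structure SearchInv (P : Config) (c₀ k : ℕ) (s : MachineState) : Prop where
  env : Env P s.nat s.real
  out : s.out = []
  n20 : s.nat 20 + 1 = P.half + k
  le : s.nat 20 ≤ c₀
  init : ∀ c, Table s.real 64 P.r (lfsr P.r c)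
  test : (k = 0 ∧ s.nat 21 = 1) ∨ (0 < k ∧ LfsrInv P (s.nat 20) (P.q - 1) s)

lemma table_lfsr_init {r c c' : ℕ} {R : ℕ → ℝ} (h : Table R 64 r (lfsr r c)) :
    Table R 64 r (lfsr r c') := by
  intro e he
  rw [h e he]
  rcases Nat.eq_zero_or_pos e with rfl | h0
  · rw [lfsr_zero, lfsr_zero]
  · rw [lfsr_init h0 he, lfsr_init h0 he]

/-- The sequence found by the search lists the values of an additive character at the powers of a
primitive element. -/
theorem tapSearch_runs {P : Config} (hq : P.q = 2 ^ P.r) (hr : 2 ≤ P.r)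
    (hhalf : 2 * P.half = P.q) {s : MachineState} (hE : Env P s.nat s.real) (hout : s.out = []) :
    Runs tapSearch s (P.q * (P.q * (16 * P.r + 16) + 7) + 5 * P.r + 20) fun s' =>
      Env P s'.nat s'.real ∧ s'.out = [] ∧
      ∃ S, IsFieldSequence P.r S ∧ Table s'.real 64 (P.q - 1) S := by
  obtain ⟨c₀, hc, hc', hgood⟩ := exists_noEarlyReturn hr
  have hhalf' : P.half = 2 ^ (P.r - 1) := by
    have : 2 ^ P.r = 2 * 2 ^ (P.r - 1) := by rw [← pow_succ']; congr 1; omega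
    omega
  have hpos : 0 < P.half := by rw [hhalf']; positivity
  refine Runs.mono (T := 4 + (P.r * (4 + 1) + 1 + (3 +
    ((P.q - 0) * (P.q * (16 * P.r + 16) + 7) + 1 + 1)))) (Runs.block_cons
    (P := fun s => Env P s.nat s.real ∧ s.out = [] ∧ s.nat 22 = 1 ∧
      Table s.real 64 1 (lfsr P.r 0)) (WP.runs_le ?_ (by simp [block, cost])) fun s₁ h₁ =>
    Runs.block_cons (Runs.for (N := P.r) (C := 4) (t := 1)
      (I := fun t s => Env P s.nat s.real ∧ s.out = [] ∧ s.nat 22 = t ∧ 0 < t ∧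
      Table s.real 64 t (lfsr P.r 0)) (fun _ _ h => h.2.2.1) (fun _ _ h => h.1.n6)
      (fun i s hi h => WP.runs_le ?_ (by simp [block, cost])) (by omega)
      ⟨h₁.1, h₁.2.1, h₁.2.2.1, one_pos, h₁.2.2.2⟩) fun s₂ h₂ =>
    Runs.block_cons (P := SearchInv P c₀ 0) (WP.runs_le ?_ (by simp [block, cost])) fun s₃ h₃ =>
    Runs.block_cons (Runs.while (fun k s h hg => ?_) h₃) fun s₄ h₄ => Runs.block_nil ?_) ?_
    fun _ h => h
  · simp (disch := omega) [block, WP, Env.update_nat, Env.update_real, hE, hout, hE.n10, hE.n2,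
      hE.r2, Function.update_of_ne]
    exact Table.zero.succ (lfsr_zero P.r 0).symm
  · obtain ⟨h1, h2, h3, h4, h5⟩ := h
    simp (disch := omega) [block, WP, Env.update_nat, Env.update_real, h1, h2, h1.n10, h3,
      h1.r1, Function.update_of_ne, h1.n1]
    exact h5.succ (lfsr_init h4 hi).symm
  · obtain ⟨h1, h2, -, -, h5⟩ := h₂
    simp (disch := omega) [block, WP, Function.update_of_ne]
    have h6 : 2 ^ (P.r - 1) - 1 ≤ c₀ := by omega
    have h7 : 2 ^ (P.r - 1) - 1 + 1 = 2 ^ (P.r - 1) := by omega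
    constructor <;> simp (disch := omega) [Function.update_of_ne, Env.update_nat, h1, h2, h1.n19,
      h1.n1, hhalf', h6, h7]
    exact fun c => table_lfsr_init h5
  · have hlt : s.nat 20 < c₀ := by
      refine h.le.lt_of_ne fun heq => ?_
      rcases h.test with h1 | ⟨h1, h2⟩
      · have := h.n20
        omega
      · have h3 := h2.bad
        rw [h.env.n2] at hg
        obtain ⟨-, t, ht, ht', h4⟩ := h3.resolve_left (by omega)
        rw [heq] at h4
        obtain ⟨i, hi, hne⟩ := hgood _ _ le_rfl (isLFSR_lfsr (by omega) c₀ _) t ht (by omega)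
        exact hne (h4 i hi)
    have := h.n20
    refine ⟨by omega, (tapTest_runs hq (by omega) (by omega) h.env h.out rfl (h.init _)).mono le_rfl
      fun s' hs' => ⟨hs'.env, hs'.out, by rw [hs'.n20]; omega, by rw [hs'.n20]; omega,
        fun c => table_lfsr_init (hs'.table.mono (by omega)), Or.inr ⟨k.succ_pos, ?_⟩⟩⟩
    rwa [hs'.n20]
  · obtain ⟨k, h, hg⟩ := h₄
    rw [h.env.n2] at hg
    obtain ⟨hk, h2⟩ := h.test.resolve_left (by omega)
    have h3 := h2.bad.resolve_right (by omega)
    have := h.n20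
    have := h.le
    refine ⟨h.env, h.out, lfsr P.r (s₄.nat 20), isFieldSequence_of_noEarlyReturn hr (by omega)
      (by omega) le_rfl (isLFSR_lfsr (by omega) _ _) ?_, h2.table.mono (by omega)⟩
    intro t
    rw [← hq]
    exact h3.2 t
  · rw [Nat.sub_zero]
    omega

/-! ### Computation of the constants -/

/-- The size `m` of the case distinction, and the size of the field that goes with it. The total
weight `A` of the points from the code is distributed evenly. -/
structure Config.Valid (P : Config) (n : ℕ) (ρ A β w' : ℝ) : Prop where
  n_eq : P.n = n
  ρ_eq : P.ρ = ρ
  β_eq : P.β = β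
  w'_eq : P.w' = w'
  one_le_m : 1 ≤ P.m
  lt_n : 2 ^ (2 * P.m - 1) < n
  cases : (P.kind = 0 ∧ P.r = 2 * P.m - 1 ∧ n ≤ 2 ^ (2 * P.m)) ∨
    (P.kind = 1 ∧ P.r = 2 * P.m ∧ 2 ^ (2 * P.m) < n ∧ n ≤ 2 ^ (2 * P.m) + 2 ^ P.m) ∨
    (P.kind = 2 ∧ P.r = 2 * P.m + 1 ∧ 2 ^ (2 * P.m) + 2 ^ P.m < n ∧ n ≤ 2 ^ (2 * P.m + 1))
  q_eq : P.q = 2 ^ P.r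
  half_eq : 2 * P.half = P.q
  w_eq : P.w = A / ((if P.kind < 2 then 4 else 2) * P.q ^ 2)

/-- The next value of `m`, with the powers `2 ^ m` and `2 ^ (2 * m - 2)`, …, `2 ^ (2 * m + 1)`. -/
def sizeStep : Program := block [.addNat 3 3 1, .addNat 4 4 4, .addNat 20 22 2, .addNat 21 23 2,
  .addNat 22 21 21, .addNat 23 22 22]

/-- Decides between the three cases and sets `q`, its half, `r` and the number of the case. -/
def chooseCase : Program := block [.addNat 24 22 4,
  .ifNat 22 0
    (.ifNat 24 0
      (block [.addNat 5 23 2, .addNat 19 22 2, .addNat 6 3 3, .addNat 6 6 1, .setNat 8 2])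
      (block [.addNat 5 22 2, .addNat 19 21 2, .addNat 6 3 3, .setNat 8 1]))
    (block [.addNat 5 21 2, .addNat 19 20 2, .addNat 6 3 3, .subNat 6 6 1, .setNat 8 0])]

/-- The remaining constants: the addresses of the tables and the weight of a point of the code. -/
def deriveConstants : Program := block [
  block [.subNat 7 5 1, .addNat 9 5 5, .addNat 9 9 9, .setNat 10 64, .setNat 14 64,
    .addNat 15 14 0, .subNat 16 3 1, .subNat 18 4 1, .addNat 17 9 9],
  block [.addNat 17 17 17, .addNat 11 10 5, .addNat 11 11 5, .addNat 12 10 17, .addNat 12 12 9],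
  block [.addNat 13 12 17, .addNat 13 13 9, .addNat 17 17 5, .castReal 10 5, .mulReal 10 10 10,
    .addReal 10 10 10],
  block [.setNat 24 2, .ifNat 8 24 (.addReal 10 10 10) .skip, .divReal 4 4 10]]

/-- Computation of all constants, given a program for those that depend on the measure. -/
def setup (parameters : Program) : Program := block [parameters,
  block [.setNat 1 1, .setNat 2 0, .setNat 3 1, .setNat 4 2, .setNat 20 1, .setNat 21 2,
    .setNat 22 4, .setNat 23 8, .castReal 1 1, .subReal 0 1 1, .subReal 2 0 1],
  .whileNat 23 0 sizeStep, chooseCase, deriveConstants]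

/-- The program computes the radii `ρ` and `β` and the weights `A` and `w'`. -/
def ComputesParameters (p : Program) (n T : ℕ) (ρ A β w' : ℝ) : Prop :=
  Runs p (startState n) T fun s => s.nat 0 = n ∧ s.out = [] ∧ s.real 3 = ρ ∧ s.real 4 = A ∧
    s.real 5 = β ∧ s.real 6 = w'

/-- Invariant of `sizeStep`. -/
structure SizeInv (n : ℕ) (ρ A β w' : ℝ) (m : ℕ) (s : MachineState) : Prop where
  n0 : s.nat 0 = n
  n1 : s.nat 1 = 1
  n2 : s.nat 2 = 0
  n3 : s.nat 3 = m
  n4 : s.nat 4 = 2 ^ m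
  n20 : s.nat 20 = 2 ^ (2 * m - 2)
  n21 : s.nat 21 = 2 ^ (2 * m - 1)
  n22 : s.nat 22 = 2 ^ (2 * m)
  n23 : s.nat 23 = 2 ^ (2 * m + 1)
  r0 : s.real 0 = 0
  r1 : s.real 1 = 1
  r2 : s.real 2 = -1
  r3 : s.real 3 = ρ
  r4 : s.real 4 = A
  r5 : s.real 5 = β
  r6 : s.real 6 = w'
  out : s.out = []
  pos : 1 ≤ m
  lt : 2 ^ (2 * m - 1) < n

/-- The situation after `chooseCase`. -/
structure CaseInv (n : ℕ) (ρ A β w' : ℝ) (m kind r q half : ℕ) (s : MachineState) : Prop where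
  n0 : s.nat 0 = n
  n1 : s.nat 1 = 1
  n2 : s.nat 2 = 0
  n3 : s.nat 3 = m
  n4 : s.nat 4 = 2 ^ m
  n5 : s.nat 5 = q
  n6 : s.nat 6 = r
  n8 : s.nat 8 = kind
  n19 : s.nat 19 = half
  r0 : s.real 0 = 0
  r1 : s.real 1 = 1
  r2 : s.real 2 = -1
  r3 : s.real 3 = ρ
  r4 : s.real 4 = A
  r5 : s.real 5 = β
  r6 : s.real 6 = w'
  out : s.out = []

lemma sizeStep_runs {n m : ℕ} {ρ A β w' : ℝ} {s : MachineState} (h : SizeInv n ρ A β w' m s)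
    (hlt : s.nat 23 < s.nat 0) : Runs sizeStep s 7 (SizeInv n ρ A β w' (m + 1)) := by
  refine WP.runs_le ?_ (by simp [sizeStep, block, cost])
  have h1 : 2 * (m + 1) - 2 = 2 * m := by omega
  have h2 : 2 * (m + 1) - 1 = 2 * m + 1 := by omega
  have h3 : 2 ^ (2 * m + 1) < n := by rw [← h.n23, ← h.n0]; exact hlt
  simp [sizeStep, block, WP, Function.update_apply]
  constructor <;> simp [h.n0, h.n1, h.n2, h.n3, h.n4, h.n22, h.n23, h.r0, h.r1,
    h.r2, h.r3, h.r4, h.r5, h.r6, h.out, Function.update_apply, h1, h2, h3] <;> ring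

set_option maxHeartbeats 1000000 in
lemma deriveConstants_runs {n m kind r q half : ℕ} {ρ A β w' : ℝ} {s : MachineState}
    (h : CaseInv n ρ A β w' m kind r q half s) (hq : 0 < q) :
    Runs deriveConstants s 40 fun s => s.out = [] ∧
      Env ⟨n, kind, m, r, q, half, ρ, A / ((if kind < 2 then 4 else 2) * q ^ 2), β, w'⟩
        s.nat s.real := by
  refine Runs.mono (T := 10 + (6 + (7 + (5 + 1)))) (Runs.block_cons
    (P := fun s => CaseInv n ρ A β w' m kind r q half s ∧ s.nat 7 = q - 1 ∧ s.nat 9 = 4 * q ∧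
      s.nat 10 = 64 ∧ s.nat 14 = 64 ∧ s.nat 15 = 64 + n ∧ s.nat 16 = m - 1 ∧
      s.nat 18 = 2 ^ m - 1 ∧ s.nat 17 = 8 * q)
    (WP.runs_le (T := 10) ?_ (by simp [block, cost])) fun s₁ h₁ => Runs.block_cons
    (P := fun s => CaseInv n ρ A β w' m kind r q half s ∧ s.nat 7 = q - 1 ∧ s.nat 9 = 4 * q ∧
      s.nat 10 = 64 ∧ s.nat 14 = 64 ∧ s.nat 15 = 64 + n ∧ s.nat 16 = m - 1 ∧
      s.nat 18 = 2 ^ m - 1 ∧ s.nat 17 = 16 * q ∧ s.nat 11 = 64 + 2 * q ∧ s.nat 12 = 64 + 20 * q)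
    (WP.runs_le (T := 6) ?_ (by simp [block, cost])) fun s₂ h₂ => Runs.block_cons
    (P := fun s => CaseInv n ρ A β w' m kind r q half s ∧ s.nat 7 = q - 1 ∧ s.nat 9 = 4 * q ∧
      s.nat 10 = 64 ∧ s.nat 14 = 64 ∧ s.nat 15 = 64 + n ∧ s.nat 16 = m - 1 ∧
      s.nat 18 = 2 ^ m - 1 ∧ s.nat 17 = 17 * q ∧ s.nat 11 = 64 + 2 * q ∧ s.nat 12 = 64 + 20 * q ∧
      s.nat 13 = 64 + 40 * q ∧ s.real 10 = 2 * (q : ℝ) ^ 2)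
    (WP.runs_le (T := 7) ?_ (by simp [block, cost])) fun s₃ h₃ => Runs.block_cons
    (WP.runs_le (T := 5) ?_ (by simp [block, cost])) fun s₄ h₄ => Runs.block_nil h₄) (by norm_num)
    fun _ h => h
  · simp [block, WP, Function.update_apply, h.n0, h.n1, h.n5, h.n3, h.n4]
    refine ⟨?_, by ring, by ring⟩
    constructor <;> simp [h.n0, h.n1, h.n2, h.n3, h.n4, h.n5, h.n6, h.n8, h.n19,
      h.r0, h.r1, h.r2, h.r3, h.r4, h.r5, h.r6, h.out, Function.update_apply]
  · clear h
    obtain ⟨h, h7, h9, h10, h14, h15, h16, h18, h17⟩ := h₁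
    simp [block, WP, Function.update_apply, h.n5, h7, h9, h10, h14, h15, h16,
      h18, h17]
    refine ⟨?_, by ring, by ring, by ring⟩
    constructor <;> simp [h.n0, h.n1, h.n2, h.n3, h.n4, h.n5, h.n6, h.n8, h.n19,
      h.r0, h.r1, h.r2, h.r3, h.r4, h.r5, h.r6, h.out, Function.update_apply]
  · clear h h₁
    obtain ⟨h, h7, h9, h10, h14, h15, h16, h18, h17, h11, h12⟩ := h₂
    simp [block, WP, Function.update_apply, h.n5, h7, h9, h10, h14, h15, h16,
      h18, h17, h11, h12]
    refine ⟨?_, by ring, by ring, by ring⟩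
    constructor <;> simp [h.n0, h.n1, h.n2, h.n3, h.n4, h.n5, h.n6, h.n8,
      h.n19, h.r0, h.r1, h.r2, h.r3, h.r4, h.r5, h.r6, h.out, Function.update_apply]
  · clear h h₁ h₂
    obtain ⟨h, h7, h9, h10, h14, h15, h16, h18, h17, h11, h12, h13, hr⟩ := h₃
    have hq' : (q : ℝ) ≠ 0 := by positivity
    simp [block, WP, Function.update_apply, h.n8, h.r4, h.out, hr]
    refine ⟨fun hk => ⟨by simpa [← two_mul] using hq', ?_⟩, fun hk => ⟨hq.ne', ?_⟩⟩
    · constructor <;> simp [h.n0, h.n1, h.n2, h.n3, h.n4, h.n5, h.n6, h.n8,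
        h.n19, h.r0, h.r1, h.r2, h.r3, h.r4, h.r5, h.r6, Function.update_apply, hk, h7, h9, h10,
        h14, h15, h16, h18, h11, h12, h13, h17]
      congr 1
      ring
    · constructor <;> simp [h.n0, h.n1, h.n2, h.n3, h.n4, h.n5, h.n6, h.n8,
        h.n19, h.r0, h.r1, h.r2, h.r3, h.r4, h.r5, h.r6, Function.update_apply, hk, h7, h9, h10,
        h14, h15, h16, h18, h11, h12, h13, h17]
      rw [if_neg (by omega)]

theorem setup_runs {p : Program} {n T : ℕ} {ρ A β w' : ℝ} (hn : 6 ≤ n)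
    (hp : ComputesParameters p n T ρ A β w') :
    Runs (setup p) (startState n) (T + 8 * n + 80) fun s => s.out = [] ∧
      ∃ P : Config, P.Valid n ρ A β w' ∧ Env P s.nat s.real := by
  refine Runs.mono (T := T + (12 + ((n - 1) * (7 + 1) + 1 + (10 + (40 + 1))))) (Runs.block_cons hp
    fun s₁ h₁ => Runs.block_cons (P := SizeInv n ρ A β w' 1) (WP.runs_le ?_
    (by simp [block, cost])) fun s₂ h₂ => Runs.block_cons (Runs.while
    (fun k s h hg => ⟨?_, sizeStep_runs h hg⟩) h₂) fun s₃ h₃ => ?_) (by omega) fun _ h => h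
  · obtain ⟨h1, h2, h3, h4, h5, h6⟩ := h₁
    simp [block, WP, Function.update_apply]
    constructor <;> simp [h1, h2, h3, h4, h5, h6, Function.update_apply]
    omega
  · rw [h.n23, h.n0] at hg
    have := @Nat.lt_two_pow_self (2 * k + 1)
    omega
  · obtain ⟨m, h, hg⟩ := h₃
    rw [h.n23, h.n0, not_lt] at hg
    have e1 : 2 * 2 ^ (2 * m - 2) = 2 ^ (2 * m - 1) := by
      rw [← pow_succ']; congr 1; have := h.pos; omega
    have e2 : 2 * 2 ^ (2 * m - 1) = 2 ^ (2 * m) := by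
      rw [← pow_succ']; congr 1; have := h.pos; omega
    have e3 : 2 * 2 ^ (2 * m) = 2 ^ (2 * m + 1) := by rw [← pow_succ']
    refine Runs.block_cons (P := fun s => ∃ P : Config, P.Valid n ρ A β w' ∧
      CaseInv n ρ A β w' P.m P.kind P.r P.q P.half s)
      (WP.runs_le ?_ (by simp [chooseCase, block, cost])) ?_
    · simp [chooseCase, block, WP, Function.update_apply, h.n22, h.n4, h.n0]
      refine ⟨fun h1 => ⟨fun h2 => ⟨⟨n, 2, m, 2 * m + 1, 2 ^ (2 * m + 1), 2 ^ (2 * m), ρ,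
        A / ((if 2 < 2 then 4 else 2) * ((2 ^ (2 * m + 1) : ℕ) : ℝ) ^ 2), β, w'⟩,
        ⟨rfl, rfl, rfl, rfl, h.pos, h.lt, Or.inr (Or.inr ⟨rfl, rfl, h2, hg⟩), rfl, e3, rfl⟩, ?_⟩,
        fun h2 => ⟨⟨n, 1, m, 2 * m, 2 ^ (2 * m), 2 ^ (2 * m - 1), ρ,
        A / ((if 1 < 2 then 4 else 2) * ((2 ^ (2 * m) : ℕ) : ℝ) ^ 2), β, w'⟩,
        ⟨rfl, rfl, rfl, rfl, h.pos, h.lt, Or.inr (Or.inl ⟨rfl, rfl, h1, h2⟩), rfl, e2, rfl⟩, ?_⟩⟩,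
        fun h1 => ⟨⟨n, 0, m, 2 * m - 1, 2 ^ (2 * m - 1), 2 ^ (2 * m - 2), ρ,
        A / ((if 0 < 2 then 4 else 2) * ((2 ^ (2 * m - 1) : ℕ) : ℝ) ^ 2), β, w'⟩,
        ⟨rfl, rfl, rfl, rfl, h.pos, h.lt, Or.inl ⟨rfl, rfl, h1⟩, rfl, e1, rfl⟩, ?_⟩⟩
      all_goals
        constructor <;> simp [h.n0, h.n1, h.n2, h.n3, h.n4, h.n20, h.n21, h.n22,
          h.n23, h.r0, h.r1, h.r2, h.r3, h.r4, h.r5, h.r6, h.out, Function.update_apply, two_mul]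
    · rintro s' ⟨P, hP, hs'⟩
      refine Runs.block_cons (deriveConstants_runs hs' (by rw [hP.q_eq]; positivity))
        fun s₄ h₄ => Runs.block_nil ⟨h₄.1, P, hP, ?_⟩
      have := h₄.2
      rw [← hP.w_eq] at this
      obtain ⟨n', kind, m, r, q, half, ρ', w, β', w''⟩ := P
      obtain ⟨rfl, rfl, rfl, rfl⟩ : n' = n ∧ ρ' = ρ ∧ β' = β ∧ w'' = w' :=
        ⟨hP.n_eq, hP.ρ_eq, hP.β_eq, hP.w'_eq⟩
      exact this

/-! ### Tables of character values -/

/-- The two configurations differ at most in the cells `21, …, 29` and in the real cells `10`,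
`11`. -/
structure Agree (s s₀ : MachineState) : Prop where
  nat : ∀ a, a < 21 ∨ 29 < a → s.nat a = s₀.nat a
  real : ∀ a, a < 10 ∨ 11 < a → s.real a = s₀.real a
  out : s.out = s₀.out

lemma Agree.trans {s s' s'' : MachineState} (h : Agree s'' s') (h' : Agree s' s) : Agree s'' s :=
  ⟨fun a ha => (h.nat a ha).trans (h'.nat a ha), fun a ha => (h.real a ha).trans (h'.real a ha),
    h.out.trans h'.out⟩

lemma Agree.env {P : Config} {s s₀ : MachineState} (h : Agree s s₀) (hE : Env P s₀.nat s₀.real) :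
    Env P s.nat s.real :=
  hE.congr (fun a ha => h.nat a (by omega)) fun a ha => h.real a (by omega)

lemma Agree.table {s s₀ : MachineState} (h : Agree s s₀) {b N : ℕ} {f : ℕ → ℝ} (hb : 12 ≤ b)
    (ht : Table s₀.real b N f) : Table s.real b N f :=
  fun e he => (h.real _ (by omega)).trans (ht e he)

/-- One factor of the product, and the doubling of the exponent modulo `q - 1`. -/
def frobStep : Program := block [.addNat 26 21 22, .addNat 26 26 24, .loadReal 11 26,
  .mulReal 10 10 11, .addNat 24 24 24, .ifNat 24 7 .skip (.subNat 24 24 7), .addNat 25 25 1]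

/-- Multiplies the entries of a table at `o + (2 ^ j * d mod (q - 1))`, where the cells `21`, …,
`24` contain the address of the table, `o`, the number of factors and `d`. -/
def frobProd : Program := block [block [.addReal 10 1 0, .setNat 25 0], .whileNat 25 23 frobStep]

lemma two_mul_mod {x E : ℕ} (hx : x < E) :
    (2 * x) % E = if 2 * x < E then 2 * x else 2 * x - E := by
  split_ifs with h
  · exact Nat.mod_eq_of_lt h
  · rw [Nat.mod_eq_sub_mod (by omega)]
    exact Nat.mod_eq_of_lt (by omega)

lemma frobProd_runs {s : MachineState} {base o k d E M : ℕ} {f : ℕ → ℝ} (hr0 : s.real 0 = 0)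
    (hr1 : s.real 1 = 1) (hn1 : s.nat 1 = 1) (hn7 : s.nat 7 = E) (hd : d < E)
    (h21 : s.nat 21 = base) (h22 : s.nat 22 = o) (h23 : s.nat 23 = k) (h24 : s.nat 24 = d)
    (hb : 12 ≤ base) (hM : o + E ≤ M) (ht : Table s.real base M f) :
    Runs frobProd s (10 * k + 5) fun s' => Agree s' s ∧
      s'.real 10 = ∏ j ∈ Finset.range k, f (o + 2 ^ j * d % E) := by
  let I : ℕ → MachineState → Prop := fun i s' => Agree s' s ∧ s'.nat 21 = base ∧ s'.nat 22 = o ∧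
    s'.nat 23 = k ∧ s'.nat 24 = 2 ^ i * d % E ∧ s'.nat 25 = i ∧
    s'.real 10 = ∏ j ∈ Finset.range i, f (o + 2 ^ j * d % E)
  refine Runs.mono (T := 3 + (k * (9 + 1) + 1 + 1)) (Runs.block_cons (P := I 0)
    (WP.runs_le ?_ (by simp [block, cost])) fun s₁ h₁ => Runs.block_cons
    (Runs.for (I := I) (fun _ _ h => h.2.2.2.2.2.1) (fun _ _ h => h.2.2.2.1) ?_ (Nat.zero_le _) h₁)
    fun s₂ h₂ => Runs.block_nil ⟨h₂.1, h₂.2.2.2.2.2.2⟩) (by omega) fun _ h => h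
  · simp (disch := decide) [block, WP, Function.update_of_ne, I, h21, h22, h23, h24, hr0, hr1,
      Nat.mod_eq_of_lt hd]
    constructor
    · intro a ha
      simp (disch := omega) [Function.update_of_ne]
    · intro a ha
      simp (disch := omega) [Function.update_of_ne]
    · rfl
  · rintro i s' hi ⟨hA, g21, g22, g23, g24, g25, g10⟩
    refine WP.runs_le ?_ (by simp [frobStep, block, cost])
    have hlt : 2 ^ i * d % E < E := Nat.mod_lt _ (by omega)
    have hrd : s'.real (base + o + 2 ^ i * d % E) = f (o + 2 ^ i * d % E) := by
      rw [hA.real _ (by omega), add_assoc]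
      exact ht _ (by omega)
    have hmod : 2 ^ (i + 1) * d % E = if 2 * (2 ^ i * d % E) < E then 2 * (2 ^ i * d % E)
        else 2 * (2 ^ i * d % E) - E := by
      rw [pow_succ', mul_assoc, ← Nat.mul_mod_mod, two_mul_mod hlt]
    have g7 : s'.nat 7 = E := by rw [hA.nat _ (by omega), hn7]
    have g1 : s'.nat 1 = 1 := by rw [hA.nat _ (by omega), hn1]
    simp (disch := decide) [frobStep, block, WP, Function.update_of_ne, I, g21, g22, g23, g24, g25,
      g10, hrd, g7, g1]
    rw [← two_mul, Finset.prod_range_succ, hmod]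
    refine ⟨fun h => ⟨?_, by rw [if_pos h], rfl⟩, fun h => ⟨?_, by rw [if_neg (by omega)], rfl⟩⟩
    all_goals
      constructor
      · intro a ha
        simp (disch := omega) [Function.update_of_ne, hA.nat a ha]
      · intro a ha
        simp (disch := omega) [Function.update_of_ne, hA.real a ha]
      · exact hA.out

/-- Fills the table whose address is in the cell `dst` from the table whose address is in the
cell `src`. The program `pre` prepares the cells `22` and `24` from the counter modulo `q - 1` in
the cell `31`. -/
def fillStep (src dst cnt : ℕ) (pre : Program) : Program := block [pre,
  block [.addNat 21 src 2, .addNat 23 cnt 2], frobProd,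
  block [.addNat 27 dst 30, .storeReal 27 10, .addNat 30 30 1, .addNat 31 31 1,
    .ifNat 31 7 .skip (.setNat 31 0)]]

/-- Fills a table: the entries at the exponents below `4 * q` by `fillStep`, the others by `1`. -/
def fillTable (src dst cnt : ℕ) (pre : Program) : Program := block [
  block [.setNat 30 0, .setNat 31 0], .whileNat 30 9 (fillStep src dst cnt pre),
  .whileNat 30 17 (block [.addNat 27 dst 30, .storeReal 27 1, .addNat 30 30 1])]

/-- The function `g` of exponents modulo `q - 1`, continued by `1` for exponents that stand for
the zero of the field. -/
def ext (q : ℕ) (g : ℕ → ℝ) (e : ℕ) : ℝ := if e < 4 * q then g (e % (q - 1)) else 1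

/-- Invariant of `fillTable`. -/
structure FillInv (P : Config) (b : ℕ) (g : ℕ → ℝ) (s₀ : MachineState) (e : ℕ)
    (s : MachineState) : Prop where
  env : Env P s.nat s.real
  out : s.out = []
  n30 : s.nat 30 = e
  table : Table s.real b e (ext P.q g)
  frame : ∀ a, 64 ≤ a → a < b ∨ b + 17 * P.q ≤ a → s.real a = s₀.real a

lemma fillTable_runs {P : Config} {s : MachineState} {src dst cnt base b k M : ℕ} {pre : Program}
    {f : ℕ → ℝ} {o d : ℕ → ℕ} (hq : 2 ≤ P.q) (hE : Env P s.nat s.real) (hout : s.out = [])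
    (hsrc : ∀ {N R}, Env P N R → N src = base) (hdst : ∀ {N R}, Env P N R → N dst = b)
    (hcnt : ∀ {N R}, Env P N R → N cnt = k) (hcnt' : cnt < 20)
    (hpre : ∀ s' c, c < P.q - 1 → Env P s'.nat s'.real → s'.nat 31 = c →
      Runs pre s' 5 fun s'' => Agree s'' s' ∧ s''.nat 22 = o c ∧ s''.nat 24 = d c)
    (ho : ∀ c < P.q - 1, o c + (P.q - 1) ≤ M) (hd : ∀ c < P.q - 1, d c < P.q - 1)
    (hb : 64 ≤ base) (hbM : base + M ≤ b) (ht : Table s.real base M f) :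
    Runs (fillTable src dst cnt pre) s (P.q * (40 * k + 200) + 10) fun s' =>
      FillInv P b (fun c => ∏ j ∈ Finset.range k, f (o c + 2 ^ j * d c % (P.q - 1))) s
        (17 * P.q) s' := by
  set g : ℕ → ℝ := fun c => ∏ j ∈ Finset.range k, f (o c + 2 ^ j * d c % (P.q - 1)) with hg
  refine Runs.mono (T := 3 + (4 * P.q * (10 * k + 21 + 1) + 1 + (17 * P.q * (4 + 1) + 1 + 1)))
    (Runs.block_cons (P := fun s' => FillInv P b g s 0 s' ∧ s'.nat 31 = 0)
    (WP.runs_le ?_ (by simp [block, cost])) fun s₁ h₁ => Runs.block_cons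
    (Runs.for (I := fun e s' => FillInv P b g s e s' ∧ s'.nat 31 = e % (P.q - 1))
      (fun _ _ h => h.1.n30) (fun _ _ h => h.1.env.n9) ?_ (Nat.zero_le _)
      ⟨h₁.1, by rw [h₁.2, Nat.zero_mod]⟩)
    fun s₂ h₂ => Runs.block_cons (Runs.for (I := fun e s' => 4 * P.q ≤ e ∧ FillInv P b g s e s')
      (fun _ _ h => h.2.n30) (fun _ _ h => h.2.env.n17) ?_
      (by omega : 4 * P.q ≤ 17 * P.q) ⟨le_rfl, h₂.1⟩) fun s₃ h₃ => Runs.block_nil h₃.2) ?_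
    fun _ h => h
  · simp (disch := decide) [block, WP, Function.update_of_ne]
    constructor <;> simp (disch := omega) [Env.update_nat, hE, hout, Function.update_of_ne,
      Table.zero]
  · rintro e s' he ⟨h, h31⟩
    have hc : e % (P.q - 1) < P.q - 1 := Nat.mod_lt _ (by omega)
    have hE' := h.env
    refine Runs.mono (T := 5 + (3 + ((10 * k + 5) + (7 + 1)))) (Runs.block_cons
      (hpre s' _ hc hE' h31) fun s₁ h₁ => Runs.block_cons (P := fun s₂ => Agree s₂ s' ∧
      s₂.nat 22 = o (e % (P.q - 1)) ∧ s₂.nat 24 = d (e % (P.q - 1)) ∧ s₂.nat 21 = base ∧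
      s₂.nat 23 = k) (WP.runs_le ?_ (by simp [block, cost])) fun s₂ h₂ =>
      Runs.block_cons (P := fun s₃ => Agree s₃ s' ∧ s₃.real 10 = g (e % (P.q - 1))) ?_
      fun s₃ h₃ => Runs.block_cons (WP.runs_le ?_ (by simp [block, cost]))
      fun s₄ h₄ => Runs.block_nil h₄) (by omega) fun _ h => h
    · obtain ⟨hA, g22, g24⟩ := h₁
      have hE₁ := hA.env hE'
      simp (disch := omega) [block, WP, Function.update_of_ne, g22, g24, hsrc hE₁, hcnt hE₁,
        hE₁.n2]
      constructor
      · intro a ha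
        simp (disch := omega) [Function.update_of_ne, hA.nat a ha]
      · exact hA.real
      · exact hA.out
    · obtain ⟨hA, g22, g24, g21, g23⟩ := h₂
      have hE₂ := hA.env hE'
      refine (frobProd_runs hE₂.r0 hE₂.r1 hE₂.n1 hE₂.n7 (hd _ hc) g21 g22 g23 g24 (by omega)
        (ho _ hc) (M := M) (f := f) fun a ha => ?_).mono le_rfl
        fun s₃ h₃ => ⟨h₃.1.trans hA, h₃.2⟩
      rw [hA.real _ (by omega), h.frame _ (by omega) (by omega), ht a ha]
    · obtain ⟨hA, g10⟩ := h₃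
      have hE₃ := hA.env hE'
      have g30 : s₃.nat 30 = e := by rw [hA.nat _ (by omega), h.n30]
      have g31 : s₃.nat 31 = e % (P.q - 1) := by rw [hA.nat _ (by omega), h31]
      have hnew : Table (Function.update s₃.real (b + e) (g (e % (P.q - 1)))) b (e + 1)
          (ext P.q g) := (hA.table (by omega) h.table).succ (by rw [ext, if_pos he])
      have hfr : ∀ a, 64 ≤ a → a < b ∨ b + 17 * P.q ≤ a →
          Function.update s₃.real (b + e) (g (e % (P.q - 1))) a = s.real a := fun a ha ha' => by
        rw [Function.update_of_ne (by omega), hA.real _ (by omega), h.frame a ha ha']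
      have hmod : (e + 1) % (P.q - 1) = if e % (P.q - 1) + 1 < P.q - 1 then e % (P.q - 1) + 1
          else 0 := by
        rw [← Nat.mod_add_mod]
        split_ifs with h1
        · exact Nat.mod_eq_of_lt h1
        · rw [show e % (P.q - 1) + 1 = P.q - 1 by omega, Nat.mod_self]
      simp (disch := omega) [block, WP, Function.update_of_ne, hdst hE₃, g30, g31, hE₃.n1, hE₃.n7,
        g10]
      rw [hmod]
      refine ⟨fun h1 => ⟨?_, by rw [if_pos h1]⟩, fun h1 => ⟨?_, by rw [if_neg (by omega)]⟩⟩
      all_goals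
        constructor <;> simp (disch := omega) [Function.update_of_ne, Env.update_nat,
          Env.update_real, hE₃, hA.out, h.out, hnew]
        exact hfr
  · rintro e s' he ⟨h4, h⟩
    refine WP.runs_le ?_ (by simp [block, cost])
    have hE₃ := h.env
    have hnew : Table (Function.update s'.real (b + e) 1) b (e + 1) (ext P.q g) :=
      h.table.succ (by rw [ext, if_neg (by omega)])
    have hfr : ∀ a, 64 ≤ a → a < b ∨ b + 17 * P.q ≤ a →
        Function.update s'.real (b + e) 1 a = s.real a := fun a ha ha' => by
      rw [Function.update_of_ne (by omega), h.frame a ha ha']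
    simp (disch := omega) [block, WP, Function.update_of_ne, hdst hE₃, h.n30, hE₃.n1, hE₃.r1]
    refine ⟨by omega, ?_⟩
    constructor <;> simp (disch := omega) [Function.update_of_ne, Env.update_nat,
      Env.update_real, hE₃, h.out, hnew]
    exact hfr
  · ring_nf
    omega

/-- Computation of the tables of the values of the three functions of the elements of the field
that occur in the arrays, from the values of the additive character. -/
def makeTables : Program := block [
  fillTable 10 11 6 (block [.setNat 22 0, .addNat 24 31 2]),
  fillTable 11 12 16 (block [.addNat 22 31 2, .addNat 24 31 31,
    .ifNat 24 7 .skip (.subNat 24 24 7)]),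
  .setNat 30 0,
  .whileNat 30 17 (block [.addNat 27 11 30, .loadReal 10 27, .addNat 27 12 30, .loadReal 11 27,
    .mulReal 10 10 11, .addNat 27 13 30, .storeReal 27 10, .addNat 30 30 1])]

/-- The values of the composition of the additive character and the trace. -/
def traceTable (q r : ℕ) (S : ℕ → ℝ) : ℕ → ℝ :=
  ext q fun c => ∏ j ∈ Finset.range r, S (2 ^ j * c % (q - 1))

/-- The values of the composition of the additive character and the quadratic form. -/
def quadTable (q r m : ℕ) (S : ℕ → ℝ) : ℕ → ℝ :=
  ext q fun c => ∏ j ∈ Finset.range (m - 1),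
    traceTable q r S (c + 2 ^ j * (2 * c % (q - 1)) % (q - 1))

/-- The three tables are in the real memory. -/
structure HasTables (P : Config) (S : ℕ → ℝ) (R : ℕ → ℝ) : Prop where
  trace : Table R (64 + 2 * P.q) (17 * P.q) (traceTable P.q P.r S)
  quad : Table R (64 + 20 * P.q) (17 * P.q) (quadTable P.q P.r P.m S)
  quadTrace : Table R (64 + 40 * P.q) (17 * P.q)
    fun e => quadTable P.q P.r P.m S e * traceTable P.q P.r S e

theorem makeTables_runs {P : Config} {s : MachineState} {S : ℕ → ℝ} (hq : 3 ≤ P.q)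
    (hE : Env P s.nat s.real) (hout : s.out = []) (hS : Table s.real 64 (P.q - 1) S) :
    Runs makeTables s (P.q * (40 * (P.r + P.m) + 600) + 30) fun s' =>
      Env P s'.nat s'.real ∧ s'.out = [] ∧ HasTables P S s'.real := by
  refine Runs.mono (T := (P.q * (40 * P.r + 200) + 10) + ((P.q * (40 * (P.m - 1) + 200) + 10) +
    (1 + (17 * P.q * (9 + 1) + 1 + 1)))) (Runs.block_cons
    (fillTable_runs (base := 64) (b := 64 + 2 * P.q) (k := P.r) (M := P.q - 1) (f := S)
      (o := fun _ => 0) (d := fun c => c) (by omega) hE hout (fun h => h.n10) (fun h => h.n11)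
      (fun h => h.n6) (by norm_num) ?_ (fun _ _ => by simp) (fun _ h => h) le_rfl (by omega) hS)
    fun s₁ h₁ => Runs.block_cons
    (fillTable_runs (base := 64 + 2 * P.q) (b := 64 + 20 * P.q) (k := P.m - 1) (M := 17 * P.q)
      (f := traceTable P.q P.r S) (o := fun c => c) (d := fun c => 2 * c % (P.q - 1)) (by omega)
      h₁.env h₁.out (fun h => h.n11) (fun h => h.n12) (fun h => h.n16) (by norm_num) ?_
      (fun _ _ => by omega) (fun _ h => Nat.mod_lt _ (by omega)) (by omega) (by omega) ?_)
    fun s₂ h₂ => Runs.block_cons (P := fun s => Env P s.nat s.real ∧ s.out = [] ∧ s.nat 30 = 0 ∧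
      Table s.real (64 + 2 * P.q) (17 * P.q) (traceTable P.q P.r S) ∧
      Table s.real (64 + 20 * P.q) (17 * P.q) (quadTable P.q P.r P.m S))
      (WP.runs_le (T := 1) ?_ (by simp [cost])) fun s₃ h₃ => Runs.block_cons
      (Runs.for (C := 9) (N := 17 * P.q)
        (I := fun e s => Env P s.nat s.real ∧ s.out = [] ∧ s.nat 30 = e ∧
        Table s.real (64 + 2 * P.q) (17 * P.q) (traceTable P.q P.r S) ∧
        Table s.real (64 + 20 * P.q) (17 * P.q) (quadTable P.q P.r P.m S) ∧
        Table s.real (64 + 40 * P.q) e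
          fun e => quadTable P.q P.r P.m S e * traceTable P.q P.r S e)
      (fun _ _ h => h.2.2.1) (fun _ _ h => h.1.n17)
      (fun e s' he h => WP.runs_le ?_ (by simp [block, cost])) (Nat.zero_le _) ?_)
      fun s₄ h₄ => Runs.block_nil ⟨h₄.1, h₄.2.1, h₄.2.2.2.1, h₄.2.2.2.2.1, h₄.2.2.2.2.2⟩) ?_
      fun _ h => h
  · intro s' c hc hE' h31
    refine WP.runs_le ?_ (by simp [block, cost])
    simp (disch := decide) [block, WP, Function.update_of_ne, h31, hE'.n2]
    constructor
    · intro a ha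
      simp (disch := omega) [Function.update_of_ne]
    · exact fun _ _ => rfl
    · rfl
  · intro s' c hc hE' h31
    refine WP.runs_le ?_ (by simp [block, cost])
    simp (disch := decide) [block, WP, Function.update_of_ne, h31, hE'.n2, hE'.n7]
    rw [← two_mul, two_mul_mod hc]
    refine ⟨fun h => ⟨?_, by rw [if_pos h]⟩, fun h => ⟨?_, by rw [if_neg (by omega)]⟩⟩
    all_goals
      constructor
      · intro a ha
        simp (disch := omega) [Function.update_of_ne]
      · exact fun _ _ => rfl
      · rfl
  · simpa only [zero_add, traceTable] using h₁.table
  · simp (disch := decide) [WP, Env.update_nat, h₂.env, h₂.out]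
    refine ⟨fun a ha => ?_, h₂.table⟩
    rw [h₂.frame _ (by omega) (by omega), h₁.table a ha]
    simp only [zero_add, traceTable]
  · obtain ⟨hE', ho, h30, h1, h2, h3⟩ := h
    have e1 : s'.real (64 + 2 * P.q + e) = _ := h1 e he
    have e2 : s'.real (64 + 20 * P.q + e) = _ := h2 e he
    simp (disch := omega) [block, WP, Function.update_of_ne, Env.update_nat, Env.update_real, hE',
      ho, h30, e1, e2, hE'.n11, hE'.n12, hE'.n13, hE'.n1, Table.update, h1, h2]
    exact Table.succ (by simpa (disch := omega) [Table.update] using h3) (mul_comm _ _)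
  · exact ⟨h₃.1, h₃.2.1, h₃.2.2.1, h₃.2.2.2.1, h₃.2.2.2.2, Table.zero⟩
  · have : P.m - 1 ≤ P.m := Nat.sub_le _ _
    nlinarith [Nat.mul_le_mul_left P.q this]

/-! ### Addresses of the entries of the arrays -/

/-- The exponent that stands for the `j`-th element of the field: `j` for the power `α ^ j` of the
primitive element, and `4 * q` for zero, which comes last. -/
def elemExp (q j : ℕ) : ℕ := if j < q - 1 then j else 4 * q

lemma elemExp_le {q j : ℕ} : elemExp q j ≤ 4 * q := by
  unfold elemExp
  split_ifs <;> omega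

/-- Address of the factor that depends on the first index, for the column `p`. -/
def xIndex (P : Config) (p : ℕ) : ℕ :=
  if p < P.q then
    if P.kind < 1 then 64 + 20 * P.q + elemExp P.q p else 64 + 2 * P.q + 3 * elemExp P.q p
  else
    if P.kind < 1 then 64 + 40 * P.q + elemExp P.q (p - P.q)
    else 64 + 2 * P.q + (2 ^ P.m - 1) * (p - P.q)

/-- Address of the factor that depends on the second index, for the column `p`. -/
def yIndex (P : Config) (p : ℕ) : ℕ :=
  64 + 2 * P.q + if p < P.q then elemExp P.q p else
    if P.kind < 1 then elemExp P.q (p - P.q) else 4 * P.q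

/-- The two addresses for the column in the cell `30`. -/
def indexStep : Program := block [
  .ifNat 30 5
    (block [.ifNat 30 7 (.addNat 22 30 2) (.addNat 22 9 2),
      .ifNat 8 1 (.addNat 23 12 22)
        (block [.addNat 23 22 22, .addNat 23 22 23, .addNat 23 11 23]),
      .addNat 24 11 22])
    (block [.subNat 31 30 5, .ifNat 31 7 (.addNat 22 31 2) (.addNat 22 9 2),
      .ifNat 8 1 (block [.addNat 23 13 22, .addNat 24 11 22])
        (block [.addNat 23 11 32, .addNat 24 11 9]),
      .addNat 32 32 18]),
  block [.addNat 25 14 30, .storeNat 25 23, .addNat 25 15 30, .storeNat 25 24, .addNat 30 30 1]]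

/-- The tables of the addresses for all columns. -/
def makeIndices : Program := block [block [.setNat 30 0, .setNat 32 0], .whileNat 30 0 indexStep]

/-- Invariant of `indexStep`. -/
structure IndexInv (P : Config) (s₀ : MachineState) (p : ℕ) (s : MachineState) : Prop where
  env : Env P s.nat s.real
  out : s.out = []
  real : s.real = s₀.real
  n30 : s.nat 30 = p
  n32 : s.nat 32 = (2 ^ P.m - 1) * (p - P.q)
  x : Table s.nat 64 p (xIndex P)
  y : Table s.nat (64 + P.n) p (yIndex P)

lemma indexStep_runs {P : Config} {s₀ s : MachineState} {p : ℕ} (hp : p < P.n)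
    (h : IndexInv P s₀ p s) : Runs indexStep s 20 (IndexInv P s₀ (p + 1)) := by
  have hE := h.env
  refine Runs.mono (T := 12 + (6 + 1)) (Runs.block_cons (P := fun s => Env P s.nat s.real ∧
    s.out = [] ∧ s.real = s₀.real ∧ s.nat 30 = p ∧ s.nat 32 = (2 ^ P.m - 1) * (p + 1 - P.q) ∧
    Table s.nat 64 p (xIndex P) ∧ Table s.nat (64 + P.n) p (yIndex P) ∧ s.nat 23 = xIndex P p ∧
    s.nat 24 = yIndex P p) (WP.runs_le ?_ (by simp [block, cost])) fun s₁ h₁ =>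
    Runs.block_cons (WP.runs_le ?_ (by simp [block, cost])) fun s₂ h₂ => Runs.block_nil h₂)
    (by norm_num) fun _ h => h
  · simp (disch := decide) [block, WP, Function.update_of_ne, hE.n5, hE.n7, h.n30, hE.n8, hE.n1,
      hE.n2, hE.n9, hE.n11, hE.n12, hE.n13, hE.n18, h.n32]
    have hz : p < P.q → p + 1 - P.q = 0 := fun h => by omega
    have hs : ¬ p < P.q → (2 ^ P.m - 1) * (p + 1 - P.q) =
        (2 ^ P.m - 1) * (p - P.q) + (2 ^ P.m - 1) := fun h => by
      rw [show p + 1 - P.q = p - P.q + 1 by omega, mul_add, mul_one]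
    simp (disch := omega) only [Env.update_nat, Table.update, hE, h.x, h.y, h.out, h.real, true_and,
      Function.update_of_ne, Function.update_self, h.n30, h.n32]
    refine ⟨fun h1 => ⟨fun h2 => ⟨fun h3 => ?_, fun h3 => ?_⟩,
      fun h2 => ⟨fun h3 => ?_, fun h3 => ?_⟩⟩,
      fun h1 => ⟨fun h2 => ⟨fun h3 => ?_, fun h3 => ?_⟩, fun h2 => ⟨fun h3 => ?_, fun h3 => ?_⟩⟩⟩
    all_goals
      refine ⟨h.real ▸ hE, ?_, ?_, ?_⟩
      · first
        | exact (hs (by omega)).symm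
        | exact Or.inl (by omega)
      · unfold xIndex elemExp
        split_ifs <;> omega
      · unfold yIndex elemExp
        split_ifs <;> omega
  · obtain ⟨hE, ho, hr, h30, h32, hx, hy, h23, h24⟩ := h₁
    have hE' : Env P s₁.nat s₀.real := hr ▸ hE
    simp (disch := omega) [block, WP, Function.update_of_ne, hE.n14, hE.n15, h30, hE.n1, h23, h24]
    constructor
    case x =>
      exact (Table.update (by omega)).2 ((Table.update (by omega)).2 ((Table.update (by omega)).2
        (Table.succ (by simpa (disch := omega) [Table.update] using hx) rfl)))
    case y =>
      exact (Table.update (by omega)).2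
        (Table.succ (by simpa (disch := omega) [Table.update] using hy) rfl)
    all_goals simp (disch := omega) [Function.update_of_ne, Env.update_nat, hE', ho, hr, h30, h32]

lemma makeIndices_runs {P : Config} {s : MachineState} (hE : Env P s.nat s.real)
    (hout : s.out = []) :
    Runs makeIndices s (21 * P.n + 10) (IndexInv P s P.n) := by
  refine Runs.mono (T := 3 + (P.n * (20 + 1) + 1 + 1)) (Runs.block_cons (P := IndexInv P s 0)
    (WP.runs_le ?_ (by simp [block, cost])) fun s₁ h₁ => Runs.block_cons
    (Runs.for (fun _ _ h => h.n30) (fun _ _ h => h.env.n0)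
      (fun p s hp h => indexStep_runs hp h) (Nat.zero_le _) h₁) fun s₂ h₂ => Runs.block_nil h₂)
    (by omega) fun _ h => h
  simp (disch := decide) [block, WP, Function.update_of_ne]
  constructor <;> simp (disch := omega) [Env.update_nat, hE, hout, Function.update_of_ne,
    Table.zero]

/-! ### Output of the formula -/

/-- The factor that depends on the first index, at the exponent `e`, for the column `p`. -/
def xValue (P : Config) (S : ℕ → ℝ) (e p : ℕ) : ℝ :=
  if p < P.q then
    if P.kind < 1 then quadTable P.q P.r P.m S (e + elemExp P.q p)
    else traceTable P.q P.r S (e + 3 * elemExp P.q p)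
  else
    if P.kind < 1 then quadTable P.q P.r P.m S (e + elemExp P.q (p - P.q)) *
      traceTable P.q P.r S (e + elemExp P.q (p - P.q))
    else traceTable P.q P.r S (e + (2 ^ P.m - 1) * (p - P.q))

/-- The factor that depends on the second index, at the exponent `e`, for the column `p`. -/
def yValue (P : Config) (S : ℕ → ℝ) (e p : ℕ) : ℝ :=
  traceTable P.q P.r S (e + if p < P.q then elemExp P.q p else
    if P.kind < 1 then elemExp P.q (p - P.q) else 4 * P.q)

/-- The output for one point: its coordinates and its weight. -/
def pointOutput (n : ℕ) (x : ℕ → ℝ) (w : ℝ) : List ℝ := (List.range n).map x ++ [w]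

/-- The coordinate `p` of the point of the code with the index `(a, b, σ)`. -/
def codeCoord (P : Config) (S : ℕ → ℝ) (a b : ℕ) (σ : ℝ × ℝ) (p : ℕ) : ℝ :=
  P.ρ * (xValue P S (elemExp P.q a) p * yValue P S (elemExp P.q b) p *
    if p < P.q then σ.1 else σ.2)

/-- The output for the point of the code with the index `(a, b, σ)`. -/
def codeOutput (P : Config) (S : ℕ → ℝ) (a b : ℕ) (σ : ℝ × ℝ) : List ℝ :=
  pointOutput P.n (codeCoord P S a b σ) P.w

/-- The signs that occur in the cases with and without additional columns. -/
def signChoices (kind : ℕ) : List (ℝ × ℝ) :=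
  [(1, 1), (-1, -1)] ++ if kind < 2 then [(1, -1), (-1, 1)] else []

/-- The output for the point on the axis `j` with the coordinate `x`. -/
def axisOutput (P : Config) (x : ℝ) (j : ℕ) : List ℝ :=
  pointOutput P.n (fun p => if p = j then x else 0) P.w'

/-- Output of the coordinate with number in the cell `30`. -/
def coordStep : Program := block [
  block [.addNat 23 14 30, .loadNat 23 23, .addNat 23 23 40, .loadReal 10 23, .addNat 24 15 30,
    .loadNat 24 24, .addNat 24 24 41, .loadReal 11 24],
  block [.mulReal 10 10 11, .ifNat 30 5 (.mulReal 10 10 20) (.mulReal 10 10 21), .mulReal 10 3 10,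
    .output 10, .addNat 30 30 1]]

/-- Output of the point with the exponents in the cells `40`, `41` and with the signs in the real
cells `i`, `j`. -/
def emitCode (i j : ℕ) : Program := block [
  block [.addReal 20 i 0, .addReal 21 j 0, .setNat 30 0], .whileNat 30 0 coordStep, .output 4]

/-- Output of the points that differ only by the signs. -/
def emitSigns : Program := block [emitCode 1 1, emitCode 2 2, .setNat 22 2,
  .ifNat 8 22 (block [emitCode 1 2, emitCode 2 1]) .skip]

/-- The loop over the second index. -/
def emitSecond : Program := block [.setNat 51 0, .whileNat 51 5 (block [
  .ifNat 51 7 (.addNat 41 51 2) (.addNat 41 9 2), emitSigns, .addNat 51 51 1])]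

/-- The loop over the first index. -/
def emitFirst : Program := block [.setNat 50 0, .whileNat 50 5 (block [
  .ifNat 50 7 (.addNat 40 50 2) (.addNat 40 9 2), emitSecond, .addNat 50 50 1])]

/-- Output of the point on the axis with number in the cell `50`, whose coordinate is in the real
cell `20`. -/
def emitAxis : Program := block [.setNat 30 0, .whileNat 30 0 (block [
  .ifNat 30 50 (.output 0) (.ifNat 50 30 (.output 0) (.output 20)), .addNat 30 30 1]), .output 6]

/-- Output of all points on the axes. -/
def emitAxes : Program := block [.setNat 50 0, .whileNat 50 0 (block [.addReal 20 5 0, emitAxis,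
  .subReal 20 0 5, emitAxis, .addNat 50 50 1])]

/-- Everything needed for the output is in memory, and `O` has been written so far. -/
structure EmitInv (P : Config) (S : ℕ → ℝ) (e a d b : ℕ) (O : List ℝ) (s : MachineState) :
    Prop where
  env : Env P s.nat s.real
  tables : HasTables P S s.real
  x : Table s.nat 64 P.n (xIndex P)
  y : Table s.nat (64 + P.n) P.n (yIndex P)
  n40 : s.nat 40 = e
  n50 : s.nat 50 = a
  n41 : s.nat 41 = d
  n51 : s.nat 51 = b
  out : s.out = O

lemma HasTables.update {P : Config} {S : ℕ → ℝ} {R : ℕ → ℝ} {i : ℕ} {v : ℝ} (hi : i < 64) :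
    HasTables P S (Function.update R i v) ↔ HasTables P S R := by
  constructor
  · rintro ⟨h1, h2, h3⟩
    exact ⟨(Table.update (by omega)).1 h1, (Table.update (by omega)).1 h2,
      (Table.update (by omega)).1 h3⟩
  · rintro ⟨h1, h2, h3⟩
    exact ⟨(Table.update (by omega)).2 h1, (Table.update (by omega)).2 h2,
      (Table.update (by omega)).2 h3⟩

lemma HasTables.xValue_eq {P : Config} {S : ℕ → ℝ} {R : ℕ → ℝ} (h : HasTables P S R) {e p : ℕ}
    (he : e ≤ 4 * P.q) (hq : 1 ≤ P.q) (hp : ¬ P.kind < 1 → (2 ^ P.m - 1) * (p - P.q) ≤ P.q) :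
    R (xIndex P p + e) = xValue P S e p := by
  have h1 := @elemExp_le P.q p
  have h2 := @elemExp_le P.q (p - P.q)
  unfold xIndex xValue
  split_ifs with h3 h4 h4
  · rw [← h.quad _ (by omega)]; congr 1; ring
  · rw [← h.trace _ (by omega)]; congr 1; ring
  · have := h.quadTrace (e + elemExp P.q (p - P.q)) (by omega)
    simp only [← this]; congr 1; ring
  · have := hp h4
    rw [← h.trace _ (by omega)]; congr 1; ring

lemma HasTables.yValue_eq {P : Config} {S : ℕ → ℝ} {R : ℕ → ℝ} (h : HasTables P S R) {e p : ℕ}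
    (he : e ≤ 4 * P.q) (hq : 1 ≤ P.q) :
    R (yIndex P p + e) = yValue P S e p := by
  have h1 := @elemExp_le P.q p
  have h2 := @elemExp_le P.q (p - P.q)
  unfold yIndex yValue
  rw [← h.trace _ (by split_ifs <;> omega)]
  congr 1
  ring

lemma pointOutput_succ (n : ℕ) (x : ℕ → ℝ) :
    (List.range (n + 1)).map x = (List.range n).map x ++ [x n] := by
  rw [List.range_succ, List.map_append, List.map_singleton]

lemma flatMap_range_succ (n : ℕ) (x : ℕ → List ℝ) :
    (List.range (n + 1)).flatMap x = (List.range n).flatMap x ++ x n := by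
  rw [List.range_succ, List.flatMap_append, List.flatMap_singleton]

lemma coordStep_runs {P : Config} {S : ℕ → ℝ} {e a d b p : ℕ} {O : List ℝ} {σ : ℝ × ℝ}
    {s : MachineState} (he : e ≤ 4 * P.q) (hd : d ≤ 4 * P.q) (hq : 1 ≤ P.q) (hp : p < P.n)
    (hc : ¬ P.kind < 1 → (2 ^ P.m - 1) * (p - P.q) ≤ P.q)
    (h : EmitInv P S e a d b O s) (h30 : s.nat 30 = p) (h20 : s.real 20 = σ.1)
    (h21 : s.real 21 = σ.2) : Runs coordStep s 20 fun s' =>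
      EmitInv P S e a d b (O ++ [P.ρ * (xValue P S e p * yValue P S d p *
        if p < P.q then σ.1 else σ.2)]) s' ∧
      s'.nat 30 = p + 1 ∧ s'.real 20 = σ.1 ∧ s'.real 21 = σ.2 := by
  have hE := h.env
  have hx := h.x p hp
  have hy := h.y p hp
  have hx' := h.tables.xValue_eq he hq hc
  have hy' := h.tables.yValue_eq (p := p) hd hq
  have hy64 : 64 ≤ yIndex P p := by unfold yIndex; omega
  refine Runs.mono (T := 9 + (7 + 1)) (Runs.block_cons (P := fun s => EmitInv P S e a d b O s ∧
    s.nat 30 = p ∧ s.real 20 = σ.1 ∧ s.real 21 = σ.2 ∧ s.real 10 = xValue P S e p ∧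
    s.real 11 = yValue P S d p) (WP.runs_le ?_ (by simp [block, cost])) fun s₁ h₁ =>
    Runs.block_cons (WP.runs_le ?_ (by simp [block, cost])) fun s₂ h₂ => Runs.block_nil h₂)
    (by norm_num) fun _ h => h
  · simp (disch := omega) [block, WP, Function.update_of_ne, hE.n14, hE.n15, h30, h.n40, h.n41,
      hx, hy, hx', hy', h20, h21]
    constructor <;> simp (disch := omega) [Env.update_nat, Env.update_real, Table.update,
      HasTables.update, hE, h.tables, h.x, h.y, h.n40, h.n41, h.n50, h.n51, h.out,
      Function.update_of_ne]
  · clear h h20 h21 hE hx hy hx' hy' h30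
    obtain ⟨h, h30, h20, h21, h10, h11⟩ := h₁
    have hE := h.env
    simp (disch := decide) [block, WP, Function.update_of_ne, h30, h20, h21, h10, h11, hE.n5,
      hE.r3, hE.n1]
    refine ⟨fun h1 => ?_, fun h1 => ?_⟩
    all_goals
      constructor <;> simp (disch := omega) [Env.update_nat, Env.update_real, Table.update,
        HasTables.update, hE, h.tables, h.x, h.y, h.n40, h.n41, h.n50, h.n51, h.out,
        Function.update_of_ne, h1]
    intro h2
    omega

lemma emitCode_runs {P : Config} {S : ℕ → ℝ} {e a d b i j : ℕ} {O : List ℝ} {σ : ℝ × ℝ}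
    {s : MachineState} (he : e ≤ 4 * P.q) (hd : d ≤ 4 * P.q) (hq : 1 ≤ P.q)
    (hc : ∀ p < P.n, ¬ P.kind < 1 → (2 ^ P.m - 1) * (p - P.q) ≤ P.q)
    (h : EmitInv P S e a d b O s) (hi : s.real i = σ.1) (hj : s.real j = σ.2) (hj' : j < 10) :
    Runs (emitCode i j) s (21 * P.n + 10) (EmitInv P S e a d b (O ++ pointOutput P.n (fun p =>
      P.ρ * (xValue P S e p * yValue P S d p * if p < P.q then σ.1 else σ.2)) P.w)) := by
  have hE := h.env
  refine Runs.mono (T := 4 + (P.n * (20 + 1) + 1 + (1 + 1))) (Runs.block_cons (P := fun s =>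
    EmitInv P S e a d b (O ++ (List.range 0).map fun p => P.ρ * (xValue P S e p * yValue P S d p *
      if p < P.q then σ.1 else σ.2)) s ∧ s.nat 30 = 0 ∧ s.real 20 = σ.1 ∧ s.real 21 = σ.2)
    (WP.runs_le ?_ (by simp [block, cost])) fun s₁ h₁ => Runs.block_cons (Runs.for (I := fun p s =>
    EmitInv P S e a d b (O ++ (List.range p).map fun p => P.ρ * (xValue P S e p * yValue P S d p *
      if p < P.q then σ.1 else σ.2)) s ∧ s.nat 30 = p ∧ s.real 20 = σ.1 ∧ s.real 21 = σ.2)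
      (fun _ _ h => h.2.1) (fun _ _ h => h.1.env.n0) (fun p s' hp h' => ?_) (Nat.zero_le _) h₁)
    fun s₂ h₂ => Runs.block_cons (WP.runs_le ?_ (by simp [cost])) fun s₃ h₃ =>
      Runs.block_nil h₃) (by omega) fun _ h => h
  · simp (disch := omega) [block, WP, Function.update_of_ne, hi, hj, hE.r0]
    constructor <;> simp (disch := omega) [Env.update_nat, Env.update_real, Table.update,
      HasTables.update, hE, h.tables, h.x, h.y, h.n40, h.n41, h.n50, h.n51, h.out,
      Function.update_of_ne]
  · rw [pointOutput_succ, ← List.append_assoc]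
    exact coordStep_runs he hd hq hp (hc p hp) h'.1 h'.2.1 h'.2.2.1 h'.2.2.2
  · obtain ⟨h, -⟩ := h₂
    refine ⟨h.env, h.tables, h.x, h.y, h.n40, h.n50, h.n41, h.n51, ?_⟩
    change s₂.out ++ [s₂.real 4] = _
    rw [h.out, h.env.r4, pointOutput, List.append_assoc]

lemma emitSigns_runs {P : Config} {S : ℕ → ℝ} {a b : ℕ} {O : List ℝ} {s : MachineState}
    (hq : 1 ≤ P.q) (hc : ∀ p < P.n, ¬ P.kind < 1 → (2 ^ P.m - 1) * (p - P.q) ≤ P.q)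
    (h : EmitInv P S (elemExp P.q a) a (elemExp P.q b) b O s) :
    Runs emitSigns s (84 * P.n + 60) (EmitInv P S (elemExp P.q a) a (elemExp P.q b) b
      (O ++ (signChoices P.kind).flatMap (codeOutput P S a b))) := by
  refine Runs.mono (T := (21 * P.n + 10) + ((21 * P.n + 10) + (1 + (((21 * P.n + 10) +
    ((21 * P.n + 10) + 1) + 1) + 1)))) (Runs.block_cons
    (emitCode_runs (σ := (1, 1)) elemExp_le elemExp_le hq hc h h.env.r1 h.env.r1 (by norm_num))
    fun s₁ h₁ => Runs.block_cons
    (emitCode_runs (σ := (-1, -1)) elemExp_le elemExp_le hq hc h₁ h₁.env.r2 h₁.env.r2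
      (by norm_num))
    fun s₂ h₂ => Runs.block_cons (P := fun s => EmitInv P S (elemExp P.q a) a (elemExp P.q b) b
      (O ++ [(1, 1), (-1, -1)].flatMap (codeOutput P S a b)) s ∧ s.nat 22 = 2)
      (WP.runs_le ?_ (by simp [cost])) fun s₃ h₃ => Runs.block_cons
      (Runs.ifNat (fun hg => ?_) (fun hg => ?_)) fun s₄ h₄ => Runs.block_nil h₄) (by omega)
    fun _ h => h
  · refine ⟨?_, rfl⟩
    constructor
    case out =>
      change s₂.out = _
      rw [h₂.out]
      simp only [List.flatMap_cons, List.flatMap_nil, List.append_nil, List.append_assoc]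
      rfl
    all_goals simp (disch := omega) [Env.update_nat, Table.update, h₂.env, h₂.tables, h₂.x,
      h₂.y, h₂.n40, h₂.n41, h₂.n50, h₂.n51, Function.update_of_ne]
  · rw [h₃.2, h₃.1.env.n8] at hg
    refine Runs.block_cons (emitCode_runs (σ := (1, -1)) elemExp_le elemExp_le hq hc h₃.1
      h₃.1.env.r1 h₃.1.env.r2 (by norm_num))
      fun s₅ h₅ => Runs.block_cons (emitCode_runs (σ := (-1, 1)) elemExp_le elemExp_le hq hc h₅
      h₅.env.r2 h₅.env.r1 (by norm_num)) fun s₆ h₆ => Runs.block_nil ?_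
    rw [signChoices, if_pos hg, List.flatMap_append, ← List.append_assoc]
    simp only [List.flatMap_cons, List.flatMap_nil, List.append_nil, ← List.append_assoc,
      codeOutput] at h₆ ⊢
    exact h₆
  · rw [h₃.2, h₃.1.env.n8] at hg
    rw [signChoices, if_neg hg, List.append_nil]
    exact (WP.runs (p := .skip) (s := s₃) h₃.1).mono (by simp only [cost]; omega) fun _ h => h

/-- All points of the code with the first index `a`. -/
def firstOutput (P : Config) (S : ℕ → ℝ) (a : ℕ) : List ℝ :=
  (List.range P.q).flatMap fun b => (signChoices P.kind).flatMap (codeOutput P S a b)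

lemma emitSecond_runs {P : Config} {S : ℕ → ℝ} {a d b : ℕ} {O : List ℝ} {s : MachineState}
    (hq : 1 ≤ P.q) (hc : ∀ p < P.n, ¬ P.kind < 1 → (2 ^ P.m - 1) * (p - P.q) ≤ P.q)
    (h : EmitInv P S (elemExp P.q a) a d b O s) :
    Runs emitSecond s (P.q * (84 * P.n + 70) + 5) fun s' => ∃ d' b',
      EmitInv P S (elemExp P.q a) a d' b' (O ++ firstOutput P S a) s' := by
  refine Runs.mono (T := 1 + (P.q * ((2 + (84 * P.n + 60 + (1 + 1))) + 1) + 1 + 1))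
    (Runs.block_cons (P := EmitInv P S (elemExp P.q a) a d 0 O) (WP.runs_le ?_ (by simp [cost]))
    fun s₁ h₁ => Runs.block_cons (Runs.for (I := fun t s => ∃ d', EmitInv P S (elemExp P.q a) a d' t
      (O ++ (List.range t).flatMap fun b => (signChoices P.kind).flatMap (codeOutput P S a b)) s)
      (fun _ _ h => h.choose_spec.n51) (fun _ _ h => h.choose_spec.env.n5)
      (fun t s' ht h' => ?_) (Nat.zero_le _) ⟨d, by simpa using h₁⟩) fun s₂ h₂ =>
      Runs.block_nil ⟨_, _, h₂.choose_spec⟩) ?_ fun _ h => h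
  · constructor <;> simp (disch := omega) [Env.update_nat, Table.update, h.env, h.tables, h.x,
      h.y, h.n40, h.n41, h.n50, h.n51, h.out, Function.update_of_ne]
  · obtain ⟨d', h⟩ := h'
    have hE := h.env
    refine Runs.block_cons (P := EmitInv P S (elemExp P.q a) a (elemExp P.q t) t
      (O ++ (List.range t).flatMap fun b => (signChoices P.kind).flatMap (codeOutput P S a b)))
      (WP.runs_le ?_ (by simp [cost])) fun s₁ h₁ => Runs.block_cons (emitSigns_runs hq hc h₁)
      fun s₂ h₂ => Runs.block_cons (WP.runs_le ?_ (by simp [cost])) fun s₃ h₃ => Runs.block_nil h₃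
    · simp (disch := omega) [WP, h.n51, hE.n7, hE.n2, hE.n9, Function.update_of_ne]
      refine ⟨fun h1 => ?_, fun h1 => ?_⟩
      all_goals
        constructor <;> simp (disch := omega) [Env.update_nat, Table.update, h.env, h.tables, h.x,
          h.y, h.n40, h.n41, h.n50, h.n51, h.out, Function.update_of_ne, elemExp, h1]
      omega
    · rw [flatMap_range_succ, ← List.append_assoc]
      refine ⟨elemExp P.q t, ?_⟩
      constructor <;> simp (disch := omega) [Env.update_nat, Table.update, h₂.env, h₂.tables,
        h₂.x, h₂.y, h₂.n40, h₂.n41, h₂.n50, h₂.n51, h₂.out, Function.update_of_ne, h₂.env.n1]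
  · ring_nf
    omega

lemma emitFirst_runs {P : Config} {S : ℕ → ℝ} {e a d b : ℕ} {O : List ℝ} {s : MachineState}
    (hq : 1 ≤ P.q) (hc : ∀ p < P.n, ¬ P.kind < 1 → (2 ^ P.m - 1) * (p - P.q) ≤ P.q)
    (h : EmitInv P S e a d b O s) :
    Runs emitFirst s (P.q * (P.q * (84 * P.n + 70) + 10) + 5) fun s' => ∃ e' a' d' b',
      EmitInv P S e' a' d' b' (O ++ (List.range P.q).flatMap (firstOutput P S)) s' := by
  refine Runs.mono (T := 1 + (P.q * ((2 + (P.q * (84 * P.n + 70) + 5 + (1 + 1))) + 1) + 1 + 1))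
    (Runs.block_cons (P := EmitInv P S e 0 d b O) (WP.runs_le ?_ (by simp [cost]))
    fun s₁ h₁ => Runs.block_cons (Runs.for (I := fun t s => ∃ e' d' b', EmitInv P S e' t d' b'
      (O ++ (List.range t).flatMap (firstOutput P S)) s)
      (fun _ _ h => h.choose_spec.choose_spec.choose_spec.n50)
      (fun _ _ h => h.choose_spec.choose_spec.choose_spec.env.n5)
      (fun t s' ht h' => ?_) (Nat.zero_le _) ⟨e, d, b, by simpa using h₁⟩) fun s₂ h₂ =>
      Runs.block_nil ⟨_, _, _, _, h₂.choose_spec.choose_spec.choose_spec⟩) ?_ fun _ h => h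
  · constructor <;> simp (disch := omega) [Env.update_nat, Table.update, h.env, h.tables, h.x,
      h.y, h.n40, h.n41, h.n50, h.n51, h.out, Function.update_of_ne]
  · obtain ⟨e', d', b', h⟩ := h'
    have hE := h.env
    refine Runs.block_cons (P := EmitInv P S (elemExp P.q t) t d' b'
      (O ++ (List.range t).flatMap (firstOutput P S)))
      (WP.runs_le ?_ (by simp [cost])) fun s₁ h₁ => Runs.block_cons (emitSecond_runs hq hc h₁)
      fun s₂ h₂ => Runs.block_cons (WP.runs_le ?_ (by simp [cost])) fun s₃ h₃ => Runs.block_nil h₃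
    · simp (disch := omega) [WP, h.n50, hE.n7, hE.n2, hE.n9, Function.update_of_ne]
      refine ⟨fun h1 => ?_, fun h1 => ?_⟩
      all_goals
        constructor <;> simp (disch := omega) [Env.update_nat, Table.update, h.env, h.tables, h.x,
          h.y, h.n40, h.n41, h.n50, h.n51, h.out, Function.update_of_ne, elemExp, h1]
      omega
    · obtain ⟨d'', b'', h₂⟩ := h₂
      rw [flatMap_range_succ, ← List.append_assoc]
      refine ⟨elemExp P.q t, d'', b'', ?_⟩
      constructor <;> simp (disch := omega) [Env.update_nat, Table.update, h₂.env, h₂.tables,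
        h₂.x, h₂.y, h₂.n40, h₂.n41, h₂.n50, h₂.n51, h₂.out, Function.update_of_ne, h₂.env.n1]
  · ring_nf
    omega

/-- Invariant of the output of the points on the axes. -/
structure AxisInv (P : Config) (j : ℕ) (O : List ℝ) (s : MachineState) : Prop where
  env : Env P s.nat s.real
  n50 : s.nat 50 = j
  out : s.out = O

lemma emitAxis_runs {P : Config} {j : ℕ} {x : ℝ} {O : List ℝ} {s : MachineState}
    (h : AxisInv P j O s) (h20 : s.real 20 = x) :
    Runs emitAxis s (6 * P.n + 5) (AxisInv P j (O ++ axisOutput P x j)) := by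
  refine Runs.mono (T := 1 + (P.n * (5 + 1) + 1 + (1 + 1))) (Runs.block_cons
    (P := fun s => AxisInv P j O s ∧ s.real 20 = x ∧ s.nat 30 = 0) (WP.runs_le ?_ (by simp [cost]))
    fun s₁ h₁ => Runs.block_cons (Runs.for (C := 5) (I := fun p s => AxisInv P j
      (O ++ (List.range p).map fun p => if p = j then x else 0) s ∧ s.real 20 = x ∧ s.nat 30 = p)
      (fun _ _ h => h.2.2) (fun _ _ h => h.1.env.n0)
      (fun t s' ht h' => WP.runs_le ?_ (by simp [block, cost])) (Nat.zero_le _)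
      (by simpa using h₁)) fun s₂ h₂ =>
      Runs.block_cons (WP.runs_le ?_ (by simp [cost])) fun s₃ h₃ => Runs.block_nil h₃) (by omega)
      fun _ h => h
  · simp (disch := omega) [WP, Function.update_of_ne, h20]
    constructor <;> simp (disch := omega) [Env.update_nat, h.env, h.n50, h.out,
      Function.update_of_ne]
  · obtain ⟨h, h20, h30⟩ := h'
    rw [pointOutput_succ, ← List.append_assoc]
    have hE := h.env
    simp (disch := omega) [block, WP, Function.update_of_ne, h20, h30, h.n50, hE.r0, hE.n1, h.out]
    refine ⟨fun h1 => ?_, fun h1 => ⟨fun h2 => ?_, fun h2 => ?_⟩⟩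
    · rw [if_neg (by omega)]
      constructor <;> simp (disch := omega) [Env.update_nat, h.env, h.n50, Function.update_of_ne]
    · rw [if_neg (by omega)]
      constructor <;> simp (disch := omega) [Env.update_nat, h.env, h.n50, Function.update_of_ne]
    · rw [if_pos (by omega)]
      constructor <;> simp (disch := omega) [Env.update_nat, h.env, h.n50, Function.update_of_ne]
  · obtain ⟨h, -⟩ := h₂
    refine ⟨h.env, h.n50, ?_⟩
    change s₂.out ++ [s₂.real 6] = _
    rw [h.out, h.env.r6, axisOutput, pointOutput, List.append_assoc]

lemma emitAxes_runs {P : Config} {j : ℕ} {O : List ℝ} {s : MachineState} (h : AxisInv P j O s) :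
    Runs emitAxes s (P.n * (12 * P.n + 20) + 5) fun s' =>
      s'.out = O ++ (List.range P.n).flatMap fun j =>
        axisOutput P P.β j ++ axisOutput P (-P.β) j := by
  refine Runs.mono (T := 1 + (P.n * ((1 + ((6 * P.n + 5) + (1 + ((6 * P.n + 5) + (1 + 1))))) + 1) +
    1 + 1)) (Runs.block_cons (P := AxisInv P 0 O) (WP.runs_le ?_ (by simp [cost])) fun s₁ h₁ =>
    Runs.block_cons (Runs.for (I := fun t s => AxisInv P t (O ++ (List.range t).flatMap fun j =>
        axisOutput P P.β j ++ axisOutput P (-P.β) j) s)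
      (fun _ _ h => h.n50) (fun _ _ h => h.env.n0) (fun t s' ht h => ?_) (Nat.zero_le _)
      (by simpa using h₁)) fun s₂ h₂ => Runs.block_nil h₂.out) ?_ fun _ h => h
  · constructor <;> simp (disch := omega) [Env.update_nat, h.env, h.out, Function.update_of_ne]
  · have hE := h.env
    refine Runs.block_cons (P := fun s => AxisInv P t (O ++ (List.range t).flatMap fun j =>
        axisOutput P P.β j ++ axisOutput P (-P.β) j) s ∧ s.real 20 = P.β)
      (WP.runs_le ?_ (by simp [cost])) fun s₁ h₁ => Runs.block_cons (emitAxis_runs h₁.1 h₁.2)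
      fun s₂ h₂ => Runs.block_cons (P := fun s => AxisInv P t ((O ++ (List.range t).flatMap fun j =>
        axisOutput P P.β j ++ axisOutput P (-P.β) j) ++ axisOutput P P.β t) s ∧ s.real 20 = -P.β)
      (WP.runs_le ?_ (by simp [cost])) fun s₃ h₃ => Runs.block_cons (emitAxis_runs h₃.1 h₃.2)
      fun s₄ h₄ => Runs.block_cons (WP.runs_le ?_ (by simp [cost])) fun s₅ h₅ => Runs.block_nil h₅
    · simp [WP, hE.r5, hE.r0]
      constructor <;> simp (disch := omega) [Env.update_real, h.env, h.n50, h.out]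
    · simp [WP, h₂.env.r5, h₂.env.r0]
      constructor <;> simp (disch := omega) [Env.update_real, h₂.env, h₂.n50, h₂.out]
    · rw [flatMap_range_succ, ← List.append_assoc, ← List.append_assoc]
      constructor <;> simp (disch := omega) [Env.update_nat, h₄.env, h₄.n50, h₄.out, h₄.env.n1]
  · ring_nf
    omega

/-- The points of the code followed by those on the axes. -/
def formulaOutput (P : Config) (S : ℕ → ℝ) : List ℝ :=
  (List.range P.q).flatMap (firstOutput P S) ++
    (List.range P.n).flatMap fun j => axisOutput P P.β j ++ axisOutput P (-P.β) j

/-- The program, given a program for the parameters that depend on the measure. -/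
def formulaProgram (parameters : Program) : Program := block [
  setup parameters, tapSearch, makeTables, makeIndices, emitFirst, emitAxes]

lemma Config.Valid.two_le_r {P : Config} {n : ℕ} {ρ A β w' : ℝ} (h : P.Valid n ρ A β w')
    (hn : 6 ≤ n) : 2 ≤ P.r := by
  have := h.one_le_m
  rcases h.cases with ⟨-, hr, hn'⟩ | ⟨-, hr, -⟩ | ⟨-, hr, -⟩
  · have : P.m ≠ 1 := by
      intro h1
      rw [h1] at hn'
      omega
    omega
  · omega
  · omega

lemma Config.Valid.m_le_r {P : Config} {n : ℕ} {ρ A β w' : ℝ} (h : P.Valid n ρ A β w') :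
    P.m ≤ P.r := by
  have := h.one_le_m
  rcases h.cases with ⟨-, hr, hn'⟩ | ⟨-, hr, -⟩ | ⟨-, hr, -⟩ <;> omega

lemma Config.Valid.q_lt {P : Config} {n : ℕ} {ρ A β w' : ℝ} (h : P.Valid n ρ A β w') :
    P.q < 2 * n := by
  have h0 := h.lt_n
  have h1 := h.one_le_m
  rcases h.cases with ⟨-, hr, -⟩ | ⟨-, hr, h2, -⟩ | ⟨-, hr, h2, -⟩ <;> rw [h.q_eq, hr]
  · omega
  · omega
  · have := Nat.two_pow_pos P.m
    rw [pow_succ']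
    omega

lemma Config.Valid.cycle {P : Config} {n : ℕ} {ρ A β w' : ℝ} (h : P.Valid n ρ A β w')
    (hk : ¬ P.kind < 1) {p : ℕ} (hp : p < n) : (2 ^ P.m - 1) * (p - P.q) ≤ P.q := by
  rcases h.cases with ⟨hk', -⟩ | ⟨-, hr, -, h3⟩ | ⟨-, hr, -, h3⟩
  · omega
  · have h4 : p - P.q ≤ 2 ^ P.m := by
      rw [h.q_eq, hr]
      have := Nat.two_pow_pos P.m
      omega
    calc _ ≤ 2 ^ P.m * 2 ^ P.m := Nat.mul_le_mul (Nat.sub_le _ _) h4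
      _ = P.q := by rw [h.q_eq, hr, ← pow_add, two_mul]
  · have h4 : p - P.q = 0 := by rw [h.q_eq, hr]; omega
    rw [h4, mul_zero]
    exact Nat.zero_le _

theorem formulaProgram_runs {p : Program} {n T : ℕ} {ρ A β w' : ℝ} (hn : 6 ≤ n)
    (hp : ComputesParameters p n T ρ A β w') :
    Runs (formulaProgram p) (startState n) (T + 700 * n ^ 3) fun s =>
      ∃ (P : Config) (S : ℕ → ℝ), P.Valid n ρ A β w' ∧ IsFieldSequence P.r S ∧
        s.out = formulaOutput P S := by
  obtain ⟨t, s₁, hexec, ht, hout, P, hP, hE⟩ := setup_runs hn hp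
  have hr := hP.two_le_r hn
  have hm := hP.m_le_r
  have hq := hP.q_lt
  have hrq : P.r < P.q := by rw [hP.q_eq]; exact Nat.lt_two_pow_self
  refine Runs.mono (T := (T + 8 * n + 80) + ((P.q * (P.q * (16 * P.r + 16) + 7) + 5 * P.r + 20) +
    ((P.q * (40 * (P.r + P.m) + 600) + 30) + ((21 * P.n + 10) +
    ((P.q * (P.q * (84 * P.n + 70) + 10) + 5) + ((P.n * (12 * P.n + 20) + 5) + 1))))))
    (Runs.block_cons (P := fun s => s = s₁) ⟨t, s₁, hexec, ht, rfl⟩ fun s h₁ => Runs.block_cons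
    (tapSearch_runs hP.q_eq hr hP.half_eq (h₁ ▸ hE) (h₁ ▸ hout)) fun s₂ h₂ => ?_) ?_ fun _ h => h
  · obtain ⟨hE₂, ho₂, S, hS, hT⟩ := h₂
    refine Runs.block_cons (makeTables_runs (by omega) hE₂ ho₂ hT) fun s₃ h₃ => Runs.block_cons
      (makeIndices_runs h₃.1 h₃.2.1) fun s₄ h₄ => Runs.block_cons
      (emitFirst_runs (P := P) (S := S) (e := s₄.nat 40) (a := s₄.nat 50) (d := s₄.nat 41)
        (b := s₄.nat 51) (O := []) (by omega) ?_ ?_) fun s₅ h₅ => ?_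
    · exact fun p hp h => hP.cycle h (by rwa [← hP.n_eq])
    · exact ⟨h₄.env, h₄.real ▸ h₃.2.2, h₄.x, h₄.y, rfl, rfl, rfl, rfl, h₄.out⟩
    · obtain ⟨e, a, d, b, h₅⟩ := h₅
      exact Runs.block_cons (emitAxes_runs ⟨h₅.env, h₅.n50, h₅.out⟩) fun s₆ h₆ =>
        Runs.block_nil ⟨P, S, hP, hS, h₆⟩
  · have h1 : P.q ≤ 2 * n := hq.le
    have h2 : P.r ≤ 2 * n := by omega
    have h3 : P.m ≤ 2 * n := by omega
    rw [hP.n_eq]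
    calc _ ≤ (T + 8 * n + 80) + ((2 * n * (2 * n * (16 * (2 * n) + 16) + 7) + 5 * (2 * n) + 20) +
        ((2 * n * (40 * (2 * n + 2 * n) + 600) + 30) + ((21 * n + 10) +
        ((2 * n * (2 * n * (84 * n + 70) + 10) + 5) + ((n * (12 * n + 20) + 5) + 1))))) := by
          gcongr
      _ ≤ T + 700 * n ^ 3 := by
        obtain ⟨k, rfl⟩ := Nat.exists_eq_add_of_le hn
        nlinarith [Nat.zero_le k, Nat.zero_le (k ^ 2), Nat.zero_le (k ^ 3)]

/-! ### Meaning of the tables -/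

section Meaning

variable {F : Type} [Field F] [Fintype F] [CharP F 2]

/-- The `j`-th element of the field: the powers of `α`, and zero at the end. -/
def elem (q : ℕ) (α : F) (j : ℕ) : F := if j < q - 1 then α ^ j else 0

/-- The exponent `e` stands for the element `x` of the field. -/
def IsExp (q : ℕ) (α : F) (e : ℕ) (x : F) : Prop := (e < 4 * q ∧ x = α ^ e) ∨ (4 * q ≤ e ∧ x = 0)

omit [Fintype F] [CharP F 2] in
lemma isExp_elem {q : ℕ} {α : F} (j : ℕ) : IsExp q α (elemExp q j) (elem q α j) := by
  unfold elemExp elem IsExp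
  split_ifs with h
  · exact Or.inl ⟨by omega, rfl⟩
  · exact Or.inr ⟨le_rfl, rfl⟩

omit [Fintype F] [CharP F 2] in
lemma IsExp.mul {q : ℕ} {α x y : F} {e d : ℕ} (hx : IsExp q α e x) (hy : IsExp q α d y)
    (h : e < 4 * q → d < 4 * q → e + d < 4 * q) : IsExp q α (e + d) (x * y) := by
  rcases hx with ⟨h1, rfl⟩ | ⟨h1, rfl⟩ <;> rcases hy with ⟨h2, rfl⟩ | ⟨h2, rfl⟩
  · exact Or.inl ⟨h h1 h2, (pow_add _ _ _).symm⟩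
  · exact Or.inr ⟨by omega, mul_zero _⟩
  · exact Or.inr ⟨by omega, zero_mul _⟩
  · exact Or.inr ⟨by omega, zero_mul _⟩

lemma elemExp_lt {q j : ℕ} (h : elemExp q j < 4 * q) : elemExp q j < q - 1 := by
  unfold elemExp at *
  split_ifs at * <;> omega

variable {q r : ℕ} {α : F} {ψ : AddChar F ℝ} {S : ℕ → ℝ}

omit [Fintype F] in
lemma traceTable_eq (hq : 2 ≤ q) (hα : orderOf α = q - 1)
    (hS : ∀ t < q - 1, S t = ψ (α ^ t)) {e : ℕ}
    {x : F} (hx : IsExp q α e x) : traceTable q r S e = traceChar r ψ x := by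
  have hmod : ∀ t, α ^ (t % (q - 1)) = α ^ t := fun t => by rw [← hα, pow_mod_orderOf]
  rcases hx with ⟨h, rfl⟩ | ⟨h, rfl⟩
  · rw [traceTable, ext, if_pos h, traceChar_apply, trace2, addChar_map_sum]
    refine Finset.prod_congr rfl fun j _ => ?_
    rw [hS _ (Nat.mod_lt _ (by omega)), hmod, mul_comm, pow_mul, hmod]
  · rw [traceTable, ext, if_neg (by omega), AddChar.map_zero_eq_one]

omit [Fintype F] in
lemma quadTable_eq (hq : 2 ≤ q) (hα : orderOf α = q - 1) (hS : ∀ t < q - 1, S t = ψ (α ^ t))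
    {e m : ℕ} {x : F} (hx : IsExp q α e x) :
    quadTable q r m S e = quadChar r (m - 1) ψ x := by
  have hmod : ∀ t, α ^ (t % (q - 1)) = α ^ t := fun t => by rw [← hα, pow_mod_orderOf]
  rcases hx with ⟨h, rfl⟩ | ⟨h, rfl⟩
  · rw [quadTable, ext, if_pos h, quadChar]
    refine Finset.prod_congr rfl fun j _ => ?_
    have h1 : e % (q - 1) < q - 1 := Nat.mod_lt _ (by omega)
    have h2 : 2 ^ j * (2 * (e % (q - 1)) % (q - 1)) % (q - 1) < q - 1 := Nat.mod_lt _ (by omega)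
    refine traceTable_eq hq hα hS (Or.inl ⟨by omega, ?_⟩)
    rw [pow_add α, hmod, hmod, mul_comm (2 ^ j), pow_mul _ _ (2 ^ j), hmod, mul_comm 2,
      pow_mul _ _ 2, hmod, ← pow_mul, ← pow_mul, ← pow_mul, ← pow_add]
    congr 1
    ring
  · rw [quadTable, ext, if_neg (by omega), quadChar_zero]

omit [Fintype F] [CharP F 2] in
lemma elem_injOn (hα : orderOf α = q - 1) (h0 : α ≠ 0) {i j : ℕ} (hi : i < q) (hj : j < q)
    (h : elem q α i = elem q α j) : i = j := by
  unfold elem at h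
  split_ifs at h with h1 h2 h2
  · exact pow_injOn_Iio_orderOf (by simpa [hα] using h1) (by simpa [hα] using h2) h
  · exact absurd h (pow_ne_zero _ h0)
  · exact absurd h.symm (pow_ne_zero _ h0)
  · omega

omit [CharP F 2] in
lemma exists_elem (hF : Fintype.card F = q) (hα : orderOf α = q - 1) (h0 : α ≠ 0) (x : F) :
    ∃ j < q, elem q α j = x := by
  have hinj : Function.Injective fun i : Fin q => elem q α i := fun i j h =>
    Fin.ext (elem_injOn hα h0 i.2 j.2 h)
  have hbij := (Fintype.bijective_iff_injective_and_card _).2 ⟨hinj, by rw [Fintype.card_fin, hF]⟩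
  obtain ⟨j, hj⟩ := hbij.2 x
  exact ⟨j, j.2, hj⟩

/-! ### The arrays that are written to the output -/

/-- The elements belonging to the columns; the extra columns repeat them in the first case. -/
def columnElem (P : Config) (α : F) (p : ℕ) : F :=
  if p < P.q then elem P.q α p else if P.kind < 1 then elem P.q α (p - P.q) else 0

/-- The distinction of the extra columns. -/
def columnMark (P : Config) (p : ℕ) : F := if p < P.q then 0 else 1

/-- The cubes, and the powers that take their place in the extra columns. -/
def columnCube (P : Config) (α : F) (p : ℕ) : F :=
  if p < P.q then elem P.q α p ^ 3 else α ^ ((2 ^ P.m - 1) * (p - P.q))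

variable {P : Config}

omit [Fintype F] in
lemma yValue_eq (hq : 2 ≤ P.q) (hα : orderOf α = P.q - 1)
    (hS : ∀ t < P.q - 1, S t = ψ (α ^ t)) (b p : ℕ) :
    yValue P S (elemExp P.q b) p = traceChar P.r ψ (elem P.q α b * columnElem P α p) := by
  have hs : ∀ j, elemExp P.q b < 4 * P.q → elemExp P.q j < 4 * P.q →
      elemExp P.q b + elemExp P.q j < 4 * P.q := fun j h1 h2 => by
    have := elemExp_lt h1; have := elemExp_lt h2; omega
  refine traceTable_eq hq hα hS ((isExp_elem b).mul ?_ ?_)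
  · unfold columnElem
    split_ifs
    · exact isExp_elem p
    · exact isExp_elem _
    · exact Or.inr ⟨le_rfl, rfl⟩
  · split_ifs
    · exact hs _
    · exact hs _
    · omega

omit [Fintype F] in
lemma xValue_eq_kerdockForm (hq : 2 ≤ P.q) (hα : orderOf α = P.q - 1)
    (hS : ∀ t < P.q - 1, S t = ψ (α ^ t)) (hk : P.kind < 1) {a p : ℕ} :
    xValue P S (elemExp P.q a) p = kerdockForm P.r (P.m - 1) ψ (fun p : ℕ => columnElem P α p)
      (fun p => columnMark P p) (elem P.q α a) p := by
  have hs : ∀ j, elemExp P.q a < 4 * P.q → elemExp P.q j < 4 * P.q →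
      elemExp P.q a + elemExp P.q j < 4 * P.q := fun j h1 h2 => by
    have := elemExp_lt h1; have := elemExp_lt h2; omega
  unfold xValue kerdockForm columnElem columnMark
  simp only [if_pos hk]
  split_ifs
  · rw [quadTable_eq hq hα hS ((isExp_elem a).mul (isExp_elem p) (hs p)), zero_mul,
      AddChar.map_zero_eq_one, mul_one]
  · rw [quadTable_eq hq hα hS ((isExp_elem a).mul (isExp_elem _) (hs _)), one_mul,
      traceTable_eq hq hα hS ((isExp_elem a).mul (isExp_elem _) (hs _))]

omit [Fintype F] in
lemma xValue_eq_traceForm (hq : 2 ≤ P.q) (hα : orderOf α = P.q - 1)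
    (hS : ∀ t < P.q - 1, S t = ψ (α ^ t)) (hk : ¬ P.kind < 1) {a p : ℕ}
    (hp : (2 ^ P.m - 1) * (p - P.q) ≤ P.q) :
    xValue P S (elemExp P.q a) p = traceForm P.r ψ (fun p : ℕ => columnCube P α p)
      (elem P.q α a) p := by
  unfold xValue traceForm columnCube
  simp only [if_neg hk]
  split_ifs
  · refine traceTable_eq hq hα hS ((isExp_elem a).mul ?_ fun h1 h2 => ?_)
    · rcases isExp_elem (q := P.q) (α := α) p with ⟨h1, h2⟩ | ⟨h1, h2⟩
      · have := elemExp_lt h1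
        exact Or.inl ⟨by omega, by rw [h2, ← pow_mul, mul_comm]⟩
      · exact Or.inr ⟨by omega, by rw [h2]; simp⟩
    · have := elemExp_lt h1
      have := elemExp_lt (q := P.q) (j := p) (by omega)
      omega
  · refine traceTable_eq hq hα hS ((isExp_elem a).mul (Or.inl ⟨by omega, rfl⟩) fun h1 h2 => ?_)
    have := elemExp_lt h1
    omega

omit [Fintype F] in
/-- The output of the code lists the rows of the array, scaled by `ρ`. -/
lemma codeOutput_eq {Sg : Type} {Φ : F → Fin P.n → ℝ} {y : Fin P.n → F} {sg : Sg → Fin P.n → ℝ}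
    {ls : List Sg} {σ : Sg → ℝ × ℝ} (hσ : signChoices P.kind = ls.map σ)
    (hcoord : ∀ (a b : ℕ) (s : Sg) (p : Fin P.n), codeCoord P S a b (σ s) p =
      P.ρ * signArray P.r ψ Φ y sg (elem P.q α a, elem P.q α b, s) p) :
    (List.range P.q).flatMap (firstOutput P S) =
      ((List.range P.q).map (elem P.q α) ×ˢ ((List.range P.q).map (elem P.q α) ×ˢ ls)).flatMap
        fun i => List.ofFn (fun p => P.ρ * signArray P.r ψ Φ y sg i p) ++ [P.w] := by
  have h1 : ∀ a b s, codeOutput P S a b (σ s) = List.ofFn (fun p => P.ρ *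
      signArray P.r ψ Φ y sg (elem P.q α a, elem P.q α b, s) p) ++ [P.w] := fun a b s => by
    rw [codeOutput, pointOutput, ← funext (hcoord a b s), List.ofFn_eq_map,
      ← List.map_coe_finRange_eq_range,
      List.map_map]
    rfl
  have hprod : ∀ {A B : Type} (l : List A) (l' : List B), l ×ˢ l' =
      l.flatMap fun a => l'.map (Prod.mk a) := fun _ _ => rfl
  simp only [hprod, List.flatMap_assoc, List.flatMap_map]
  refine List.flatMap_congr fun a _ => ?_
  rw [firstOutput]
  refine List.flatMap_congr fun b _ => ?_
  rw [hσ, List.flatMap_map]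
  exact List.flatMap_congr fun s _ => h1 a b s

omit [CharP F 2] in
lemma product_complete {Sg : Type} {ls : List Sg} (hF : Fintype.card F = q) (hα : orderOf α = q - 1)
    (h0 : α ≠ 0) (hnd : ls.Nodup) (hls : ∀ s, s ∈ ls) :
    ((List.range q).map (elem q α) ×ˢ ((List.range q).map (elem q α) ×ˢ ls)).Nodup ∧
      ∀ i, i ∈ ((List.range q).map (elem q α) ×ˢ ((List.range q).map (elem q α) ×ˢ ls)) := by
  have h1 : ((List.range q).map (elem q α)).Nodup := List.nodup_range.map_on
    fun i hi j hj h => elem_injOn hα h0 (List.mem_range.1 hi) (List.mem_range.1 hj) h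
  have h2 : ∀ x, x ∈ (List.range q).map (elem q α) := fun x => by
    obtain ⟨j, hj, h⟩ := exists_elem hF hα h0 x
    exact List.mem_map.2 ⟨j, List.mem_range.2 hj, h⟩
  exact ⟨h1.product (h1.product hnd), fun i =>
    List.pair_mem_product.2 ⟨h2 _, List.pair_mem_product.2 ⟨h2 _, hls _⟩⟩⟩

end Meaning

/-- The output for the code lists the rows of a sign design. -/
def ListsSignDesign (P : Config) (S : ℕ → ℝ) : Prop :=
  ∃ (ι : Type) (_ : Fintype ι) (σ : ι → Fin P.n → ℝ) (l : List ι), IsSignDesign σ ∧ l.Nodup ∧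
    (∀ i, i ∈ l) ∧ Fintype.card ι = (if P.kind < 2 then 4 else 2) * P.q ^ 2 ∧
    (List.range P.q).flatMap (firstOutput P S) =
      l.flatMap fun i => List.ofFn (fun p => P.ρ * σ i p) ++ [P.w]

section Designs

variable {F : Type} [Field F] [Fintype F] [CharP F 2] {α : F} {ψ : AddChar F ℝ} {S : ℕ → ℝ}
  {P : Config}

lemma signChoices_pair (hk : P.kind < 2) : signChoices P.kind =
    [((1, 1) : ℤˣ × ℤˣ), (-1, -1), (1, -1), (-1, 1)].map
      fun s => (((s.1 : ℤ) : ℝ), ((s.2 : ℤ) : ℝ)) := by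
  simp [signChoices, hk]

lemma signChoices_const (hk : ¬ P.kind < 2) : signChoices P.kind =
    ([1, -1] : List ℤˣ).map fun s : ℤˣ => (((s : ℤ) : ℝ), ((s : ℤ) : ℝ)) := by
  simp [signChoices, hk]

/-- In the two cases with extra columns it suffices to know the strength of the array. -/
lemma listsSignDesign_of_pair {Φ : F → Fin P.n → ℝ} (hk : P.kind < 2) (hq : 2 ≤ P.q)
    (hF : Fintype.card F = P.q) (hα : orderOf α = P.q - 1) (h0 : α ≠ 0)
    (hS : ∀ t < P.q - 1, S t = ψ (α ^ t))
    (hx : ∀ a (p : Fin P.n), xValue P S (elemExp P.q a) p = Φ (elem P.q α a) p)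
    (hdesign : IsSignDesign (signArray P.r ψ Φ (fun p => columnElem P α p)
      (signPair fun p : Fin P.n => (columnMark P p : F)))) : ListsSignDesign P S := by
  obtain ⟨h1, h2⟩ := product_complete (ls := [((1, 1) : ℤˣ × ℤˣ), (-1, -1), (1, -1), (-1, 1)]) hF hα
    h0 (by decide) (by decide)
  refine ⟨_, inferInstance, _, _, hdesign, h1, h2, ?_, codeOutput_eq (signChoices_pair hk)
    fun a b s p => ?_⟩
  · rw [if_pos hk]
    simp only [Fintype.card_prod, hF, Fintype.card_units_int]
    ring
  · rw [codeCoord, hx, yValue_eq hq hα hS, signArray, signPair]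
    congr 2
    unfold columnMark
    by_cases h : (p : ℕ) < P.q
    · simp [h]
    · simp [h]

theorem listsSignDesign {n : ℕ} {ρ A β w' : ℝ} (hn : 6 ≤ n) (hP : P.Valid n ρ A β w')
    (hS : IsFieldSequence P.r S) : ListsSignDesign P S := by
  obtain ⟨F, _, _, _, α, ψ, hF, hψ, hα, hS⟩ := hS
  have hr := hP.two_le_r hn
  have hn' := hP.n_eq
  have hm := hP.one_le_m
  have hlt := hP.lt_n
  have hrq : P.r < P.q := by rw [hP.q_eq]; exact Nat.lt_two_pow_self
  rw [← hP.q_eq] at hF hα hS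
  have hq : 2 ≤ P.q := by omega
  have h0 : α ≠ 0 := by
    rintro rfl
    have := pow_orderOf_eq_one (0 : F)
    rw [hα, zero_pow (by omega)] at this
    exact zero_ne_one this
  have hmark : ∀ p, (columnMark P p : F) = 0 ↔ p < P.q := fun p => by
    unfold columnMark; split_ifs with h <;> simp [h]
  have hmark1 : ∀ p, (columnMark P p : F) = 1 ↔ ¬ p < P.q := fun p => by
    unfold columnMark; split_ifs with h <;> simp [h]
  have hmark' : ∀ p : Fin P.n, (columnMark P p : F) = 0 ∨ (columnMark P p : F) = 1 := fun p => by
    unfold columnMark; split_ifs <;> simp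
  have hfull : P.q < n → ∀ x, ∃ p : Fin P.n, (columnMark P p : F) = 0 ∧ columnElem P α p = x := by
    intro hqn x
    obtain ⟨j, hj, rfl⟩ := exists_elem hF hα h0 x
    exact ⟨⟨j, by omega⟩, (hmark _).2 hj, if_pos hj⟩
  rcases hP.cases with ⟨hk, hPr, hn2⟩ | ⟨hk, hPr, hn1, hn2⟩ | ⟨hk, hPr, hn1, hn2⟩
  · have hr' : P.r = 2 * (P.m - 1) + 1 := by omega
    have hqn : P.q < n := by rw [hP.q_eq, hPr]; exact hlt
    have hq2 : n ≤ 2 * P.q := by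
      rw [hP.q_eq, hPr, ← pow_succ', show 2 * P.m - 1 + 1 = 2 * P.m by omega]; exact hn2
    refine listsSignDesign_of_pair (Φ := kerdockForm P.r (P.m - 1) ψ
      (fun p : Fin P.n => columnElem P α p) fun p => columnMark P p) (by omega) hq hF hα h0 hS
      (fun a p => xValue_eq_kerdockForm hq hα hS (by omega)) ?_
    have key := kerdock_isSignDesign (h := P.m - 1) (ψ := ψ)
      (y := fun p : Fin P.n => columnElem P α p) (e := fun p => columnMark P p) (by omega)
      (by rw [hF, hP.q_eq, hr']) hψ hmark' ?_ (hfull hqn)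
      ⟨⟨P.q, by omega⟩, fun h => lt_irrefl _ ((hmark _).1 h)⟩
    · rw [← hr'] at key
      exact key
    · intro p p' hy he
      have hiff : (p : ℕ) < P.q ↔ (p' : ℕ) < P.q := by
        rw [← hmark, ← hmark]; exact ⟨fun h => he ▸ h, fun h => he ▸ h⟩
      simp only [columnElem, hk, zero_lt_one, if_true] at hy
      have := p.2
      have := p'.2
      by_cases hp : (p : ℕ) < P.q
      · rw [if_pos hp, if_pos (hiff.1 hp)] at hy
        exact Fin.ext (elem_injOn hα h0 hp (hiff.1 hp) hy)
      · rw [if_neg hp, if_neg (fun h => hp (hiff.2 h))] at hy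
        have := elem_injOn hα h0 (by omega) (by omega) hy
        exact Fin.ext (by omega)
  · have hqn : P.q < n := by rw [hP.q_eq, hPr]; exact hn1
    have hq' : P.q = 2 ^ P.m * 2 ^ P.m := by rw [hP.q_eq, hPr, two_mul, pow_add]
    have h2m : 2 ≤ 2 ^ P.m := by
      calc 2 = 2 ^ 1 := rfl
        _ ≤ 2 ^ P.m := Nat.pow_le_pow_right (by norm_num) hm
    rw [← hPr, ← hP.q_eq] at hn2
    obtain ⟨M, hM⟩ : ∃ M, 2 ^ P.m = M + 1 := ⟨2 ^ P.m - 1, by omega⟩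
    have hM1 : 2 ^ P.m - 1 = M := by omega
    have hE : P.q - 1 = M * (2 ^ P.m + 1) := by
      rw [hq', hM, show (M + 1) * (M + 1) = M * (M + 1 + 1) + 1 by ring, Nat.add_sub_cancel]
    have hcubeq : ∀ p : Fin P.n, ¬ (p : ℕ) < P.q →
        columnCube P α p = α ^ (M * (p - P.q)) := fun p hp => by
      rw [columnCube, if_neg hp, hM1]
    have hginj : ∀ p p' : Fin P.n, (columnMark P p : F) = 1 → (columnMark P p' : F) = 1 →
        columnCube P α p = columnCube P α p' → p = p' := by
      intro p p' hp hp' hg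
      rw [hmark1] at hp hp'
      rw [hcubeq p hp, hcubeq p' hp'] at hg
      have hlt' : ∀ p : Fin P.n, M * (p - P.q) < P.q - 1 := fun p => by
        have := p.2
        rw [hE]
        exact Nat.mul_lt_mul_of_pos_left (by omega) (by omega)
      have := pow_injOn_Iio_orderOf (by simpa [hα] using hlt' p) (by simpa [hα] using hlt' p') hg
      have := Nat.eq_of_mul_eq_mul_left (by omega : 0 < M) this
      exact Fin.ext (by omega)
    refine listsSignDesign_of_pair (Φ := traceForm P.r ψ fun p : Fin P.n => columnCube P α p)
      (by omega) hq hF hα h0 hS (fun a p => xValue_eq_traceForm hq hα hS (by omega)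
      (hP.cycle (by omega) (hn' ▸ p.2))) ?_
    refine cubicPair_isSignDesign (by rw [hF, hP.q_eq]) (by omega) hψ hmark' ?_ ?_ ?_ hginj ?_
      (hfull hqn) ⟨⟨P.q, by omega⟩, (hmark1 _).2 (lt_irrefl _)⟩ ?_
    · intro p p' hp hp' hy
      rw [hmark] at hp hp'
      simp only [columnElem, if_pos hp, if_pos hp'] at hy
      exact Fin.ext (elem_injOn hα h0 hp hp' hy)
    · intro p hp
      rw [hmark] at hp
      simp only [columnElem, columnCube, if_pos hp]
    · intro p hp
      rw [hmark1] at hp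
      simp [columnElem, if_neg hp, hk]
    · intro a b c d ha hb hc hd hab hac hbc h
      have hone : ∀ p : Fin P.n, (columnMark P p : F) = 1 →
          columnCube P α p ^ (2 ^ P.m + 1) = 1 := fun p hp => by
        rw [hmark1] at hp
        rw [hcubeq p hp, ← pow_mul, mul_right_comm, ← hE, pow_mul, ← hα,
          pow_orderOf_eq_one, one_pow]
      exact norm_one_sidon (hone a ha) (hone b hb) (hone c hc) (hone d hd)
        (fun h => hab (hginj _ _ ha hb h)) (fun h => hac (hginj _ _ ha hc h))
        (fun h => hbc (hginj _ _ hb hc h)) h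
    · rcases hm.eq_or_lt with h1 | h1
      · -- the field with four elements, where the extra columns have different traces
        right
        have hr2 : P.r = 2 := by omega
        have hq4 : P.q = 4 := by rw [hP.q_eq, hr2]; rfl
        have hM : M = 1 := by rw [← hM1, ← h1]; rfl
        rw [← h1] at hn2
        refine ⟨⟨4, by omega⟩, ⟨5, by omega⟩, (hmark1 _).2 (by simp [hq4]),
          (hmark1 _).2 (by simp [hq4]), ?_⟩
        rw [hcubeq _ (by simp [hq4]), hcubeq _ (by simp [hq4])]
        simp only [hq4, hM, hr2, traceChar_apply, trace2, Finset.sum_range_succ,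
          Finset.sum_range_zero, zero_add]
        norm_num
        have h3 : α ^ 3 = 1 := by
          have := pow_orderOf_eq_one α
          rwa [hα, hq4] at this
        have hne : α - 1 ≠ 0 := fun h => by
          rw [sub_eq_zero] at h
          rw [h, orderOf_one] at hα
          omega
        have h4 : α + α ^ 2 = 1 := by
          have h5 : α ^ 2 + α + 1 = 0 := by
            refine (mul_eq_zero.1 ?_).resolve_left hne
            linear_combination h3
          have h6 : (2 : F) = 0 := CharTwo.two_eq_zero
          linear_combination h5 - h6
        have h7 : (2 : F) = 0 := CharTwo.two_eq_zero
        rw [h4, hψ, h7, AddChar.map_zero_eq_one]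
        norm_num
      · left
        refine ⟨α, h0, fun h => ?_⟩
        have h4 : 4 ≤ 2 ^ P.m := by
          calc 4 = 2 ^ 2 := rfl
            _ ≤ 2 ^ P.m := Nat.pow_le_pow_right (by norm_num) h1
        have h5 := Nat.le_of_dvd (by norm_num) (orderOf_dvd_of_pow_eq_one h)
        rw [hα, hE] at h5
        nlinarith
  · have hqn : n ≤ P.q := by rw [hP.q_eq, hPr]; exact hn2
    have hk2 : ¬ P.kind < 2 := by omega
    have hcol : ∀ p : Fin P.n, columnElem P α p = elem P.q α p := fun p =>
      if_pos (by have := p.2; omega)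
    have hdesign := cubic_isSignDesign (r := P.r) (ψ := ψ) (by rw [hF, hP.q_eq]) ⟨P.m, hPr⟩ hψ
      (y := fun p : Fin P.n => columnElem P α p) (fun p p' h => ?_) ?_ ?_
    · obtain ⟨h1, h2⟩ := product_complete (ls := [(1 : ℤˣ), -1]) hF hα h0 (by decide) (by decide)
      refine ⟨_, inferInstance, _, _, hdesign, h1, h2, ?_, codeOutput_eq (signChoices_const hk2)
        fun a b s p => ?_⟩
      · rw [if_neg hk2]
        simp only [Fintype.card_prod, hF, Fintype.card_units_int]
        ring
      · rw [codeCoord, yValue_eq hq hα hS, signArray, signConst, ite_self,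
          xValue_eq_traceForm hq hα hS (by omega) (hP.cycle (by omega) (hn' ▸ p.2))]
        simp only [traceForm, hcol]
        rw [columnCube, if_pos (by have := p.2; omega)]
    · have := p.2
      have := p'.2
      simp only [hcol] at h
      exact Fin.ext (elem_injOn hα h0 (by omega) (by omega) h)
    · rw [Fintype.card_fin, hn', ← hP.q_eq]
      exact hP.q_lt
    · rw [Fintype.card_fin, hn', hPr]
      have h1 : (2 : ℝ) ^ (2 * P.m) + 2 ^ P.m < n := by exact_mod_cast hn1
      have h2 : (2 : ℝ) ^ (2 * P.m) = 2 ^ P.m * 2 ^ P.m := by rw [two_mul, pow_add]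
      have h3 : (0 : ℝ) < 2 ^ P.m := by positivity
      rw [pow_succ, h2]
      rw [h2] at h1
      have h4 : 2 * (2 : ℝ) ^ P.m < 2 * n - 2 ^ P.m * 2 ^ P.m * 2 := by linarith
      nlinarith

end Designs

/-! ### The output as a list of points -/

lemma pointOutput_eq (n : ℕ) (x : ℕ → ℝ) (w : ℝ) :
    pointOutput n x w = List.ofFn (fun p : Fin n => x p) ++ [w] := by
  rw [pointOutput, List.ofFn_eq_map, ← List.map_coe_finRange_eq_range, List.map_map]
  rfl

lemma isListing_formulaOutput {P : Config} {S : ℕ → ℝ} {ι : Type} [Fintype ι]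
    {σ : ι → Fin P.n → ℝ} {l : List ι} (hσ : IsSignDesign σ) (hnd : l.Nodup) (hl : ∀ i, i ∈ l)
    (hout : (List.range P.q).flatMap (firstOutput P S) =
      l.flatMap fun i => List.ofFn (fun p => P.ρ * σ i p) ++ [P.w])
    (hn : 2 ≤ P.n) (hρ : P.ρ ≠ 0) (hβ : 0 < P.β) :
    (designFormula σ P.ρ P.w P.β P.w').IsListing (formulaOutput P S) := by
  refine ⟨l.map (fun i => codePoint P.ρ (σ i)) ++
    (List.finRange P.n).flatMap fun j => [axisPoint P.β j, axisPoint (-P.β) j], ?_, ?_, ?_⟩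
  · refine List.Nodup.append (hnd.map (codePoint_injective hσ hρ)) ?_ ?_
    · refine List.nodup_flatMap.2 ⟨fun j _ => ?_, (List.nodup_finRange _).imp fun {i j} hij => ?_⟩
      · simpa using axisPoint_ne_axisPoint_neg hβ j j
      · have h1 := fun h => hij (axisPoint_injective hβ.ne' h)
        have h2 := fun h => hij (axisPoint_injective (neg_ne_zero.2 hβ.ne') h)
        have h3 := axisPoint_ne_axisPoint_neg hβ i j
        have h4 := (axisPoint_ne_axisPoint_neg hβ j i).symm
        simp [Function.onFun, List.disjoint_left, h3, h4]
        exact ⟨h1, h2⟩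
    · intro x hx hx'
      obtain ⟨i, -, rfl⟩ := List.mem_map.1 hx
      obtain ⟨j, -, h⟩ := List.mem_flatMap.1 hx'
      simp only [List.mem_cons, List.not_mem_nil, or_false] at h
      rcases h with h | h <;> exact codePoint_ne_axisPoint hσ hρ hn i _ j h
  · intro x
    simp [designFormula, hl, eq_comm, exists_or]
  · rw [List.flatMap_append, List.flatMap_map, formulaOutput, hout, List.flatMap_assoc]
    congr 1
    · refine List.flatMap_congr fun i _ => ?_
      rw [weight_codePoint hσ hρ]
      rfl
    · rw [← List.map_coe_finRange_eq_range, List.flatMap_map]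
      refine List.flatMap_congr fun j _ => ?_
      simp only [List.flatMap_cons, List.flatMap_nil, List.append_nil, weight_axisPoint hn,
        axisOutput, pointOutput_eq]
      simp only [axisPoint, Fin.ext_iff]

lemma Formula.IsListing.length {n : ℕ} {F : Formula n} {out : List ℝ} (h : F.IsListing out) :
    out.length = F.points.card * (n + 1) := by
  obtain ⟨l, hnd, hl, rfl⟩ := h
  classical
  have : F.points = l.toFinset := by ext p; rw [List.mem_toFinset, hl]
  rw [this, List.toFinset_card_of_nodup hnd, List.length_flatMap]
  simp [List.map_const', List.sum_replicate]

/-! ### Families of formulas -/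

lemma isQuasilinear_mul (C : ℕ) : IsQuasilinear fun L => C * L := by
  refine ⟨0, ?_⟩
  simp only [pow_zero, one_mul, Nat.cast_mul]
  exact Asymptotics.isBigO_const_mul_self _ _ _

lemma Config.Valid.le_two_mul_q {P : Config} {n : ℕ} {ρ A β w' : ℝ} (h : P.Valid n ρ A β w') :
    n ≤ 2 * P.q := by
  have h1 := h.one_le_m
  rcases h.cases with ⟨-, hr, h2⟩ | ⟨-, hr, -, h2⟩ | ⟨-, hr, -, h2⟩ <;> rw [h.q_eq, hr]
  · rw [← pow_succ', show 2 * P.m - 1 + 1 = 2 * P.m by omega]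
    exact h2
  · have := Nat.pow_le_pow_right (n := 2) (by norm_num) (by omega : P.m ≤ 2 * P.m)
    omega
  · omega

lemma Config.Valid.card_eq {P : Config} {n : ℕ} {ρ A β w' : ℝ} (h : P.Valid n ρ A β w')
    (hn : 6 ≤ n) {k : ℕ → ℕ}
    (hk : ∀ n m : ℕ, 6 ≤ n → 1 ≤ m →
      (2 ^ (2 * m - 1) < n → n ≤ 2 ^ (2 * m) → k n = 4 * m) ∧
      (2 ^ (2 * m) < n → n ≤ 2 ^ (2 * m) + 2 ^ m → k n = 4 * m + 2) ∧
      (2 ^ (2 * m) + 2 ^ m < n → n ≤ 2 ^ (2 * m + 1) → k n = 4 * m + 3)) :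
    (if P.kind < 2 then 4 else 2) * P.q ^ 2 = 2 ^ k n := by
  have h1 := h.one_le_m
  obtain ⟨k0, k1, k2⟩ := hk n P.m hn h1
  rcases h.cases with ⟨hk, hr, h2⟩ | ⟨hk, hr, h2, h3⟩ | ⟨hk, hr, h2, h3⟩ <;>
    rw [h.q_eq, hr, hk, ← pow_mul]
  · rw [k0 h.lt_n h2, if_pos (by norm_num), show 4 = 2 ^ 2 by rfl, ← pow_add]
    congr 1
    omega
  · rw [k1 h2 h3, if_pos (by norm_num), show 4 = 2 ^ 2 by rfl, ← pow_add]
    congr 1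
    omega
  · rw [k2 h2 h3, if_neg (by norm_num), ← pow_succ']
    congr 1
    omega

/-- The radii `ρ` and `β`, the total weight `A` of the code and the weight `w'` of the points on the
axes are such that the formula of degree five is exact, positive and interior for `μ`. -/
structure IsParameters {n : ℕ} (μ : Measure (EuclideanSpace ℝ (Fin n))) (ρ A β w' c₂ c₄ : ℝ) :
    Prop where
  moments : HasMoments μ c₂ c₄
  ρ_pos : 0 < ρ
  A_pos : 0 < A
  β_pos : 0 < β
  w'_pos : 0 < w'
  eq0 : A + 2 * n * w' = 1
  eq2 : A * ρ ^ 2 + 2 * w' * β ^ 2 = c₂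
  eq4 : A * ρ ^ 4 = c₄
  eq4' : w' * β ^ 4 = c₄
  interior : ∀ x : EuclideanSpace ℝ (Fin n),
    ‖x‖ ^ 2 = n * ρ ^ 2 ∨ ‖x‖ ^ 2 = β ^ 2 → x ∈ geomInterior μ.support

theorem exists_formula {k : ℕ → ℕ}
    (hk : ∀ n m : ℕ, 6 ≤ n → 1 ≤ m →
      (2 ^ (2 * m - 1) < n → n ≤ 2 ^ (2 * m) → k n = 4 * m) ∧
      (2 ^ (2 * m) < n → n ≤ 2 ^ (2 * m) + 2 ^ m → k n = 4 * m + 2) ∧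
      (2 ^ (2 * m) + 2 ^ m < n → n ≤ 2 ^ (2 * m + 1) → k n = 4 * m + 3))
    {n T : ℕ} (hn : 6 ≤ n) {μ : Measure (EuclideanSpace ℝ (Fin n))} {ρ A β w' c₂ c₄ : ℝ}
    {p : Program} (hμ : IsParameters μ ρ A β w' c₂ c₄) (hp : ComputesParameters p n T ρ A β w') :
    ∃ F : Formula n, (F.IsCubature 5 μ ∧ F.IsPositive ∧ F.IsInterior μ ∧
      F.points.card = 2 ^ k n + 2 * n) ∧ ∃ (t : ℕ) (s : MachineState),
      Exec (formulaProgram p) (startState n) t s ∧ F.IsListing s.out ∧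
        t ≤ (T + 1400) * s.out.length := by
  obtain ⟨t, s, hexec, ht, P, S, hP, hS, hout⟩ := formulaProgram_runs hn hp
  obtain ⟨ι, _, σ, l, hσ, hnd, hl, hcard, hlist⟩ := listsSignDesign hn hP hS
  have hcard' := hP.card_eq hn hk
  have hq := hP.le_two_mul_q
  have hw := hP.w_eq
  obtain ⟨n', kind, m, r, q, half, ρ', w, β', w''⟩ := P
  obtain ⟨rfl, rfl, rfl, rfl⟩ : n' = n ∧ ρ' = ρ ∧ β' = β ∧ w'' = w' :=
    ⟨hP.n_eq, hP.ρ_eq, hP.β_eq, hP.w'_eq⟩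
  simp only at *
  have hn2 : 2 ≤ n' := by omega
  have hq0 : 0 < q := by omega
  have hι : 0 < Fintype.card ι := by rw [hcard]; split_ifs <;> positivity
  have hwA : w * Fintype.card ι = A := by
    rw [hw, hcard]
    push_cast
    rw [div_mul_cancel₀]
    split_ifs <;> positivity
  have hw0 : 0 < w := by
    have : (0 : ℝ) < Fintype.card ι := by exact_mod_cast hι
    by_contra! h
    have := mul_nonpos_of_nonpos_of_nonneg h this.le
    linarith [hμ.A_pos]
  have hlisting := isListing_formulaOutput hσ hnd hl hlist hn2 hμ.ρ_pos.ne'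
    hμ.β_pos
  simp only at hlisting
  have hF := card_designFormula (w := w) (w' := w'') hσ hμ.ρ_pos.ne' hμ.β_pos hn2
  refine ⟨designFormula σ ρ' w β' w'', ⟨designFormula_isCubature hμ.moments hσ hn2
    hμ.ρ_pos.ne' hμ.β_pos (by rw [hwA]; exact hμ.eq0) (by rw [hwA]; exact hμ.eq2)
    (by rw [hwA]; exact hμ.eq4) hμ.eq4', designFormula_isPositive hw0 hμ.w'_pos,
    designFormula_isInterior hσ hμ.interior, by rw [hF, hcard, hcard']⟩, t, s, hexec,
    by rw [hout]; exact hlisting, ht.trans ?_⟩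
  rw [hout, hlisting.length, hF, hcard]
  have h1 : 2 * q ^ 2 ≤ (if kind < 2 then 4 else 2) * q ^ 2 := by split_ifs <;> omega
  have h2 : n' ^ 3 ≤ 2 * (((if kind < 2 then 4 else 2) * q ^ 2 + 2 * n') * (n' + 1)) := by
    calc n' ^ 3 = n' * n' * n' := by ring
      _ ≤ (2 * q) * (2 * q) * (n' + 1) := by gcongr; omega
      _ = 2 * ((2 * q ^ 2) * (n' + 1)) := by ring
      _ ≤ _ := by gcongr; omega
  have h3 : 1 ≤ ((if kind < 2 then 4 else 2) * q ^ 2 + 2 * n') * (n' + 1) :=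
    Nat.mul_pos (by omega) (by omega)
  generalize ((if kind < 2 then 4 else 2) * q ^ 2 + 2 * n') * (n' + 1) = L at *
  nlinarith

theorem admitQLPI_of_parameters {k : ℕ → ℕ}
    (hk : ∀ n m : ℕ, 6 ≤ n → 1 ≤ m →
      (2 ^ (2 * m - 1) < n → n ≤ 2 ^ (2 * m) → k n = 4 * m) ∧
      (2 ^ (2 * m) < n → n ≤ 2 ^ (2 * m) + 2 ^ m → k n = 4 * m + 2) ∧
      (2 ^ (2 * m) + 2 ^ m < n → n ≤ 2 ^ (2 * m + 1) → k n = 4 * m + 3))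
    {μ : ∀ n, Measure (EuclideanSpace ℝ (Fin n))} {p : Program} {T : ℕ}
    (h : ∀ n, 6 ≤ n → ∃ ρ A β w' c₂ c₄, IsParameters (μ n) ρ A β w' c₂ c₄ ∧
      ComputesParameters p n T ρ A β w') :
    AdmitQLPI 5 6 μ fun n => 2 ^ k n + 2 * n := by
  have hF : ∀ n, ∃ F : Formula n, 6 ≤ n → (F.IsCubature 5 (μ n) ∧ F.IsPositive ∧
      F.IsInterior (μ n) ∧ F.points.card = 2 ^ k n + 2 * n) ∧ ∃ (t : ℕ) (s : MachineState),
      Exec (formulaProgram p) (startState n) t s ∧ F.IsListing s.out ∧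
        t ≤ (T + 1400) * s.out.length := fun n => by
    by_cases hn : 6 ≤ n
    · obtain ⟨ρ, A, β, w', c₂, c₄, h1, h2⟩ := h n hn
      obtain ⟨F, hF⟩ := exists_formula hk hn h1 h2
      exact ⟨F, fun _ => hF⟩
    · exact ⟨⟨∅, fun _ => 0⟩, fun h => absurd h hn⟩
  choose F hF using hF
  exact ⟨F, fun n hn => (hF n hn).1, formulaProgram p, _, isQuasilinear_mul (T + 1400),
    fun n hn => (hF n hn).2⟩

/-! ### Parameters for the three measures -/

/-- Preparation of the real numbers `n`, `1`, `2`, `n + 2` in the cells `10`, `11`, `12`, `14`. -/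
def prepare : Program := block [.setNat 1 1, .setNat 20 2, .castReal 10 0, .castReal 11 1,
  .castReal 12 20, .addReal 14 10 12]

lemma prepare_runs (n : ℕ) : Runs prepare (startState n) 7 fun s => s.nat 0 = n ∧ s.nat 20 = 2 ∧
    s.out = [] ∧ s.real 10 = n ∧ s.real 11 = 1 ∧ s.real 12 = 2 ∧ s.real 13 = 0 ∧
    s.real 14 = n + 2 := by
  refine WP.runs_le ?_ (by simp [prepare, block, cost])
  simp [prepare, block, WP, startState, Function.update_apply]

/-- The parameters for the sphere: `ρ = 1 / √n`, `A = n / (n + 2)`, `β = 1` and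
`w' = 1 / (n * (n + 2))`. -/
def sphereProgram : Program := block [prepare, block [.sqrtReal 3 10, .divReal 3 11 3,
  .addReal 5 11 13, .divReal 4 10 14, .mulReal 15 10 14, .divReal 6 11 15]]

lemma sphereProgram_runs {n : ℕ} (hn : 0 < n) : ComputesParameters sphereProgram n 20
    (1 / √n) (n / (n + 2)) 1 (1 / (n * (n + 2))) := by
  refine Runs.mono (T := 7 + (7 + 1)) (Runs.block_cons (prepare_runs n) fun s h => Runs.block_cons
    (WP.runs_le ?_ (by simp [block, cost])) fun s' h' => Runs.block_nil h') (by norm_num)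
    fun _ h => h
  obtain ⟨h0, -, ho, h10, h11, h12, h13, h14⟩ := h
  have h1 : (n : ℝ) + 2 ≠ 0 := by positivity
  have h2 : √(n : ℝ) ≠ 0 := by positivity
  simp [block, WP, Function.update_apply, h0, ho, h10, h11, h12, h13, h14, h1, h2,
    hn.ne']

/-- The parameters for the Gaussian measure: with `u = (n - 2) / (n + 2)` and `v = 2 / (n + 2)`,
`ρ = √(1 / u)`, `A = u ^ 2`, `β = √(1 / v)` and `w' = v ^ 2`. -/
def gaussianProgram : Program := block [prepare, block [.subReal 15 10 12, .divReal 15 15 14,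
  .divReal 16 12 14, .divReal 3 11 15, .sqrtReal 3 3, .divReal 5 11 16, .sqrtReal 5 5,
  .mulReal 4 15 15, .mulReal 6 16 16]]

lemma gaussianProgram_runs {n : ℕ} (hn : 2 < n) : ComputesParameters gaussianProgram n 20
    √(1 / ((n - 2) / (n + 2))) ((n - 2) / (n + 2) * ((n - 2) / (n + 2))) √(1 / (2 / (n + 2)))
    (2 / (n + 2) * (2 / (n + 2))) := by
  refine Runs.mono (T := 7 + (10 + 1)) (Runs.block_cons (prepare_runs n) fun s h => Runs.block_cons
    (WP.runs_le ?_ (by simp [block, cost])) fun s' h' => Runs.block_nil h') (by norm_num)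
    fun _ h => h
  obtain ⟨h0, -, ho, h10, h11, h12, h13, h14⟩ := h
  have h1 : (n : ℝ) + 2 ≠ 0 := by positivity
  have h3 : (0 : ℝ) < n - 2 := by
    have : (2 : ℝ) < n := by exact_mod_cast hn
    linarith
  have h4 : (0 : ℝ) ≤ (n + 2) / (n - 2) := by positivity
  have h5 : (0 : ℝ) ≤ (n + 2) / 2 := by positivity
  simp [block, WP, Function.update_apply, h0, ho, h10, h11, h12, h13, h14, h1,
    h3.ne', h4, h5]

/-- The parameters for the ball, in terms of the quantities `ballU n` and `ballV n` below. -/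
def ballProgram : Program := block [prepare,
  block [.addReal 15 14 12, .addReal 16 15 15, .sqrtReal 16 16, .addReal 16 15 16,
    .divReal 16 16 14, .mulReal 17 14 15, .divReal 17 11 17, .subReal 15 15 16,
    .subReal 15 15 16],
  block [.divReal 3 11 15, .sqrtReal 3 3, .divReal 5 11 16, .sqrtReal 5 5, .mulReal 4 15 15,
    .mulReal 4 17 4, .mulReal 6 16 16, .mulReal 6 17 6]]

/-- The reciprocal of the square of the radius `β` for the ball. -/
def ballV (n : ℕ) : ℝ := (n + 4 + √(2 * (n + 4))) / (n + 2)

/-- The reciprocal of the square of the radius `ρ` for the ball. -/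
def ballU (n : ℕ) : ℝ := n + 4 - 2 * ballV n

lemma one_lt_ballV (n : ℕ) : 1 < ballV n := by
  rw [ballV, one_lt_div (by positivity)]
  have := Real.sqrt_nonneg (2 * ((n : ℝ) + 4))
  linarith

lemma lt_ballU {n : ℕ} (hn : 5 ≤ n) : n < ballU n := by
  have hn' : (5 : ℝ) ≤ n := by exact_mod_cast hn
  have h : ballV n < 2 := by
    rw [ballV, div_lt_iff₀ (by positivity)]
    have : √(2 * ((n : ℝ) + 4)) < n := by
      rw [Real.sqrt_lt' (by linarith)]
      nlinarith
    linarith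
  rw [ballU]
  linarith

/-- The total weight is one. -/
lemma ballU_ballV (n : ℕ) : ballU n ^ 2 + 2 * n * ballV n ^ 2 = (n + 2) * (n + 4) := by
  have h1 : (n : ℝ) + 2 ≠ 0 := by positivity
  have h2 := Real.sq_sqrt (by positivity : 0 ≤ 2 * ((n : ℝ) + 4))
  rw [ballU, ballV]
  generalize √(2 * ((n : ℝ) + 4)) = s at *
  field_simp
  linear_combination (2 * (n : ℝ) + 4) * h2

lemma ballProgram_runs {n : ℕ} (hn : 5 ≤ n) : ComputesParameters ballProgram n 30
    √(1 / ballU n) (1 / ((n + 2) * (n + 4)) * (ballU n * ballU n)) √(1 / ballV n)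
    (1 / ((n + 2) * (n + 4)) * (ballV n * ballV n)) := by
  have hv := one_lt_ballV n
  have hu := lt_ballU hn
  have hn' : (5 : ℝ) ≤ n := by exact_mod_cast hn
  refine Runs.mono (T := 7 + (10 + (9 + 1))) (Runs.block_cons (prepare_runs n)
    fun s h => Runs.block_cons (P := fun s => s.nat 0 = n ∧ s.out = [] ∧ s.real 11 = 1 ∧
    s.real 15 = ballU n ∧ s.real 16 = ballV n ∧ s.real 17 = 1 / ((n + 2) * (n + 4)))
    (WP.runs_le ?_ (by simp [block, cost])) fun s₁ h₁ => Runs.block_cons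
    (WP.runs_le ?_ (by simp [block, cost])) fun s₂ h₂ => Runs.block_nil h₂) (by norm_num)
    fun _ h => h
  · obtain ⟨h0, -, ho, h10, h11, h12, h13, h14⟩ := h
    have h1 : (n : ℝ) + 2 ≠ 0 := by positivity
    have e : (n : ℝ) + 2 + 2 = n + 4 := by ring
    have h2 : (n : ℝ) + 4 ≠ 0 := by positivity
    have h3 : (0 : ℝ) ≤ n + 4 + (n + 4) := by positivity
    simp [block, WP, Function.update_apply, h0, ho, h10, h11, h12, h13, h14, h1,
      h2, e, h3]
    rw [ballU, ballV, ← two_mul]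
    exact ⟨by ring, rfl⟩
  · obtain ⟨h0, ho, h11, h15, h16, h17⟩ := h₁
    have h1 : ballU n ≠ 0 := by linarith
    have h2 : ballV n ≠ 0 := by linarith
    have h3 : 0 ≤ ballU n := by linarith
    have h4 : 0 ≤ ballV n := by linarith
    simp [block, WP, Function.update_apply, h0, ho, h11, h15, h16, h17, h1, h2,
      h3, h4]

lemma sphere_isParameters {n : ℕ} (hn : 2 ≤ n) : IsParameters (sphereMeasure n) (1 / √n)
    (n / (n + 2)) 1 (1 / (n * (n + 2))) (1 / n) (1 / (n * (n + 2))) := by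
  have h0 : (0 : ℝ) < n := by exact_mod_cast (by omega : 0 < n)
  have h2 : (1 / √(n : ℝ)) ^ 2 = 1 / n := by rw [div_pow, Real.sq_sqrt h0.le, one_pow]
  have h4 : (1 / √(n : ℝ)) ^ 4 = 1 / n ^ 2 := by
    rw [show (1 / √(n : ℝ)) ^ 4 = ((1 / √(n : ℝ)) ^ 2) ^ 2 by ring, h2, div_pow, one_pow]
  refine ⟨sphereMeasure_hasMoments (by omega), by positivity, by positivity, one_pos,
    by positivity, by field_simp, ?_, ?_, by rw [one_pow, mul_one], fun x hx => ?_⟩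
  · rw [h2]; field_simp
  · rw [h4]; field_simp
  · rw [h2, mul_one_div_cancel h0.ne', one_pow, or_self] at hx
    exact mem_geomInterior_sphere (by omega) ((pow_eq_one_iff_of_nonneg (norm_nonneg x)
      two_ne_zero).1 hx)

/-- The moments and the total weight in terms of `u = 1 / ρ ^ 2` and `v = 1 / β ^ 2`. -/
lemma isParameters_of_reciprocals {n : ℕ} {μ : Measure (EuclideanSpace ℝ (Fin n))} {u v c₂ c₄ : ℝ}
    (hμ : HasMoments μ c₂ c₄) (hu : 0 < u) (hv : 0 < v) (hc : 0 < c₄)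
    (h0 : c₄ * (u ^ 2 + 2 * n * v ^ 2) = 1) (h2 : c₄ * (u + 2 * v) = c₂)
    (hint : ∀ x : EuclideanSpace ℝ (Fin n),
      ‖x‖ ^ 2 = n / u ∨ ‖x‖ ^ 2 = 1 / v → x ∈ geomInterior μ.support) :
    IsParameters μ √(1 / u) (c₄ * (u * u)) √(1 / v) (c₄ * (v * v)) c₂ c₄ := by
  have hu2 : √(1 / u) ^ 2 = 1 / u := Real.sq_sqrt (by positivity)
  have hv2 : √(1 / v) ^ 2 = 1 / v := Real.sq_sqrt (by positivity)
  have hu4 : √(1 / u) ^ 4 = 1 / u ^ 2 := by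
    rw [show √(1 / u) ^ 4 = (√(1 / u) ^ 2) ^ 2 by ring, hu2, div_pow, one_pow]
  have hv4 : √(1 / v) ^ 4 = 1 / v ^ 2 := by
    rw [show √(1 / v) ^ 4 = (√(1 / v) ^ 2) ^ 2 by ring, hv2, div_pow, one_pow]
  refine ⟨hμ, by positivity, by positivity, by positivity, by positivity, ?_, ?_, ?_, ?_,
    fun x hx => hint x ?_⟩
  · rw [← h0]; ring
  · rw [hu2, hv2, ← h2]; field_simp
  · rw [hu4]; field_simp
  · rw [hv4]; field_simp
  · rwa [hu2, hv2, mul_one_div] at hx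

lemma gaussian_isParameters {n : ℕ} (hn : 2 < n) : IsParameters (gaussianMeasure n)
    √(1 / ((n - 2) / (n + 2))) ((n - 2) / (n + 2) * ((n - 2) / (n + 2))) √(1 / (2 / (n + 2)))
    (2 / (n + 2) * (2 / (n + 2))) 1 1 := by
  have h1 : (n : ℝ) + 2 ≠ 0 := by positivity
  have h3 : (0 : ℝ) < n - 2 := by
    have : (2 : ℝ) < n := by exact_mod_cast hn
    linarith
  have := isParameters_of_reciprocals (u := (n - 2) / (n + 2)) (v := 2 / (n + 2))
    (gaussianMeasure_hasMoments n) (by positivity) (by positivity) one_pos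
    (by field_simp; ring) (by field_simp; ring) fun x _ => mem_geomInterior_gaussian x
  simpa only [one_mul] using this

lemma ball_isParameters {n : ℕ} (hn : 5 ≤ n) : IsParameters (ballMeasure n) √(1 / ballU n)
    (1 / ((n + 2) * (n + 4)) * (ballU n * ballU n)) √(1 / ballV n)
    (1 / ((n + 2) * (n + 4)) * (ballV n * ballV n)) (1 / (n + 2)) (1 / ((n + 2) * (n + 4))) := by
  have hv := one_lt_ballV n
  have hu := lt_ballU hn
  have h0 : (0 : ℝ) < n := by exact_mod_cast (by omega : 0 < n)
  refine isParameters_of_reciprocals (ballMeasure_hasMoments (by omega)) (by linarith)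
    (by linarith) (by positivity) ?_ ?_ fun x hx => mem_geomInterior_ball ?_
  · rw [ballU_ballV]; field_simp
  · rw [ballU]; field_simp; ring
  · have : ‖x‖ ^ 2 < 1 := by
      rcases hx with h | h <;> rw [h]
      · rwa [div_lt_one (by linarith)]
      · rwa [div_lt_one (by linarith)]
    exact (sq_lt_one_iff₀ (norm_nonneg x)).1 this

end Cubature

end

theorem theorem4 (k : ℕ → ℕ)
    (hk : ∀ n m : ℕ, 6 ≤ n → 1 ≤ m →
      (2 ^ (2 * m - 1) < n → n ≤ 2 ^ (2 * m) → k n = 4 * m) ∧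
      (2 ^ (2 * m) < n → n ≤ 2 ^ (2 * m) + 2 ^ m → k n = 4 * m + 2) ∧
      (2 ^ (2 * m) + 2 ^ m < n → n ≤ 2 ^ (2 * m + 1) → k n = 4 * m + 3)) :
    Cubature.AdmitQLPI 5 6 Cubature.sphereMeasure (fun n => 2 ^ k n + 2 * n) ∧
    Cubature.AdmitQLPI 5 6 Cubature.gaussianMeasure (fun n => 2 ^ k n + 2 * n) ∧
    Cubature.AdmitQLPI 5 6 Cubature.ballMeasure (fun n => 2 ^ k n + 2 * n) :=
  ⟨Cubature.admitQLPI_of_parameters hk fun _ hn => ⟨_, _, _, _, _, _,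
      Cubature.sphere_isParameters (by omega), Cubature.sphereProgram_runs (by omega)⟩,
    Cubature.admitQLPI_of_parameters hk fun _ hn => ⟨_, _, _, _, _, _,
      Cubature.gaussian_isParameters (by omega), Cubature.gaussianProgram_runs (by omega)⟩,
    Cubature.admitQLPI_of_parameters hk fun _ hn => ⟨_, _, _, _, _, _,
      Cubature.ball_isParameters (by omega), Cubature.ballProgram_runs (by omega)⟩⟩
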